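/- **Theorem.** Let $k$ be any field of characteristic $\neq 2$ containing an element $i$ with $i^2=-1$. Let $C\subset\mathbb P^2_k$ be the plane cubic curve $y^2z=x(x^2-z^2)$, let $g$ be the automorphism $(x:y:z)\mapsto(-x:iy:z)$ of order $4$ of $C$, and let $g$ act diagonally on $Z=C\times_k C\times_k C$. Let $Y=Z/\langle g\rangle$ be the quotient, and let $X\to Y$ be the blow-up of $Y$ at its singular points (that is, along the closed subset of singular points of $Y$ with its reduced scheme structure). Then the threefold $X$ (the Ueno–Campana threefold) is unirational over $k$: there is a dominant rational map $\mathbb P^3_k\dashrightarrow X$ of $k$-schemes. -/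

import Mathlib

namespace UenoCampana

universe u

noncomputable section

open CategoryTheory Limits AlgebraicGeometry Opposite TopologicalSpace

section Invariants

variable {A B : Type*} [CommRing A] [CommRing B]

/-- The subring of elements fixed by a ring endomorphism. -/
abbrev fixedSubring (σ : A →+* A) : Subring A := σ.eqLocus (RingHom.id A)

/-- An equivariant ring homomorphism restricts to the subrings of fixed elements. -/
def fixedMap (σ : A →+* A) (τ : B →+* B) (φ : A →+* B) (h : τ.comp φ = φ.comp σ) :
    fixedSubring σ →+* fixedSubring τ :=
  (φ.comp (fixedSubring σ).subtype).codRestrict (fixedSubring τ) (fun a => by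
    have h1 : τ (φ a.1) = φ (σ a.1) := congr($h a.1)
    have h2 : σ a.1 = a.1 := a.2
    change τ (φ a.1) = φ a.1
    rw [h1, h2])

/-- Taking invariants commutes with inverting an invariant element. -/
lemma isLocalization_fixedMap (σ : A →+* A) (τ : B →+* B) (φ : A →+* B) (h : τ.comp φ = φ.comp σ)
    (f : fixedSubring σ) (hloc : letI := φ.toAlgebra; IsLocalization.Away f.1 B) :
    letI := (fixedMap σ τ φ h).toAlgebra
    IsLocalization.Away f (fixedSubring τ) := by
  let _ := φ.toAlgebra
  let _ := (fixedMap σ τ φ h).toAlgebra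
  have hact : ∀ a : A, τ (φ a) = φ (σ a) := fun a => congr($h a)
  have hf : σ f.1 = f.1 := f.2
  have hu : IsUnit (φ f.1) := IsLocalization.Away.algebraMap_isUnit (S := B) f.1
  rw [IsLocalization.Away, isLocalization_iff]
  refine ⟨?_, ?_, ?_⟩
  · rintro ⟨_, n, rfl⟩
    simp only [map_pow]
    refine IsUnit.pow n ?_
    obtain ⟨v, hv⟩ := hu.exists_right_inv
    have hv' : τ v = v := by
      have h2 : φ f.1 * τ v = 1 := by
        have := congrArg τ hv
        rwa [map_one, map_mul, hact, hf] at this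
      exact hu.mul_left_cancel (h2.trans hv.symm)
    exact IsUnit.of_mul_eq_one ⟨v, hv'⟩ (Subtype.ext hv)
  · intro z
    obtain ⟨n, a, ha⟩ := IsLocalization.Away.surj f.1 z.1
    replace ha : z.1 * φ f.1 ^ n = φ a := ha
    have hz : τ z.1 = z.1 := z.2
    have h3 : φ (σ a) = φ a := by
      rw [← hact, ← ha, map_mul, map_pow, hact, hz, hf]
    obtain ⟨⟨_, m, rfl⟩, hc⟩ := (IsLocalization.eq_iff_exists (.powers f.1) B).mp h3
    refine ⟨⟨⟨f.1 ^ m * a, ?_⟩, ⟨f ^ (m + n), ⟨_, rfl⟩⟩⟩, Subtype.ext ?_⟩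
    · change σ (f.1 ^ m * a) = f.1 ^ m * a
      rw [map_mul, map_pow, hf]
      exact hc
    · change z.1 * φ (f.1 ^ (m + n)) = φ (f.1 ^ m * a)
      rw [map_mul, ← ha, map_pow, map_pow]
      ring
  · intro x y hxy
    have h' : φ x.1 = φ y.1 := congrArg Subtype.val hxy
    obtain ⟨⟨_, m, rfl⟩, hc⟩ := (IsLocalization.eq_iff_exists (.powers f.1) B).mp h'
    exact ⟨⟨f ^ m, m, rfl⟩, Subtype.ext hc⟩

end Invariants

section Quotient

variable {Z : Scheme.{u}} (g : Z ⟶ Z)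

/-- An affine open subset `U` of `Z` that is stable under the endomorphism `g`. -/
structure StableAffine where
  U : Z.Opens
  isAffineOpen : IsAffineOpen U
  stable : g ⁻¹ᵁ U = U

variable {g}

namespace StableAffine

/-- The action of `g` on the sections over a stable affine open. -/
def act (U : StableAffine g) : Γ(Z, U.U) →+* Γ(Z, U.U) :=
  (g.appLE U.U U.U U.stable.ge).hom

/-- The ring `Γ(Z, U)^g` of invariant sections over a stable affine open. -/
abbrev invariants (U : StableAffine g) : Subring Γ(Z, U.U) := fixedSubring U.act

/-- Restriction of sections. -/
abbrev restrict {U V : StableAffine g} (h : V.U ≤ U.U) : Γ(Z, U.U) →+* Γ(Z, V.U) :=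
  (Z.presheaf.map (homOfLE h).op).hom

lemma act_comp_restrict {U V : StableAffine g} (h : V.U ≤ U.U) :
    V.act.comp (restrict h) = (restrict h).comp U.act := by
  have : Z.presheaf.map (homOfLE h).op ≫ g.appLE V.U V.U V.stable.ge =
      g.appLE U.U U.U U.stable.ge ≫ Z.presheaf.map (homOfLE h).op := by
    rw [Scheme.Hom.map_appLE, Scheme.Hom.appLE_map]
  exact congr($(this).hom)

lemma stable_basicOpen (U : StableAffine g) (f : U.invariants) :
    g ⁻¹ᵁ Z.basicOpen f.1 = Z.basicOpen f.1 := by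
  have h : Z.basicOpen (g.appLE U.U U.U U.stable.ge f.1) = U.U ⊓ g ⁻¹ᵁ Z.basicOpen f.1 :=
    Scheme.basicOpen_appLE ..
  have h1 : g.appLE U.U U.U U.stable.ge f.1 = f.1 := f.2
  rw [h1] at h
  have h2 : g ⁻¹ᵁ Z.basicOpen f.1 ≤ U.U :=
    (g.preimage_mono (Z.basicOpen_le f.1)).trans U.stable.le
  rw [inf_eq_right.mpr h2] at h
  exact h.symm

/-- The stable affine open `D(f) ⊆ U` for an invariant section `f` over `U`. -/
abbrev basicOpen (U : StableAffine g) (f : U.invariants) : StableAffine g where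
  U := Z.basicOpen f.1
  isAffineOpen := U.isAffineOpen.basicOpen f.1
  stable := U.stable_basicOpen f

@[ext] lemma ext {U V : StableAffine g} (h : U.U = V.U) : U = V := by
  cases U; cases V; cases h; rfl

/-- Restriction of invariant sections. -/
def res {U V : StableAffine g} (h : V.U ≤ U.U) : U.invariants →+* V.invariants :=
  fixedMap U.act V.act (restrict h) (act_comp_restrict h)

lemma isLocalization_res (U : StableAffine g) (f : U.invariants) :
    letI := (res (V := U.basicOpen f) (Z.basicOpen_le f.1)).toAlgebra
    IsLocalization.Away f (U.basicOpen f).invariants :=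
  isLocalization_fixedMap U.act (U.basicOpen f).act (restrict (Z.basicOpen_le f.1))
    (act_comp_restrict _) f (U.isAffineOpen.isLocalization_basicOpen f.1)

lemma basicOpen_restrict {U V : StableAffine g} (h : V.U ≤ U.U) (f : Γ(Z, U.U)) :
    Z.basicOpen (restrict h f) = V.U ⊓ Z.basicOpen f :=
  Scheme.basicOpen_res Z f (homOfLE h).op

lemma exists_basicOpen_basicOpen (U : StableAffine g) (f : U.invariants)
    (h : (U.basicOpen f).invariants) :
    ∃ f' : U.invariants, Z.basicOpen h.1 = Z.basicOpen f'.1 := by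
  let _ := (res (V := U.basicOpen f) (Z.basicOpen_le f.1)).toAlgebra
  have := U.isLocalization_res f
  obtain ⟨n, a, ha⟩ := IsLocalization.Away.surj f h
  refine ⟨f * a, ?_⟩
  have hu : IsUnit (restrict (V := U.basicOpen f) (Z.basicOpen_le f.1) f.1) :=
    (IsLocalization.Away.algebraMap_isUnit (S := (U.basicOpen f).invariants) f).map
      (U.basicOpen f).invariants.subtype
  have ha' : h.1 * restrict (V := U.basicOpen f) (Z.basicOpen_le f.1) f.1 ^ n =
      restrict (V := U.basicOpen f) (Z.basicOpen_le f.1) a.1 := congrArg Subtype.val ha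
  have h2 : Z.basicOpen (h.1 * restrict (V := U.basicOpen f) (Z.basicOpen_le f.1) f.1 ^ n) =
      Z.basicOpen h.1 := by
    rw [Scheme.basicOpen_mul, Scheme.basicOpen_of_isUnit _ (hu.pow n)]
    exact inf_eq_left.mpr (Z.basicOpen_le h.1)
  rw [← h2, ha', basicOpen_restrict]
  exact (Z.basicOpen_mul f.1 a.1).symm

/-- `V ≤ U` means that `V = D(f)` for an invariant section `f` over `U`. -/
instance : Preorder (StableAffine g) where
  le V U := ∃ f : U.invariants, V = U.basicOpen f
  le_refl U := ⟨1, ext (Scheme.basicOpen_of_isUnit _ isUnit_one).symm⟩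
  le_trans := by
    rintro _ _ U ⟨h, rfl⟩ ⟨f, rfl⟩
    obtain ⟨f', hf'⟩ := U.exists_basicOpen_basicOpen f h
    exact ⟨f', ext hf'⟩

lemma U_mono {U V : StableAffine g} (h : V ≤ U) : V.U ≤ U.U := by
  obtain ⟨f, rfl⟩ := h
  exact Z.basicOpen_le f.1

variable (g) in
/-- The affine charts `Spec Γ(Z, U)^g`, glued along the open immersions
`Spec Γ(Z, D(f))^g ⟶ Spec Γ(Z, U)^g` for invariant `f`. -/
@[simps] def quotientDiagram : StableAffine g ⥤ Scheme.{u} where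
  obj U := Spec (.of U.invariants)
  map {V U} h := Spec.map (CommRingCat.ofHom (res (U_mono h.le)))
  map_id U := by
    have : res (U_mono (le_refl U)) = RingHom.id _ :=
      RingHom.ext fun a => Subtype.ext congr($(Z.presheaf.map_id _).hom a.1)
    rw [← Spec.map_id, this]
    rfl
  map_comp {W V U} h h' := by
    have : res (U_mono (h ≫ h').le) = (res (U_mono h.le)).comp (res (U_mono h'.le)) :=
      RingHom.ext fun a => Subtype.ext congr($(Z.presheaf.map_comp
        (homOfLE (U_mono h'.le)).op (homOfLE (U_mono h.le)).op).hom a.1)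
    rw [← Spec.map_comp, this]
    rfl

lemma range_quotientDiagram_map (U : StableAffine g) (f : U.invariants) (h : U.basicOpen f ⟶ U) :
    Set.range ((quotientDiagram g).map h) = {x : PrimeSpectrum U.invariants | f ∉ x.asIdeal} := by
  let _ := (res (V := U.basicOpen f) (Z.basicOpen_le f.1)).toAlgebra
  have := U.isLocalization_res f
  exact PrimeSpectrum.localization_away_comap_range (U.basicOpen f).invariants f

instance isOpenImmersion_quotientDiagram_map {V U : StableAffine g} (h : V ⟶ U) :
    IsOpenImmersion ((quotientDiagram g).map h) := by
  obtain ⟨f, rfl⟩ := h.le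
  let _ := (res (V := U.basicOpen f) (Z.basicOpen_le f.1)).toAlgebra
  have := U.isLocalization_res f
  exact IsOpenImmersion.of_isLocalization (S := (U.basicOpen f).invariants) f

instance isLocallyDirected_quotientDiagram :
    (quotientDiagram g ⋙ Scheme.forget).IsLocallyDirected where
  cond {i j U} fi fj xi xj hx := by
    obtain ⟨f, rfl⟩ := fi.le
    obtain ⟨h, rfl⟩ := fj.le
    replace hx : (quotientDiagram g).map fi xi = (quotientDiagram g).map fj xj := hx
    have h1 : U.basicOpen (f * h) ≤ U.basicOpen f :=
      ⟨res (Z.basicOpen_le f.1) h, ext ((Z.basicOpen_mul f.1 h.1).trans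
        (basicOpen_restrict (V := U.basicOpen f) (Z.basicOpen_le f.1) h.1).symm)⟩
    have h2 : U.basicOpen (f * h) ≤ U.basicOpen h :=
      ⟨res (Z.basicOpen_le h.1) f, ext ((Z.basicOpen_mul f.1 h.1).trans ((inf_comm _ _).trans
        (basicOpen_restrict (V := U.basicOpen h) (Z.basicOpen_le h.1) f.1).symm))⟩
    have hxf : (quotientDiagram g).map fi xi ∈ Set.range ((quotientDiagram g).map fi) := ⟨_, rfl⟩
    have hxh : (quotientDiagram g).map fi xi ∈ Set.range ((quotientDiagram g).map fj) :=
      ⟨_, hx.symm⟩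
    rw [range_quotientDiagram_map] at hxf hxh
    have hxfh : (quotientDiagram g).map fi xi ∈
        Set.range ((quotientDiagram g).map (homOfLE (h1.trans fi.le))) := by
      rw [range_quotientDiagram_map]
      exact fun hm => ((PrimeSpectrum.isPrime (R := U.invariants) _).mem_or_mem hm).elim hxf hxh
    obtain ⟨z, hz⟩ := hxfh
    refine ⟨U.basicOpen (f * h), homOfLE h1, homOfLE h2, z, ?_, ?_⟩
    · apply ((quotientDiagram g).map fi).isOpenEmbedding.injective
      refine Eq.trans ?_ hz
      exact congr($((quotientDiagram g).map_comp (homOfLE h1) fi) z).symm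
    · apply ((quotientDiagram g).map fj).isOpenEmbedding.injective
      refine Eq.trans ?_ (hz.trans hx)
      exact congr($((quotientDiagram g).map_comp (homOfLE h2) fj) z).symm

end StableAffine

variable (g) in
/-- The quotient of `Z` by the group generated by `g`, for an automorphism `g` of finite order
such that every orbit lies in an affine open: the gluing of the spectra `Spec Γ(Z, U)^g` of the
rings of invariants over the stable affine opens `U`. -/
def quotient : Scheme.{u} := colimit (StableAffine.quotientDiagram g)

/-- The pullback of functions from an affine base, as a map to the invariants. -/
def StableAffine.fromBase {R : Type u} [CommRing R] (s : Z ⟶ Spec (.of R)) (hs : g ≫ s = s)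
    (U : StableAffine g) : R →+* U.invariants :=
  (((Scheme.ΓSpecIso (.of R)).inv ≫ s.appLE ⊤ U.U le_top).hom).codRestrict U.invariants
    (fun a => by
      have key : ∀ (t : Z ⟶ Spec (.of R)) (_ : t = s) (e : U.U ≤ t ⁻¹ᵁ ⊤) (e' : U.U ≤ s ⁻¹ᵁ ⊤),
          t.appLE ⊤ U.U e = s.appLE ⊤ U.U e' := by
        rintro _ rfl _ _; rfl
      have : s.appLE ⊤ U.U le_top ≫ g.appLE U.U U.U U.stable.ge = s.appLE ⊤ U.U le_top :=
        (Scheme.Hom.appLE_comp_appLE ..).trans (key _ hs _ _)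
      exact congr(((Scheme.ΓSpecIso (.of R)).inv ≫ $(this)).hom a))

/-- The structure map of the quotient over an affine base over which `g` is defined. -/
def quotientToSpec {R : Type u} [CommRing R] (s : Z ⟶ Spec (.of R)) (hs : g ≫ s = s) :
    quotient g ⟶ Spec (.of R) :=
  colimit.desc (StableAffine.quotientDiagram g)
    { pt := Spec (.of R)
      ι :=
        { app := fun U => Spec.map (CommRingCat.ofHom (U.fromBase s hs))
          naturality := fun V U h => by
            have : (StableAffine.res (StableAffine.U_mono h.le)).comp (U.fromBase s hs) =
                V.fromBase s hs := by
              refine RingHom.ext fun a => Subtype.ext ?_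
              have := Scheme.Hom.appLE_map (f := s) (U := ⊤) (V := U.U) le_top
                (homOfLE (StableAffine.U_mono h.le)).op
              exact congr(((Scheme.ΓSpecIso (.of R)).inv ≫ $(this)).hom a)
            change Spec.map _ ≫ Spec.map _ = Spec.map _ ≫ 𝟙 _
            rw [Category.comp_id, ← Spec.map_comp, ← this]
            rfl } }

end Quotient
section ProjMap

open HomogeneousLocalization HomogeneousIdeal

/-- The structure map of `Proj 𝒜` for a graded `R`-algebra. -/
def projToSpec {R A : Type u} [CommRing R] [CommRing A] [Algebra R A] (𝒜 : ℕ → Submodule R A)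
    [GradedAlgebra 𝒜] : Proj 𝒜 ⟶ Spec (.of R) :=
  Proj.toSpecZero 𝒜 ≫ Spec.map (CommRingCat.ofHom (algebraMap R (𝒜 0)))

variable {R R' A B : Type u} [CommRing R] [CommRing R'] [CommRing A] [CommRing B]
  [Algebra R A] [Algebra R' B] {𝒜 : ℕ → Submodule R A} {ℬ : ℕ → Submodule R' B}
  [GradedAlgebra 𝒜] [GradedAlgebra ℬ]

variable (𝒜) in
/-- The structure map of a chart of `Proj`. -/
def toAway (s : A) : R →+* Away 𝒜 s :=
  (fromZeroRingHom 𝒜 _).comp (algebraMap R (𝒜 0))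

lemma awayι_projToSpec {m : ℕ} {s : A} (hs : s ∈ 𝒜 m) (hm : 0 < m) :
    Proj.awayι 𝒜 s hs hm ≫ projToSpec 𝒜 = Spec.map (CommRingCat.ofHom (toAway 𝒜 s)) := by
  rw [projToSpec, Proj.awayι_toSpecZero_assoc, ← Spec.map_comp]
  rfl

lemma val_toAway (s : A) (r : R) : (toAway 𝒜 s r).val = algebraMap A _ (algebraMap R A r) := by
  change (HomogeneousLocalization.mk _).val = _
  rw [HomogeneousLocalization.val_mk]
  exact Localization.mk_one_eq_algebraMap _

/-- The graded ring `ℬ` over `R'` is the localization at `f` of the graded ring `𝒜` over `R`. -/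
structure IsGradedLocalization (ρ : R →+* R') (f : R) (φ : 𝒜 →+*ᵍ ℬ) : Prop where
  comm : ∀ r, φ (algebraMap R A r) = algebraMap R' B (ρ r)
  loc : letI := ρ.toAlgebra; IsLocalization.Away f R'
  surj : ∀ n, ∀ b ∈ ℬ n, ∃ N, ∃ a ∈ 𝒜 n, φ a = algebraMap R' B (ρ f) ^ N * b
  inj : ∀ n, ∀ a ∈ 𝒜 n, φ a = 0 → ∃ N, algebraMap R A f ^ N * a = 0

variable {ρ : R →+* R'} {f : R} {φ : 𝒜 →+*ᵍ ℬ}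

lemma toAway_map (hc : ∀ r, φ (algebraMap R A r) = algebraMap R' B (ρ r)) (s : A) (r : R) :
    Away.map φ s (toAway 𝒜 s r) = toAway ℬ (φ s) (ρ r) := by
  change HomogeneousLocalization.mk _ = HomogeneousLocalization.mk _
  apply HomogeneousLocalization.val_injective
  rw [HomogeneousLocalization.val_mk, HomogeneousLocalization.val_mk]
  congr 1
  · exact hc r
  · exact Subtype.ext (map_one φ)

lemma IsGradedLocalization.away (H : IsGradedLocalization ρ f φ) {d : ℕ} {s : A} (hs : s ∈ 𝒜 d) :
    letI := (Away.map φ s).toAlgebra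
    IsLocalization.Away (toAway 𝒜 s f) (Away ℬ (φ s)) := by
  let _ := (Away.map φ s).toAlgebra
  have hφs : φ s ∈ ℬ d := φ.map_mem hs
  have hdeg0 : ∀ N, algebraMap R A f ^ N ∈ 𝒜 0 := fun N => by
    rw [← map_pow]; exact SetLike.algebraMap_mem_graded 𝒜 _
  have hdeg0' : ∀ N, algebraMap R' B (ρ f) ^ N ∈ ℬ 0 := fun N => by
    rw [← map_pow]; exact SetLike.algebraMap_mem_graded ℬ _
  rw [IsLocalization.Away, isLocalization_iff]
  refine ⟨?_, ?_, ?_⟩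
  · rintro ⟨_, n, rfl⟩
    simp only [map_pow]
    refine IsUnit.pow n ?_
    have hu : IsUnit (ρ f) := by
      let _ := ρ.toAlgebra
      have := H.loc
      exact IsLocalization.Away.algebraMap_isUnit (S := R') f
    change IsUnit (Away.map φ s (toAway 𝒜 s f))
    rw [toAway_map H.comm]
    exact hu.map _
  · intro z
    obtain ⟨n, b, hb, rfl⟩ := Away.mk_surjective ℬ hφs z
    obtain ⟨N, a, ha, hab⟩ := H.surj _ b hb
    refine ⟨⟨Away.mk 𝒜 hs n a ha, ⟨toAway 𝒜 s f ^ N, N, rfl⟩⟩, ?_⟩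
    change _ * Away.map φ s (toAway 𝒜 s f ^ N) = Away.map φ s (Away.mk 𝒜 hs n a ha)
    rw [Away.map_mk, map_pow, toAway_map H.comm]
    apply HomogeneousLocalization.val_injective
    rw [val_mul, val_pow, val_toAway, Away.val_mk, Away.val_mk, hab,
      ← map_pow (algebraMap B (Localization (Submonoid.powers (φ s)))), ← Localization.mk_one_eq_algebraMap, Localization.mk_mul, mul_one, mul_comm]
  · intro x y hxy
    obtain ⟨z, rfl⟩ : ∃ z, x = y + z := ⟨x - y, by ring⟩
    have hz : Away.map φ s z = 0 := by
      have : Away.map φ s (y + z) = Away.map φ s y := hxy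
      rwa [map_add, add_eq_left] at this
    obtain ⟨n, a, ha, rfl⟩ := Away.mk_surjective 𝒜 hs z
    rw [Away.map_mk] at hz
    have hz' := congrArg HomogeneousLocalization.val hz
    rw [Away.val_mk, val_zero, ← Localization.mk_zero 1, Localization.mk_eq_mk_iff,
      Localization.r_iff_exists] at hz'
    obtain ⟨⟨_, m, rfl⟩, hm⟩ := hz'
    have hm' : φ (s ^ m * a) = 0 := by
      simpa using hm
    obtain ⟨N, hN⟩ := H.inj _ _ (SetLike.mul_mem_graded (SetLike.pow_mem_graded m hs) ha) hm'
    refine ⟨⟨toAway 𝒜 s f ^ N, N, rfl⟩, ?_⟩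
    change toAway 𝒜 s f ^ N * (y + _) = toAway 𝒜 s f ^ N * y
    rw [mul_add, add_eq_left]
    apply HomogeneousLocalization.val_injective
    rw [val_mul, val_pow, val_toAway, Away.val_mk, val_zero,
      ← map_pow (algebraMap A (Localization (Submonoid.powers s))), ← Localization.mk_one_eq_algebraMap, Localization.mk_mul,
      ← Localization.mk_zero 1, Localization.mk_eq_mk_iff, Localization.r_iff_exists]
    refine ⟨⟨s ^ m, m, rfl⟩, ?_⟩
    simp only [one_mul, OneMemClass.coe_one, mul_zero]
    linear_combination hN

variable (hφ : ℬ₊ ≤ 𝒜₊.map φ)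

lemma isPullback_awayι {d : ℕ} (hd : 0 < d) {s : A} (hs : s ∈ 𝒜 d) :
    IsPullback (Spec.map (CommRingCat.ofHom (Away.map φ s)))
      (Proj.awayι ℬ (φ s) (φ.map_mem hs) hd) (Proj.awayι 𝒜 s hs hd) (Proj.map φ hφ) := by
  apply IsOpenImmersion.isPullback
  · exact Proj.awayι_comp_map φ hφ hd s hs
  · rw [Proj.opensRange_awayι, Proj.opensRange_awayι, Proj.map_preimage_basicOpen]

lemma IsGradedLocalization.isOpenImmersion_snd (H : IsGradedLocalization ρ f φ) {d : ℕ}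
    (hd : 0 < d) {s : A} (hs : s ∈ 𝒜 d) :
    IsOpenImmersion (pullback.snd (Proj.map φ hφ) (Proj.awayι 𝒜 s hs hd)) := by
  have hp := isPullback_awayι hφ hd hs
  have : IsOpenImmersion (Spec.map (CommRingCat.ofHom (Away.map φ s))) := by
    let _ := (Away.map φ s).toAlgebra
    have := H.away hs
    exact IsOpenImmersion.of_isLocalization (S := Away ℬ (φ s)) (toAway 𝒜 s f)
  rw [← hp.flip.isoPullback_inv_snd]
  infer_instance

lemma awayι_comm (hc : ∀ r, φ (algebraMap R A r) = algebraMap R' B (ρ r)) {d : ℕ}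
    (hd : 0 < d) {s : A} (hs : s ∈ 𝒜 d) :
    Proj.awayι ℬ (φ s) (φ.map_mem hs) hd ≫ Proj.map φ hφ ≫ projToSpec 𝒜 =
      Proj.awayι ℬ (φ s) (φ.map_mem hs) hd ≫ projToSpec ℬ ≫ Spec.map (CommRingCat.ofHom ρ) := by
  rw [Proj.awayι_comp_map_assoc φ hφ hd _ hs, awayι_projToSpec, ← Category.assoc,
    awayι_projToSpec, ← Spec.map_comp, ← Spec.map_comp]
  congr 1
  ext r
  exact congrArg HomogeneousLocalization.val (toAway_map hc s r)

lemma IsGradedLocalization.isOpenImmersion_map (H : IsGradedLocalization ρ f φ) :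
    IsOpenImmersion (Proj.map φ hφ) := by
  refine IsZariskiLocalAtTarget.of_openCover (P := @IsOpenImmersion)
    (Proj.affineOpenCover 𝒜).openCover fun i => ?_
  exact H.isOpenImmersion_snd hφ i.1.2 i.2.2

lemma map_projToSpec (hc : ∀ r, φ (algebraMap R A r) = algebraMap R' B (ρ r)) :
    Proj.map φ hφ ≫ projToSpec 𝒜 = projToSpec ℬ ≫ Spec.map (CommRingCat.ofHom ρ) := by
  refine (Proj.mapAffineOpenCover φ hφ).openCover.hom_ext _ _ fun s => ?_
  exact awayι_comm hφ hc s.1.2 s.2.2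

lemma IsGradedLocalization.isPullback (H : IsGradedLocalization ρ f φ) :
    IsPullback (Proj.map φ hφ) (projToSpec ℬ) (projToSpec 𝒜) (Spec.map (CommRingCat.ofHom ρ)) := by
  have := H.isOpenImmersion_map hφ
  let _ := ρ.toAlgebra
  have := H.loc
  have : IsOpenImmersion (Spec.map (CommRingCat.ofHom ρ)) :=
    IsOpenImmersion.of_isLocalization (S := R') f
  refine (IsOpenImmersion.isPullback _ _ _ _ (map_projToSpec hφ H.comm) ?_).flip
  apply le_antisymm
  · intro x hx
    obtain ⟨i, y, rfl⟩ := (Proj.affineOpenCover 𝒜).openCover.exists_eq x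
    have hR : (Spec.map (CommRingCat.ofHom ρ)).opensRange = PrimeSpectrum.basicOpen f :=
      TopologicalSpace.Opens.ext (PrimeSpectrum.localization_away_comap_range R' f)
    rw [hR] at hx
    have hx' : (Spec.map (CommRingCat.ofHom (toAway 𝒜 i.2.1))) y ∈ PrimeSpectrum.basicOpen f := by
      rw [← awayι_projToSpec i.2.2 i.1.2]
      exact hx
    let _ := (Away.map φ i.2.1).toAlgebra
    have := H.away i.2.2
    have hy : y ∈ Set.range (PrimeSpectrum.comap (algebraMap (Away 𝒜 i.2.1) (Away ℬ (φ i.2.1)))) := by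
      rw [PrimeSpectrum.localization_away_comap_range (Away ℬ (φ i.2.1)) (toAway 𝒜 i.2.1 f)]
      exact hx'
    obtain ⟨w, rfl⟩ := hy
    refine ⟨Proj.awayι ℬ (φ i.2.1) (φ.map_mem i.2.2) i.1.2 w, ?_⟩
    exact congr($(Proj.awayι_comp_map φ hφ i.1.2 _ i.2.2) w)
  · rintro _ ⟨w, rfl⟩
    exact ⟨projToSpec ℬ w, congr($(map_projToSpec hφ H.comm) w).symm⟩

end ProjMap

section Rees

open Polynomial HomogeneousIdeal

variable {R : Type u} [CommRing R] (I : Ideal R)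

/-- The degree `n` part `Iⁿ tⁿ` of the Rees algebra `R[It] = ⨁ Iⁿ tⁿ`. -/
def reesGrading (n : ℕ) : Submodule R (reesAlgebra I) where
  carrier := {p | ∀ j, j ≠ n → (p : R[X]).coeff j = 0}
  add_mem' {p q} hp hq j hj := by
    change ((p : R[X]) + q).coeff j = 0
    rw [coeff_add, hp j hj, hq j hj, add_zero]
  zero_mem' _ _ := coeff_zero _
  smul_mem' r p hp j hj := by
    change (r • (p : R[X])).coeff j = 0
    rw [coeff_smul, hp j hj, smul_zero]

variable {I}

/-- The element `r tⁿ` of the Rees algebra, for `r ∈ Iⁿ`. -/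
def reesMonomial (n : ℕ) (r : R) (hr : r ∈ I ^ n) : reesAlgebra I :=
  ⟨monomial n r, reesAlgebra.monomial_mem.mpr hr⟩

lemma reesMonomial_mem (n : ℕ) (r : R) (hr : r ∈ I ^ n) :
    reesMonomial n r hr ∈ reesGrading I n := fun _ hj => coeff_monomial_of_ne _ hj

lemma eq_reesMonomial {n : ℕ} {p : reesAlgebra I} (hp : p ∈ reesGrading I n) :
    p = reesMonomial n ((p : R[X]).coeff n) (p.2 n) := by
  refine Subtype.ext (Polynomial.ext fun j => ?_)
  change _ = (monomial n _).coeff j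
  rw [coeff_monomial]
  split_ifs with h
  · rw [h]
  · exact hp j (Ne.symm h)

instance : SetLike.GradedMonoid (reesGrading I) where
  one_mem j hj := by
    change (1 : R[X]).coeff j = 0
    rw [coeff_one, if_neg hj]
  mul_mem m n p q hp hq j hj := by
    rw [eq_reesMonomial hp, eq_reesMonomial hq]
    change (monomial m _ * monomial n _ : R[X]).coeff j = 0
    rw [monomial_mul_monomial, coeff_monomial_of_ne _ hj]

lemma rees_isInternal : DirectSum.IsInternal (reesGrading I) := by
  constructor
  · intro x x' hx
    refine DFinsupp.ext fun n => Subtype.ext (Subtype.ext (Polynomial.ext fun j => ?_))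
    have key : ∀ y : DirectSum ℕ (fun i => reesGrading I i),
        ((DirectSum.coeAddMonoidHom (reesGrading I) y : reesAlgebra I) : R[X]).coeff n =
          ((y n : reesAlgebra I) : R[X]).coeff n := by
      intro y
      induction y using DirectSum.induction_on with
      | zero => simp
      | of i y =>
        rw [DirectSum.coeAddMonoidHom_of]
        by_cases h : i = n
        · subst h; rw [DirectSum.of_eq_same]
        · rw [DirectSum.of_eq_of_ne _ _ _ (Ne.symm h)]
          exact y.2 n (Ne.symm h)
      | add y z hy hz =>
        rw [map_add]
        change ((_ : R[X]) + _).coeff n = (((y n : reesAlgebra I) : R[X]) + _).coeff n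
        rw [coeff_add, coeff_add, hy, hz]
    by_cases h : j = n
    · subst h
      exact (key x).symm.trans ((congrArg (fun p : reesAlgebra I => (p : R[X]).coeff j) hx).trans
        (key x'))
    · exact ((x n).2 j h).trans ((x' n).2 j h).symm
  · intro p
    refine ⟨∑ n ∈ (p : R[X]).support, DirectSum.of (fun i => reesGrading I i) n
      ⟨reesMonomial n ((p : R[X]).coeff n) (p.2 n), reesMonomial_mem _ _ _⟩, ?_⟩
    rw [map_sum]
    simp only [DirectSum.coeAddMonoidHom_of]
    refine Subtype.ext ?_
    rw [AddSubmonoidClass.coe_finsetSum]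
    exact (p : R[X]).as_sum_support.symm

instance : GradedAlgebra (reesGrading I) where
  toDecomposition := rees_isInternal.chooseDecomposition

variable {R' : Type u} [CommRing R'] {I' : Ideal R'}

/-- A ring homomorphism carrying `I` to `I'` by extension induces a graded homomorphism of the
Rees algebras. -/
def reesMap (ρ : R →+* R') (h : I.map ρ = I') : reesGrading I →+*ᵍ reesGrading I' where
  toRingHom := ((mapRingHom ρ).comp (reesAlgebra I).val.toRingHom).codRestrict
    (reesAlgebra I').toSubring fun p n => by
      change ((p : R[X]).map ρ).coeff n ∈ I' ^ n
      rw [coeff_map, ← h, ← Ideal.map_pow]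
      exact Ideal.mem_map_of_mem _ (p.2 n)
  map_mem {n p} hp j hj := by
    change ((p : R[X]).map ρ).coeff j = 0
    rw [coeff_map, hp j hj, map_zero]

lemma coe_reesMap (ρ : R →+* R') (h : I.map ρ = I') (p : reesAlgebra I) :
    (reesMap ρ h p : R'[X]) = (p : R[X]).map ρ := rfl

lemma reesMap_irrelevant (ρ : R →+* R') (h : I.map ρ = I') :
    (reesGrading I')₊ ≤ (reesGrading I)₊.map (reesMap ρ h) := by
  refine (toIdeal_irrelevant_le _).mpr fun n hn p hp => ?_
  change p ∈ Ideal.map (reesMap ρ h) _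
  have key : ∀ (r : R') (_ : r ∈ (I ^ n).map ρ) (hr : r ∈ I' ^ n), reesMonomial n r hr ∈
      Ideal.map (reesMap ρ h) (irrelevant (reesGrading I)).toIdeal := by
    intro r hr
    induction hr using Submodule.span_induction with
    | mem x hx =>
      obtain ⟨y, hy, rfl⟩ := hx
      intro hr
      have : reesMonomial n (ρ y) hr = reesMap ρ h (reesMonomial n y hy) :=
        Subtype.ext (map_monomial ρ).symm
      rw [this]
      refine Ideal.mem_map_of_mem _ ?_
      exact mem_irrelevant_of_mem _ hn (reesMonomial_mem _ _ _)
    | zero =>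
      intro hr
      have : reesMonomial n (0 : R') hr = 0 := Subtype.ext (monomial_zero_right n)
      rw [this]; exact zero_mem _
    | add x y hx hy ihx ihy =>
      intro hr
      have e : (I ^ n).map ρ = I' ^ n := by rw [Ideal.map_pow, h]
      have : reesMonomial n (x + y) hr = reesMonomial n x (e ▸ hx) + reesMonomial n y (e ▸ hy) :=
        Subtype.ext ((monomial n).map_add _ _)
      rw [this]; exact add_mem (ihx _) (ihy _)
    | smul a x hx ih =>
      intro hr
      have e : (I ^ n).map ρ = I' ^ n := by rw [Ideal.map_pow, h]
      have : reesMonomial n (a • x) hr = algebraMap R' (reesAlgebra I') a *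
          reesMonomial n x (e ▸ hx) := Subtype.ext (by
        change monomial n (a * x) = C a * monomial n x
        rw [C_mul_monomial])
      rw [this]; exact Ideal.mul_mem_left _ _ (ih _)
  rw [eq_reesMonomial hp]
  exact key _ (by rw [Ideal.map_pow, h]; exact p.2 n) _

lemma isGradedLocalization_reesMap (ρ : R →+* R') (h : I.map ρ = I') (f : R)
    (hloc : letI := ρ.toAlgebra; IsLocalization.Away f R') :
    IsGradedLocalization ρ f (reesMap ρ h) where
  comm r := Subtype.ext (map_C ρ)
  loc := hloc
  surj n b hb := by
    rw [eq_reesMonomial hb]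
    refine (?_ : ∀ (r : R') (hmem : r ∈ I' ^ n), ∃ N, ∃ a ∈ reesGrading I n, reesMap ρ h a =
      algebraMap R' (reesAlgebra I') (ρ f) ^ N * reesMonomial n r hmem) _ _
    intro r hmem
    have hr : r ∈ (I ^ n).map ρ := by rwa [Ideal.map_pow, h]
    let _ := ρ.toAlgebra
    obtain ⟨⟨y, ⟨_, N, rfl⟩⟩, hy⟩ :=
      (IsLocalization.mem_map_algebraMap_iff (.powers f) R').mp hr
    refine ⟨N, reesMonomial n y.1 y.2, reesMonomial_mem _ _ _, Subtype.ext ?_⟩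
    change (monomial n y.1).map ρ = (C (ρ f)) ^ N * monomial n r
    have hy' : r * ρ (f ^ N) = ρ y.1 := hy
    rw [map_monomial, ← C_pow, C_mul_monomial, ← hy', map_pow, mul_comm]
  inj n a ha h0 := by
    rw [eq_reesMonomial ha] at h0 ⊢
    refine (?_ : ∀ (r : R) (hmem : r ∈ I ^ n), reesMap ρ h (reesMonomial n r hmem) = 0 →
      ∃ N, algebraMap R (reesAlgebra I) f ^ N * reesMonomial n r hmem = 0) _ _ h0
    intro r hmem h0
    let _ := ρ.toAlgebra
    have h0' : (monomial n r).map ρ = 0 := congrArg Subtype.val h0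
    rw [map_monomial, monomial_eq_zero_iff] at h0'
    obtain ⟨⟨_, N, rfl⟩, hN⟩ :=
      (IsLocalization.eq_iff_exists (.powers f) R').mp (h0'.trans (map_zero ρ).symm)
    refine ⟨N, Subtype.ext ?_⟩
    change (C f) ^ N * monomial n r = 0
    have hN' : f ^ N * r = 0 := by simpa using hN
    rw [← C_pow, C_mul_monomial, hN', monomial_zero_right]

end Rees

section BlowUp

open HomogeneousIdeal

open Scheme.AffineZariskiSite

variable {Y : Scheme.{u}} (J : Y.IdealSheafData)

/-- The ideal of sections of `J` over an affine open. -/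
abbrev idealOn (U : Y.AffineZariskiSite) : Ideal Γ(Y, U.1) := J.ideal ⟨U.1, U.2⟩

lemma map_idealOn {V U : Y.AffineZariskiSite} (h : V ≤ U) :
    (idealOn J U).map (Y.presheaf.map (homOfLE (toOpens_mono h)).op).hom = idealOn J V :=
  J.map_ideal (U := ⟨V.1, V.2⟩) (V := ⟨U.1, U.2⟩) (toOpens_mono h)

lemma projMap_congr {R R' A B : Type u} [CommRing R] [CommRing R'] [CommRing A] [CommRing B]
    [Algebra R A] [Algebra R' B] {𝒜 : ℕ → Submodule R A} {ℬ : ℕ → Submodule R' B}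
    [GradedAlgebra 𝒜] [GradedAlgebra ℬ] {φ ψ : 𝒜 →+*ᵍ ℬ} (h : φ = ψ)
    (hφ : ℬ₊ ≤ 𝒜₊.map φ) (hψ : ℬ₊ ≤ 𝒜₊.map ψ) : Proj.map φ hφ = Proj.map ψ hψ := by
  subst h; rfl

/-- The schemes `Proj ⨁ₙ J(U)ⁿ` for the affine opens `U` of `Y`, with the maps given by
restriction to basic opens. -/
@[simps] def blowUpDiagram : Y.AffineZariskiSite ⥤ Scheme.{u} where
  obj U := Proj (reesGrading (idealOn J U))
  map {V U} h := Proj.map (reesMap _ (map_idealOn J h.le))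
    (reesMap_irrelevant _ (map_idealOn J h.le))
  map_id U := by
    rw [← Proj.map_id]
    refine projMap_congr (GradedRingHom.ext fun p => Subtype.ext ?_) _ _
    have h : (Y.presheaf.map (homOfLE (toOpens_mono (le_refl U))).op).hom = RingHom.id _ :=
      congr($(Y.presheaf.map_id _).hom)
    exact (congrArg (Polynomial.map · (p : Polynomial Γ(Y, U.1))) h).trans Polynomial.map_id
  map_comp := by
    intro W V U h h'
    rw [← Proj.map_comp]
    refine projMap_congr (GradedRingHom.ext fun p => Subtype.ext ?_) _ _
    have h : (Y.presheaf.map (homOfLE (toOpens_mono (h ≫ h').le)).op).hom =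
        (Y.presheaf.map (homOfLE (toOpens_mono h.le)).op).hom.comp
          (Y.presheaf.map (homOfLE (toOpens_mono h'.le)).op).hom :=
      congr($(Y.presheaf.map_comp (homOfLE (toOpens_mono h'.le)).op
        (homOfLE (toOpens_mono h.le)).op).hom)
    exact (congrArg (Polynomial.map · (p : Polynomial Γ(Y, U.1))) h).trans
      (Polynomial.map_map _ _ _).symm

/-- The map `Proj ⨁ₙ J(U)ⁿ ⟶ U`. -/
def blowUpChart (U : Y.AffineZariskiSite) :
    Proj (reesGrading (idealOn J U)) ⟶ Spec Γ(Y, U.1) :=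
  projToSpec (R := Γ(Y, U.1)) (reesGrading (idealOn J U))

lemma exists_isLocalization {V U : Y.AffineZariskiSite} (h : V ≤ U) : ∃ f : Γ(Y, U.1),
    letI := (Y.presheaf.map (homOfLE (toOpens_mono h)).op).hom.toAlgebra
    IsLocalization.Away f Γ(Y, V.1) := by
  obtain ⟨f, hf⟩ := id h
  obtain rfl : V = U.basicOpen f := Subtype.ext hf.symm
  exact ⟨f, U.2.isLocalization_basicOpen f⟩

lemma isPullback_blowUpChart {V U : Y.AffineZariskiSite} (h : V ≤ U) :
    IsPullback (Proj.map (reesMap _ (map_idealOn J h)) (reesMap_irrelevant _ (map_idealOn J h)))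
      (blowUpChart J V) (blowUpChart J U)
      (Spec.map (Y.presheaf.map (homOfLE (toOpens_mono h)).op)) := by
  obtain ⟨f, hf⟩ := exists_isLocalization h
  exact (isGradedLocalization_reesMap _ (map_idealOn J h) f hf).isPullback
    (reesMap_irrelevant _ (map_idealOn J h))

/-- The maps `Proj ⨁ₙ J(U)ⁿ ⟶ U`, as a natural transformation. -/
def blowUpToSpec : blowUpDiagram J ⟶ toOpensFunctor Y ⋙ Y.presheaf.rightOp ⋙ Scheme.Spec where
  app U := blowUpChart J U
  naturality _ _ h := (isPullback_blowUpChart J h.le).w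

lemma equifibered_blowUpToSpec : (blowUpToSpec J).Equifibered :=
  fun _ _ h => isPullback_blowUpChart J h.le

/-- The relative gluing data of the blow-up. -/
def blowUpGluingData : (directedCover Y).RelativeGluingData where
  functor := blowUpDiagram J
  natTrans := blowUpToSpec J ≫ (restrictIsoSpec Y).inv
  equifibered :=
    have h : (restrictIsoSpec Y).inv.Equifibered := .of_isIso _
    (equifibered_blowUpToSpec J).comp h

/-- The blow-up of `Y` along the closed subscheme defined by `J`: the relative `Proj` of the Rees
algebra `⨁ₙ Jⁿ`, glued from the schemes `Proj ⨁ₙ J(U)ⁿ` over the affine opens `U` of `Y`. -/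
def blowUp : Scheme.{u} := (blowUpGluingData J).glued

/-- The blow-down map. -/
def blowUpMap : blowUp J ⟶ Y := (blowUpGluingData J).toBase

end BlowUp
section QuotientGrading

variable {R A : Type u} [CommRing R] [CommRing A] [Algebra R A] (𝒜 : ℕ → Submodule R A)

/-- The grading on `A ⧸ I` by the images of the graded pieces of `A`. -/
def quotientGrading (I : Ideal A) (n : ℕ) : Submodule R (A ⧸ I) :=
  (𝒜 n).map (Ideal.Quotient.mkₐ R I).toLinearMap

variable {𝒜}

lemma mk_mem_quotientGrading (I : Ideal A) {n : ℕ} {a : A} (ha : a ∈ 𝒜 n) :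
    Ideal.Quotient.mk I a ∈ quotientGrading 𝒜 I n := ⟨a, ha, rfl⟩

variable [GradedAlgebra 𝒜]

instance (I : Ideal A) : SetLike.GradedMonoid (quotientGrading 𝒜 I) where
  one_mem := mk_mem_quotientGrading I (SetLike.GradedOne.one_mem (A := 𝒜))
  mul_mem := by
    rintro m n _ _ ⟨a, ha, rfl⟩ ⟨b, hb, rfl⟩
    exact mk_mem_quotientGrading I (SetLike.mul_mem_graded ha hb)

lemma quotientGrading_isInternal {I : Ideal A} (hI : I.IsHomogeneous 𝒜) :
    DirectSum.IsInternal (quotientGrading 𝒜 I) := by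
  have lift : ∀ x : DirectSum ℕ (fun i => quotientGrading 𝒜 I i), ∃ y : A,
      Ideal.Quotient.mk I y = DirectSum.coeAddMonoidHom (quotientGrading 𝒜 I) x ∧
      ∀ n, Ideal.Quotient.mk I (DirectSum.decompose 𝒜 y n) = x n := by
    intro x
    induction x using DirectSum.induction_on with
    | zero => exact ⟨0, by simp, fun n => by simp⟩
    | of i x =>
      obtain ⟨_, a, ha, rfl⟩ := x
      refine ⟨a, by rw [DirectSum.coeAddMonoidHom_of]; rfl, fun n => ?_⟩
      by_cases h : i = n
      · subst h
        rw [DirectSum.of_eq_same, DirectSum.decompose_of_mem_same 𝒜 ha]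
        rfl
      · rw [DirectSum.of_eq_of_ne _ _ _ (Ne.symm h), DirectSum.decompose_of_mem_ne 𝒜 ha h, map_zero]
        rfl
    | add x x' h h' =>
      obtain ⟨y, hy, hy'⟩ := h
      obtain ⟨z, hz, hz'⟩ := h'
      refine ⟨y + z, by rw [map_add, map_add, hy, hz], fun n => ?_⟩
      rw [DirectSum.decompose_add, DirectSum.add_apply, DirectSum.add_apply]
      simp [hy', hz']
  constructor
  · intro x x' hx
    obtain ⟨y, hy, hy'⟩ := lift x
    obtain ⟨z, hz, hz'⟩ := lift x'
    have hI' : y - z ∈ I := Ideal.Quotient.eq.mp (hy.trans (hx.trans hz.symm))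
    refine DFinsupp.ext fun n => Subtype.ext ?_
    refine (hy' n).symm.trans (Eq.trans ?_ (hz' n))
    rw [Ideal.Quotient.eq]
    have := hI n hI'
    rwa [DirectSum.decompose_sub, DirectSum.sub_apply] at this
  · intro q
    classical
    obtain ⟨a, rfl⟩ := Ideal.Quotient.mk_surjective q
    refine ⟨∑ n ∈ (DirectSum.decompose 𝒜 a).support, DirectSum.of (fun i => quotientGrading 𝒜 I i) n
      ⟨_, mk_mem_quotientGrading I (DirectSum.decompose 𝒜 a n).2⟩, ?_⟩
    rw [map_sum]
    simp only [DirectSum.coeAddMonoidHom_of]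
    rw [← map_sum, DirectSum.sum_support_decompose 𝒜 a]

/-- The quotient of a graded algebra by a homogeneous ideal is graded. -/
abbrev quotientGradedAlgebra {I : Ideal A} (hI : I.IsHomogeneous 𝒜) :
    GradedAlgebra (quotientGrading 𝒜 I) where
  toDecomposition := (quotientGrading_isInternal hI).chooseDecomposition

end QuotientGrading

section Curve

open MvPolynomial HomogeneousIdeal

attribute [local instance] MvPolynomial.gradedAlgebra

variable (k : Type u) [Field k]

/-- The cubic form `y²z - x(x² - z²)`. -/
def cubic : MvPolynomial (Fin 3) k := X 1 ^ 2 * X 2 - X 0 * (X 0 ^ 2 - X 2 ^ 2)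

lemma cubic_isHomogeneous : (cubic k).IsHomogeneous 3 :=
  (((isHomogeneous_X k 1).pow 2).mul (isHomogeneous_X k 2)).sub
    ((isHomogeneous_X k 0).mul (((isHomogeneous_X k 0).pow 2).sub ((isHomogeneous_X k 2).pow 2)))

/-- The homogeneous coordinate ring of the curve `y²z = x(x² - z²)`. -/
abbrev CurveRing : Type u := MvPolynomial (Fin 3) k ⧸ Ideal.span {cubic k}

/-- The grading of the homogeneous coordinate ring by degree. -/
abbrev curveGrading : ℕ → Submodule k (CurveRing k) :=
  quotientGrading (homogeneousSubmodule (Fin 3) k) (Ideal.span {cubic k})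

instance curveGradedAlgebra : GradedAlgebra (curveGrading k) :=
  quotientGradedAlgebra (Ideal.homogeneous_span _ _ (by
    rintro _ rfl
    exact ⟨3, cubic_isHomogeneous k⟩))

/-- The plane cubic curve `y²z = x(x² - z²)`. -/
def curve : Scheme.{u} := Proj (curveGrading k)

/-- The structure map of the curve. -/
def curveToSpec : curve k ⟶ Spec (.of k) := projToSpec (curveGrading k)

variable {k} (i : k) (hi : i ^ 2 = -1)

/-- The substitution `(x, y, z) ↦ (-x, iy, z)`. -/
def subst : MvPolynomial (Fin 3) k →ₐ[k] MvPolynomial (Fin 3) k := aeval ![-X 0, C i * X 1, X 2]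

lemma subst_cubic (hi : i ^ 2 = -1) : subst i (cubic k) = -cubic k := by
  have h : (C i : MvPolynomial (Fin 3) k) ^ 2 = -1 := by rw [← C_pow, hi, C_neg, C_1]
  simp only [subst, cubic, map_sub, map_mul, map_pow, aeval_X]
  simp only [Matrix.cons_val_zero, Matrix.cons_val_one, Matrix.cons_val]
  linear_combination X 1 ^ 2 * X 2 * h

lemma subst_pow_four (hi : i ^ 2 = -1) (p : MvPolynomial (Fin 3) k) :
    subst i (subst i (subst i (subst i p))) = p := by
  have h : (C i : MvPolynomial (Fin 3) k) ^ 2 = -1 := by rw [← C_pow, hi, C_neg, C_1]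
  have : (subst i).comp ((subst i).comp ((subst i).comp (subst i))) = AlgHom.id k _ := by
    ext j : 1
    fin_cases j
    · simp [subst]
    · simp only [subst, AlgHom.comp_apply, aeval_X, map_mul, algHom_C, algebraMap_eq, AlgHom.id_apply,
        Matrix.cons_val_one, Matrix.cons_val_zero, Fin.mk_one]
      linear_combination X 1 * (C i ^ 2 - 1) * h
    · simp [subst]
  exact congr($this p)

lemma subst_mem {n : ℕ} {p : MvPolynomial (Fin 3) k} (hp : p ∈ homogeneousSubmodule (Fin 3) k n) :
    subst i p ∈ homogeneousSubmodule (Fin 3) k n := by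
  have := MvPolynomial.IsHomogeneous.aeval (n := 1) hp
    (![-X 0, C i * X 1, X 2] : Fin 3 → MvPolynomial (Fin 3) k) (fun j => by
    fin_cases j
    · exact (isHomogeneous_X k 0).neg
    · simpa using (isHomogeneous_C (Fin 3) i).mul (isHomogeneous_X k 1)
    · exact isHomogeneous_X k 2)
  rwa [one_mul] at this

/-- The graded automorphism `(x, y, z) ↦ (-x, iy, z)` of the homogeneous coordinate ring. -/
def curveRingMap : curveGrading k →+*ᵍ curveGrading k where
  toRingHom := Ideal.quotientMap _ (subst i).toRingHom (by
    rw [Ideal.span_singleton_le_iff_mem, Ideal.mem_comap]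
    change subst i (cubic k) ∈ _
    rw [subst_cubic i hi]
    exact neg_mem (Ideal.mem_span_singleton_self _))
  map_mem := by
    rintro n _ ⟨p, hp, rfl⟩
    exact mk_mem_quotientGrading _ (subst_mem i hp)

lemma curveRingMap_mk (p : MvPolynomial (Fin 3) k) :
    curveRingMap i hi (Ideal.Quotient.mk _ p) = Ideal.Quotient.mk _ (subst i p) := rfl

lemma curveRingMap_irrelevant :
    (curveGrading k)₊ ≤ (curveGrading k)₊.map (curveRingMap i hi) := by
  refine (toIdeal_irrelevant_le _).mpr fun n hn p hp => ?_
  obtain ⟨p, hp, rfl⟩ := hp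
  change _ ∈ Ideal.map (curveRingMap i hi) _
  have : (Ideal.Quotient.mkₐ k (Ideal.span {cubic k})).toLinearMap p =
      curveRingMap i hi (Ideal.Quotient.mk _ (subst i (subst i (subst i p)))) := by
    rw [curveRingMap_mk, subst_pow_four i hi]
    rfl
  rw [this]
  exact Ideal.mem_map_of_mem _ (mem_irrelevant_of_mem _ hn
    (mk_mem_quotientGrading _ (subst_mem i (subst_mem i (subst_mem i hp)))))

/-- The automorphism `g : [x : y : z] ↦ [-x : iy : z]` of the curve. -/
def curveAut : curve k ⟶ curve k := Proj.map (curveRingMap i hi) (curveRingMap_irrelevant i hi)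

lemma curveAut_toSpec : curveAut i hi ≫ curveToSpec k = curveToSpec k := by
  refine (map_projToSpec (ρ := RingHom.id k) (curveRingMap_irrelevant i hi) fun r => ?_).trans ?_
  · exact congrArg (Ideal.Quotient.mk _) ((subst i).commutes r)
  · exact (congrArg _ (Spec.map_id _)).trans (Category.comp_id _)

end Curve

section Threefold

variable (k : Type u) [Field k]

/-- The product `C ×ₖ C` of two copies of the curve. -/
abbrev square : Scheme.{u} := pullback (curveToSpec k) (curveToSpec k)

/-- The structure map of `C ×ₖ C`. -/
abbrev squareToSpec : square k ⟶ Spec (.of k) := pullback.fst _ _ ≫ curveToSpec k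

/-- The product `(C ×ₖ C) ×ₖ C`. -/
abbrev cube : Scheme.{u} := pullback (squareToSpec k) (curveToSpec k)

/-- The structure map of `(C ×ₖ C) ×ₖ C`. -/
abbrev cubeToSpec : cube k ⟶ Spec (.of k) := pullback.snd _ _ ≫ curveToSpec k

variable {k} (i : k) (hi : i ^ 2 = -1)

/-- The automorphism `g × g`. -/
abbrev squareAut : square k ⟶ square k :=
  pullback.map _ _ _ _ (curveAut i hi) (curveAut i hi) (𝟙 _)
    (by rw [curveAut_toSpec, Category.comp_id]) (by rw [curveAut_toSpec, Category.comp_id])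

lemma squareAut_toSpec : squareAut i hi ≫ squareToSpec k = squareToSpec k := by
  rw [squareAut, squareToSpec, pullback.map, pullback.lift_fst_assoc, Category.assoc,
    curveAut_toSpec]

/-- The diagonal action of `g` on the triple product. -/
abbrev cubeAut : cube k ⟶ cube k :=
  pullback.map _ _ _ _ (squareAut i hi) (curveAut i hi) (𝟙 _)
    (by rw [squareAut_toSpec, Category.comp_id]) (by rw [curveAut_toSpec, Category.comp_id])

lemma cubeAut_toSpec : cubeAut i hi ≫ cubeToSpec k = cubeToSpec k := by
  rw [cubeAut, cubeToSpec, pullback.map, pullback.lift_snd_assoc, Category.assoc, curveAut_toSpec]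

/-- The quotient of `C ×ₖ C ×ₖ C` by the group generated by the diagonal action of `g`. -/
def cubeQuotient : Scheme.{u} := quotient (cubeAut i hi)

/-- The structure map of the quotient. -/
def cubeQuotientToSpec : cubeQuotient i hi ⟶ Spec (.of k) :=
  quotientToSpec (cubeToSpec k) (cubeAut_toSpec i hi)

end Threefold

section Singular

/-- The set of points of `X` at which `f : X ⟶ S` is not smooth: the complement of the largest
open subset on which `f` is smooth. -/
def singularLocus {X S : Scheme.{u}} (f : X ⟶ S) : Closeds X :=
  (⨆ U : {U : X.Opens // Smooth (U.ι ≫ f)}, U.1).compl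

end Singular

section Main

variable {k : Type u} [Field k] (i : k) (hi : i ^ 2 = -1)

/-- The Ueno–Campana threefold: the blow-up of `(C ×ₖ C ×ₖ C)/⟨g⟩` along the reduced closed
subscheme of its singular points. -/
def uenoCampana : Scheme.{u} :=
  blowUp (Scheme.IdealSheafData.vanishingIdeal (singularLocus (cubeQuotientToSpec i hi)))

/-- The structure map of the Ueno–Campana threefold. -/
def uenoCampanaToSpec : uenoCampana i hi ⟶ Spec (.of k) :=
  blowUpMap _ ≫ cubeQuotientToSpec i hi

variable (k)

attribute [local instance] MvPolynomial.gradedAlgebra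

/-- Projective space of dimension `n` over `k`. -/
def projectiveSpace (n : ℕ) : Scheme.{u} := Proj (MvPolynomial.homogeneousSubmodule (Fin (n + 1)) k)

/-- The structure map of projective space. -/
def projectiveSpaceToSpec (n : ℕ) : projectiveSpace k n ⟶ Spec (.of k) :=
  projToSpec (MvPolynomial.homogeneousSubmodule (Fin (n + 1)) k)

end Main

end

end UenoCampana

open AlgebraicGeometry

/-! On the dense open set of C³ where all three points are affine, the xⱼ are nonzero and the
numbers xⱼ² differ from 1 and from each other, g multiplies every xⱼ by −1 and every yⱼ by i. Hence
s = x₁², a = x₂/x₁, b = x₃/x₁, w = y₂/y₁ and v = y₃/y₁ are invariant. They satisfy w²(s − 1) = a(a²s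
− 1) and v²(s − 1) = b(b²s − 1), and generate `RatioRing` together with the inverse of a
discriminant. The remaining functions come from y₁ alone: y₁⁴ = s(s − 1)² and x₁ = y₁²/(s − 1). So
the coordinate ring of the open set is the fourth-root extension `RootRing` of `RatioRing`, with g
acting by y₁ ↦ iy₁ (`RootRing.isLocalization_ofCube`). Since 2 is invertible, its invariants are
exactly `RatioRing` (`mem_range_of_fourthRootAut_eq`), whose spectrum is therefore a dense open
chart of Y.

This chart is rationally parametrized after adjoining square roots. Put a = α², b = β², w = αw', v =
βv'. Eliminating s leaves the conic (w'² − 1)(1 − β⁴) = (v'² − 1)(1 − α⁴) over k(α, β), which has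
the rational point (1, 1). The slope t of the line through (1, 1) and (w', v') parametrizes the
conic, and s is then a rational function of α, β, t. This gives a map from an open subset of affine
3-space (`exists_isParam`). It is surjective onto the chart, because over an algebraically closed
field suitable α, β, t can be found for every point (`exists_param`, `exists_parametrization`).

Finally, a Jacobian computation shows that the chart is smooth over k (`RatioRing.smooth`), so it
avoids the centre of the blow-up and lifts to X (`exists_lift_blowUp`).

Dominance needs density at each stage: of the affine charts in C and C³, of the chart in the
quotient (`StableAffine.isDominant_ι`), and of its preimage in the blow-up (`dense_range_blowUpι`).
These are proved with regular elements and non-nilpotent invariants, without showing that C³, Y or X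
is integral. -/

namespace UenoCampana

universe u

noncomputable section

open CategoryTheory Limits AlgebraicGeometry Opposite TopologicalSpace

/-! ### Ring-valued points and affine charts of Proj -/

section ProjChart

open HomogeneousLocalization HomogeneousIdeal

variable {R A : Type u} [CommRing R] [CommRing A] [Algebra R A] {𝒜 : ℕ → Submodule R A}
  [GradedAlgebra 𝒜]

/-- The evaluation of fractions `a / sⁿ` of degree zero at a ring homomorphism sending `s` to
`1`. -/
def awayEval {S : Type*} [CommRing S] (χ : A →+* S) {s : A} (hs : χ s = 1) : Away 𝒜 s →+* S :=
  (Localization.awayLift χ s (hs ▸ isUnit_one)).comp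
    (algebraMap (Away 𝒜 s) (Localization.Away s))

lemma awayEval_mk {S : Type*} [CommRing S] (χ : A →+* S) {s : A} (hs : χ s = 1) {d : ℕ}
    (hm : s ∈ 𝒜 d) (n : ℕ) (a : A) (ha : a ∈ 𝒜 (n • d)) :
    awayEval χ hs (Away.mk 𝒜 hm n a ha) = χ a := by
  have hu : IsUnit (χ s) := hs ▸ isUnit_one
  change Localization.awayLift χ s hu (Away.mk 𝒜 hm n a ha).val = _
  rw [Away.val_mk, Localization.mk_eq_mk']
  refine (IsLocalization.lift_mk'_spec _ _ _ _).mpr ?_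
  simp [hs]

lemma awayEval_toAway {S : Type*} [CommRing S] (χ : A →+* S) {s : A} (hs : χ s = 1) (r : R) :
    awayEval χ hs (toAway 𝒜 s r) = χ (algebraMap R A r) := by
  have hu : IsUnit (χ s) := hs ▸ isUnit_one
  change Localization.awayLift χ s hu (toAway 𝒜 s r).val = _
  rw [val_toAway]
  exact IsLocalization.lift_eq _ _

lemma comp_awayEval {S S' : Type*} [CommRing S] [CommRing S'] (χ : A →+* S) (f : S →+* S') {s : A}
    (hs : χ s = 1) {d : ℕ} (hm : s ∈ 𝒜 d) :
    f.comp (awayEval χ hs) = awayEval (𝒜 := 𝒜) (f.comp χ) (s := s) (by simp [hs]) := by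
  ext z
  obtain ⟨n, a, ha, rfl⟩ := Away.mk_surjective 𝒜 hm z
  rw [RingHom.comp_apply, awayEval_mk, awayEval_mk, RingHom.comp_apply]

/-- The point of `Proj 𝒜` with values in a ring `S` given by a ring homomorphism `χ : A →+* S`
sending the homogeneous element `s` to `1`. -/
def projPoint {S : Type u} [CommRing S] (χ : A →+* S) {s : A} {d : ℕ} (hm : s ∈ 𝒜 d) (hd : 0 < d)
    (hs : χ s = 1) : Spec (.of S) ⟶ Proj 𝒜 :=
  Spec.map (CommRingCat.ofHom (awayEval χ hs)) ≫ Proj.awayι 𝒜 s hm hd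

section

variable {S S' : Type u} [CommRing S] [CommRing S'] (χ : A →+* S) {s : A} {d : ℕ}
  (hm : s ∈ 𝒜 d) (hd : 0 < d) (hs : χ s = 1)

lemma projPoint_congr {χ χ' : A →+* S} (h : χ = χ') (hs : χ s = 1) :
    projPoint χ hm hd hs = projPoint χ' hm hd (h ▸ hs) := by
  subst h; rfl

lemma map_projPoint (f : S →+* S') :
    Spec.map (CommRingCat.ofHom f) ≫ projPoint χ hm hd hs =
      projPoint (f.comp χ) hm hd (by simp [hs]) := by
  rw [projPoint, projPoint, ← Category.assoc, ← Spec.map_comp, ← comp_awayEval χ f hs hm]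
  rfl

lemma projPoint_toSpec : projPoint χ hm hd hs ≫ projToSpec 𝒜 =
    Spec.map (CommRingCat.ofHom (χ.comp (algebraMap R A))) := by
  rw [projPoint, Category.assoc, awayι_projToSpec, ← Spec.map_comp]
  congr 1
  ext r
  exact awayEval_toAway χ hs r

lemma projPoint_map (φ : 𝒜 →+*ᵍ 𝒜) (hφ : 𝒜₊ ≤ 𝒜₊.map φ) (hφs : φ s = s) (χ' : A →+* S)
    (hs' : χ' s = 1) (hχ : ∀ z, χ (φ z) = χ' z) :
    projPoint χ hm hd hs ≫ Proj.map φ hφ = projPoint χ' hm hd hs' := by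
  -- The chart attached to `φ s` is the chart attached to `s` only through the equation `φ s = s`,
  -- so the point is first rewritten on the chart of any `t = s`.
  have key : ∀ (t : A) (ht : t = s), projPoint χ hm hd hs =
      Spec.map (CommRingCat.ofHom (awayEval χ (s := t) (ht ▸ hs))) ≫
        Proj.awayι 𝒜 t (ht ▸ hm) hd := by
    rintro _ rfl; rfl
  rw [key _ hφs, Category.assoc, Proj.awayι_comp_map φ hφ hd s hm, ← Category.assoc,
    ← Spec.map_comp, projPoint]
  congr 2
  ext z
  obtain ⟨n, a, ha, rfl⟩ := Away.mk_surjective 𝒜 hm z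
  rw [CommRingCat.hom_comp, RingHom.comp_apply]
  have hs'' : χ (φ s) = 1 := by rw [hφs, hs]
  change awayEval χ hs'' (Away.map φ s _) = awayEval χ' hs' _
  rw [Away.map_mk, awayEval_mk, awayEval_mk, hχ]

lemma isOpenImmersion_projPoint (h : Function.Bijective (awayEval (𝒜 := 𝒜) χ hs)) :
    IsOpenImmersion (projPoint χ hm hd hs) := by
  have : IsIso (CommRingCat.ofHom (awayEval (𝒜 := 𝒜) χ hs)) :=
    (RingEquiv.ofBijective _ h).toCommRingCatIso.isIso_hom
  rw [projPoint]
  infer_instance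

lemma range_projPoint (h : Function.Bijective (awayEval (𝒜 := 𝒜) χ hs)) :
    Set.range (projPoint χ hm hd hs) = Proj.basicOpen 𝒜 s := by
  have : IsIso (CommRingCat.ofHom (awayEval (𝒜 := 𝒜) χ hs)) :=
    (RingEquiv.ofBijective _ h).toCommRingCatIso.isIso_hom
  rw [← Proj.opensRange_awayι 𝒜 s hm hd, projPoint, Scheme.Hom.comp_base, TopCat.coe_comp,
    Set.range_comp, Set.range_eq_univ.mpr, Set.image_univ]
  · rfl
  · exact (Spec.map (CommRingCat.ofHom (awayEval (𝒜 := 𝒜) χ hs))).surjective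

end

/-- The basic open subset of `Proj 𝒜` given by a non-zero-divisor is dense. -/
lemma dense_basicOpen_of_mem_nonZeroDivisors {s : A} (hs : s ∈ nonZeroDivisors A) :
    Dense (Proj.basicOpen 𝒜 s : Set (Proj 𝒜)) := by
  intro x
  let p : Ideal A := x.asHomogeneousIdeal.toIdeal
  have hp : p.IsPrime := x.isPrime
  -- A minimal prime q below the prime of x is homogeneous, because its homogeneous core is again
  -- prime, and it contains no non-zero-divisor. So q is a point of D(s) that specializes to x.
  obtain ⟨q, hq, hqp⟩ := Ideal.exists_minimalPrimes_le (I := (⊥ : Ideal A)) (J := p) bot_le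
  have hqprime : q.IsPrime := hq.1.1
  have hcore : (q.homogeneousCore 𝒜).toIdeal = q :=
    le_antisymm (Ideal.toIdeal_homogeneousCore_le 𝒜 q)
      (hq.2 ⟨hqprime.homogeneousCore, bot_le⟩ (Ideal.toIdeal_homogeneousCore_le 𝒜 q))
  have hsq : s ∉ q := fun h =>
    Set.disjoint_left.mp (Ideal.disjoint_nonZeroDivisors_of_mem_minimalPrimes hq) h hs
  let y : Proj 𝒜 := ⟨⟨q, by rw [← hcore]; exact (q.homogeneousCore 𝒜).isHomogeneous⟩, hqprime,
    fun h => x.not_irrelevant_le (h.trans hqp)⟩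
  have hyx : x ∈ closure {y} := (ProjectiveSpectrum.le_iff_mem_closure 𝒜 y x).mp hqp
  exact closure_mono (Set.singleton_subset_iff.mpr (show y ∈ Proj.basicOpen 𝒜 s from hsq)) hyx

lemma isDominant_projPoint {S : Type u} [CommRing S] (χ : A →+* S) {s : A} {d : ℕ} (hm : s ∈ 𝒜 d)
    (hd : 0 < d) (hs : χ s = 1) (h : Function.Bijective (awayEval (𝒜 := 𝒜) χ hs))
    (hs' : s ∈ nonZeroDivisors A) : IsDominant (projPoint χ hm hd hs) := by
  refine ⟨?_⟩
  rw [DenseRange, range_projPoint χ hm hd hs h]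
  exact dense_basicOpen_of_mem_nonZeroDivisors hs'

end ProjChart

/-! ### Degree-zero fractions as polynomials in the fractions of the generators -/

section Dehomogenization

open HomogeneousLocalization HomogeneousIdeal MvPolynomial

variable {R A : Type u} [CommRing R] [CommRing A] [Algebra R A] {𝒜 : ℕ → Submodule R A}
  [GradedAlgebra 𝒜]

/-- Compare monomials: in each monomial of a form of degree n the exponents add up to n, so sⁿ
splits into one factor s for each variable. -/
lemma Away.mk_eq_eval₂ {σ : Type*} [Fintype σ] (π : MvPolynomial σ R →ₐ[R] A)
    (hπ : ∀ j, π (X j) ∈ 𝒜 (1 • 1)) {s : A} (hs : s ∈ 𝒜 1) {n : ℕ} {p : MvPolynomial σ R}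
    (hp : p.IsHomogeneous n) (hmem : π p ∈ 𝒜 (n • 1)) :
    Away.mk 𝒜 hs n (π p) hmem =
      eval₂ (toAway 𝒜 s) (fun j => Away.mk 𝒜 hs 1 (π (X j)) (hπ j)) p := by
  apply HomogeneousLocalization.val_injective
  have hval : ∀ z : Away 𝒜 s, z.val = algebraMap (Away 𝒜 s) (Localization.Away s) z :=
    fun _ => rfl
  rw [Away.val_mk, hval, MvPolynomial.eval₂_comp_left, eval₂_eq',
    Localization.mk_eq_mk', IsLocalization.mk'_eq_iff_eq_mul]
  conv_lhs => rw [p.as_sum, map_sum, map_sum]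
  rw [Finset.sum_mul]
  refine Finset.sum_congr rfl fun d hd => ?_
  have hdeg : ∑ j, d j = n := by
    have := hp (mem_support_iff.mp hd)
    exact (Finsupp.degree_eq_sum d).symm.trans
      ((DFunLike.congr_fun Finsupp.degree_eq_weight_one d).trans this)
  have h1 : ∀ j, (algebraMap (Away 𝒜 s) (Localization.Away s))
      (Away.mk 𝒜 hs 1 (π (X j)) (hπ j)) * algebraMap A _ s = algebraMap A _ (π (X j)) := by
    intro j
    rw [← hval, Away.val_mk, Localization.mk_eq_mk']
    convert! IsLocalization.mk'_spec (Localization.Away s) (π (X j)) (⟨s ^ 1, 1, rfl⟩ : Submonoid.powers s) using 2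
    simp
  have h2 : (algebraMap (Away 𝒜 s) (Localization.Away s)).comp (toAway 𝒜 s) (coeff d p) =
      algebraMap A _ (algebraMap R A (coeff d p)) := val_toAway s _
  rw [h2, mul_assoc]
  rw [monomial_eq, map_mul, map_mul, Finsupp.prod_fintype _ _ (by simp), map_prod, map_prod]
  congr 1
  · rw [← MvPolynomial.algebraMap_eq, AlgHom.commutes]
  · change _ = _ * algebraMap A _ (s ^ n)
    rw [map_pow (algebraMap A _) s n, ← hdeg, ← Finset.prod_pow_eq_pow_sum, ← Finset.prod_mul_distrib]
    refine Finset.prod_congr rfl fun j _ => ?_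
    rw [map_pow, map_pow, ← h1, mul_pow]
    rfl

lemma Away.mk_self {s : A} (hs : s ∈ 𝒜 1) (h : s ∈ 𝒜 (1 • 1)) : Away.mk 𝒜 hs 1 s h = 1 := by
  apply HomogeneousLocalization.val_injective
  rw [Away.val_mk, val_one, Localization.mk_eq_mk', IsLocalization.mk'_eq_iff_eq_mul, one_mul]
  exact congrArg _ (pow_one s).symm

/-- Turns a homogeneous equation of a projective scheme into the affine equation of a chart. -/
lemma Away.eval₂_eq_zero {σ : Type*} [Fintype σ] (π : MvPolynomial σ R →ₐ[R] A)
    (hπ : ∀ j, π (X j) ∈ 𝒜 (1 • 1)) {s : A} (hs : s ∈ 𝒜 1) {n : ℕ} {p : MvPolynomial σ R}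
    (hp : p.IsHomogeneous n) (h : π p = 0) :
    eval₂ (toAway 𝒜 s) (fun j => Away.mk 𝒜 hs 1 (π (X j)) (hπ j)) p = 0 := by
  rw [← Away.mk_eq_eval₂ π hπ hs hp (h ▸ zero_mem _)]
  apply HomogeneousLocalization.val_injective
  rw [Away.val_mk, val_zero, h]
  exact Localization.mk_zero _

/-- A criterion for a ring to be the coordinate ring of the chart `s ≠ 0` of `Proj 𝒜`. -/
lemma awayEval_bijective {σ : Type*} [Fintype σ] (π : MvPolynomial σ R →ₐ[R] A)
    (hπ : ∀ j, π (X j) ∈ 𝒜 (1 • 1)) (hπ' : ∀ n, ∀ a ∈ 𝒜 n, ∃ p, p.IsHomogeneous n ∧ π p = a)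
    {s : A} (hs : s ∈ 𝒜 1) {S : Type*} [CommRing S] [Algebra R S] (χ : A →ₐ[R] S) (hχ : χ s = 1)
    (hgen : Function.Surjective (χ.comp π)) (ψ : S →+* Away 𝒜 s)
    (hψ : ∀ r, ψ (algebraMap R S r) = toAway 𝒜 s r)
    (hψ' : ∀ j, ψ (χ (π (X j))) = Away.mk 𝒜 hs 1 (π (X j)) (hπ j)) :
    Function.Bijective (awayEval (𝒜 := 𝒜) χ.toRingHom hχ) := by
  -- The map `ψ` is the candidate inverse: composed with `χ` and `π` it substitutes the fractions of
  -- the generators. Every element of the chart is such a substitution, which gives injectivity;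
  -- surjectivity comes from `hgen`.
  have key : ∀ p : MvPolynomial σ R, ψ (χ (π p)) =
      eval₂ (toAway 𝒜 s) (fun j => Away.mk 𝒜 hs 1 (π (X j)) (hπ j)) p := by
    intro p
    induction p using MvPolynomial.induction_on with
    | C r =>
      rw [eval₂_C, ← hψ, ← MvPolynomial.algebraMap_eq, AlgHom.commutes, AlgHom.commutes]
    | add p q hp hq => rw [map_add, map_add, map_add, eval₂_add, hp, hq]
    | mul_X p j hp => rw [map_mul, map_mul, map_mul, eval₂_mul, hp, eval₂_X, hψ']
  constructor
  · refine Function.LeftInverse.injective (g := ψ) fun z => ?_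
    obtain ⟨n, a, ha, rfl⟩ := Away.mk_surjective 𝒜 hs z
    obtain ⟨p, hp, rfl⟩ := hπ' _ a ha
    rw [awayEval_mk]
    refine (key p).trans (Away.mk_eq_eval₂ π hπ hs (n := n) ?_ ha).symm
    simpa using hp
  · intro r
    obtain ⟨p, rfl⟩ := hgen r
    refine ⟨eval₂ (toAway 𝒜 s) (fun j => Away.mk 𝒜 hs 1 (π (X j)) (hπ j)) p, ?_⟩
    rw [MvPolynomial.eval₂_comp_left]
    have h1 : (awayEval χ.toRingHom hχ).comp (toAway 𝒜 s) = algebraMap R S := RingHom.ext fun r =>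
      (awayEval_toAway χ.toRingHom hχ r).trans (χ.commutes r)
    have h2 : awayEval χ.toRingHom hχ ∘ (fun j => Away.mk 𝒜 hs 1 (π (X j)) (hπ j)) =
        fun j => χ.comp π (X j) := funext fun j => awayEval_mk χ.toRingHom hχ hs 1 _ _
    rw [h1, h2]
    exact DFunLike.congr_fun (aeval_unique (χ.comp π)).symm p

end Dehomogenization

/-! ### The standard affine chart of projective space -/

section ProjectiveSpace

open HomogeneousLocalization HomogeneousIdeal MvPolynomial

attribute [local instance] MvPolynomial.gradedAlgebra

variable (k : Type u) [Field k] (n : ℕ)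

/-- The evaluation of homogeneous polynomials at `(1, x₁, …, xₙ)`. -/
def dehomogenize : MvPolynomial (Fin (n + 1)) k →ₐ[k] MvPolynomial (Fin n) k :=
  aeval (Fin.cons 1 X)

lemma dehomogenize_zero : dehomogenize k n (X 0) = 1 := by simp [dehomogenize]

lemma dehomogenize_succ (j : Fin n) : dehomogenize k n (X j.succ) = X j := by simp [dehomogenize]

lemma X_mem_homogeneousSubmodule (j : Fin (n + 1)) :
    (X j : MvPolynomial (Fin (n + 1)) k) ∈ homogeneousSubmodule (Fin (n + 1)) k 1 :=
  isHomogeneous_X k j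

/-- The chart `𝔸ⁿ ⟶ ℙⁿ`. -/
def affineChart : Spec (.of (MvPolynomial (Fin n) k)) ⟶ projectiveSpace k n :=
  projPoint (𝒜 := homogeneousSubmodule (Fin (n + 1)) k) (dehomogenize k n).toRingHom
    (X_mem_homogeneousSubmodule k n 0) one_pos (dehomogenize_zero k n)

lemma awayEval_dehomogenize_bijective :
    Function.Bijective (awayEval (𝒜 := homogeneousSubmodule (Fin (n + 1)) k)
      (dehomogenize k n).toRingHom (s := X 0) (dehomogenize_zero k n)) := by
  have hX : ∀ j : Fin (n + 1), AlgHom.id k (MvPolynomial (Fin (n + 1)) k) (X j) ∈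
    homogeneousSubmodule (Fin (n + 1)) k (1 • 1) := fun j => isHomogeneous_X k j
  have h0 := X_mem_homogeneousSubmodule k n 0
  let ψ : MvPolynomial (Fin n) k →+* Away (homogeneousSubmodule (Fin (n + 1)) k) (X 0) :=
    eval₂Hom (toAway _ _) (fun j => Away.mk _ h0 1 (X j.succ) (hX _))
  refine awayEval_bijective (AlgHom.id k _) hX (fun n a ha => ⟨a, ha, rfl⟩) h0 (dehomogenize k n)
    (dehomogenize_zero k n) (fun p => ?_) ψ (fun r => eval₂Hom_C _ _ r) fun j => ?_
  · induction p using MvPolynomial.induction_on with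
    | C r => exact ⟨C r, by simp [dehomogenize]⟩
    | add p q hp hq =>
      obtain ⟨p, rfl⟩ := hp
      obtain ⟨q, rfl⟩ := hq
      exact ⟨p + q, map_add _ _ _⟩
    | mul_X p j hp =>
      obtain ⟨p, rfl⟩ := hp
      refine ⟨p * X j.succ, (map_mul _ _ _).trans ?_⟩
      congr 1
      exact dehomogenize_succ k n j
  · refine Fin.cases ?_ (fun j => ?_) j
    · refine (congrArg ψ (dehomogenize_zero k n)).trans ?_
      rw [map_one]
      exact (Away.mk_self h0 _).symm
    · refine (congrArg ψ (dehomogenize_succ k n j)).trans ?_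
      simp [ψ]

instance : IsOpenImmersion (affineChart k n) :=
  isOpenImmersion_projPoint _ _ _ _ (awayEval_dehomogenize_bijective k n)

instance : IsDominant (affineChart k n) :=
  isDominant_projPoint _ _ _ _ (awayEval_dehomogenize_bijective k n)
    (mem_nonZeroDivisors_of_ne_zero (X_ne_zero 0))

lemma affineChart_toSpec : affineChart k n ≫ projectiveSpaceToSpec k n =
    Spec.map (CommRingCat.ofHom (algebraMap k (MvPolynomial (Fin n) k))) := by
  refine (projPoint_toSpec _ _ _ _).trans ?_
  congr 2
  exact (dehomogenize k n).comp_algebraMap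

end ProjectiveSpace

/-! ### The affine curve y² = x³ − x over a ring -/

section AffineCurve

open Polynomial

/-- The coordinate ring `S[x, y] / (y² - (x³ - x))`. -/
abbrev AffineCurveRing (S : Type*) [CommRing S] : Type _ :=
  AdjoinRoot (X ^ 2 - C (X ^ 3 - X) : S[X][X])

namespace AffineCurveRing

variable (S : Type*) [CommRing S] {S' : Type*} [CommRing S'] [Algebra S S']

/-- The coordinate function `x`. -/
def x : AffineCurveRing S := AdjoinRoot.of _ X

/-- The coordinate function `y`. -/
def y : AffineCurveRing S := AdjoinRoot.root _

lemma y_sq : y S ^ 2 = x S ^ 3 - x S := by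
  have := AdjoinRoot.eval₂_root (X ^ 2 - C (X ^ 3 - X) : S[X][X])
  rw [eval₂_sub, eval₂_pow, eval₂_X, eval₂_C, sub_eq_zero] at this
  exact this.trans ((map_sub (AdjoinRoot.of _) _ _).trans (by rw [map_pow]; rfl))

variable {S}

/-- A solution of `y² = x³ - x` in an `S`-algebra gives a point of the affine curve. -/
def eval (a b : S') (h : b ^ 2 = a ^ 3 - a) : AffineCurveRing S →ₐ[S] S' :=
  AdjoinRoot.liftAlgHom _ (aeval a) b (by
    rw [eval₂_sub, eval₂_pow, eval₂_X, eval₂_C, h]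
    simp)

variable (a b : S') (h : b ^ 2 = a ^ 3 - a)

@[simp] lemma eval_x : eval a b h (x S) = a :=
  (AdjoinRoot.liftAlgHom_of _ _ _ _ _).trans (aeval_X a)

@[simp] lemma eval_y : eval a b h (y S) = b := AdjoinRoot.liftAlgHom_root _ _ _ _

@[ext] lemma algHom_ext {f g : AffineCurveRing S →ₐ[S] S'} (hx : f (x S) = g (x S))
    (hy : f (y S) = g (y S)) : f = g := by
  apply AlgHom.coe_ringHom_injective
  apply AdjoinRoot.ringHom_ext
  · ext r
    · exact (f.commutes r).trans (g.commutes r).symm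
    · exact hx
  · exact hy

variable (S) in
lemma adjoin_eq_top : Algebra.adjoin S {x S, y S} = ⊤ := by
  rw [eq_top_iff]
  rintro r -
  obtain ⟨p, rfl⟩ := AdjoinRoot.mk_surjective r
  have hx : x S ∈ Algebra.adjoin S {x S, y S} := Algebra.subset_adjoin (Set.mem_insert _ _)
  have hy : y S ∈ Algebra.adjoin S {x S, y S} :=
    Algebra.subset_adjoin (Set.mem_insert_of_mem _ rfl)
  have hX : ∀ q : S[X], AdjoinRoot.of (X ^ 2 - C (X ^ 3 - X) : S[X][X]) q ∈
      Algebra.adjoin S {x S, y S} := by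
    intro q
    induction q using Polynomial.induction_on' with
    | add p q hp hq => rw [map_add]; exact add_mem hp hq
    | monomial n a =>
      rw [← C_mul_X_pow_eq_monomial, map_mul, map_pow]
      exact mul_mem (Subalgebra.algebraMap_mem _ a) (pow_mem hx n)
  induction p using Polynomial.induction_on' with
  | add p q hp hq => rw [map_add]; exact add_mem hp hq
  | monomial n a =>
    rw [← C_mul_X_pow_eq_monomial, map_mul, map_pow]
    exact mul_mem (hX a) (pow_mem hy n)

variable (S) in
lemma aeval_surjective : Function.Surjective
    (MvPolynomial.aeval ![x S, y S, 1] : MvPolynomial (Fin 3) S →ₐ[S] AffineCurveRing S) := by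
  rw [← AlgHom.range_eq_top, eq_top_iff, ← adjoin_eq_top, Algebra.adjoin_le_iff]
  rintro _ (rfl | rfl)
  · exact ⟨MvPolynomial.X 0, by simp⟩
  · exact ⟨MvPolynomial.X 1, by simp⟩

end AffineCurveRing

end AffineCurve

/-! ### The affine chart z ≠ 0 of the plane cubic -/

section CurveChart

open MvPolynomial HomogeneousLocalization HomogeneousIdeal

attribute [local instance] MvPolynomial.gradedAlgebra

variable {k : Type u} [Field k]

/-- The evaluation of the homogeneous coordinate ring of the curve at `(a, b, 1)`. -/
def curveEval {S : Type*} [CommRing S] [Algebra k S] (a b : S) (h : b ^ 2 = a ^ 3 - a) :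
    CurveRing k →ₐ[k] S :=
  Ideal.Quotient.liftₐ _ (aeval ![a, b, 1]) (by
    intro p hp
    refine (RingHom.mem_ker (f := (aeval ![a, b, 1] : MvPolynomial (Fin 3) k →ₐ[k] S))).mp
      ((Ideal.span_singleton_le_iff_mem _).mpr ?_ hp)
    rw [RingHom.mem_ker]
    simp [cubic]
    linear_combination h)

section

variable {S : Type*} [CommRing S] [Algebra k S] (a b : S) (h : b ^ 2 = a ^ 3 - a)

@[simp] lemma curveEval_mk (p : MvPolynomial (Fin 3) k) :
    curveEval a b h (Ideal.Quotient.mk _ p) = aeval ![a, b, 1] p := rfl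

lemma curveEval_z : curveEval (k := k) a b h (Ideal.Quotient.mk _ (X 2)) = 1 := by
  rw [curveEval_mk, aeval_X]
  rfl

end

lemma mk_X_mem (j : Fin 3) :
    Ideal.Quotient.mk (Ideal.span {cubic k}) (X j) ∈ curveGrading k 1 :=
  mk_mem_quotientGrading _ (X_mem_homogeneousSubmodule k 2 j)

/-- The point `[a : b : 1]` of the curve. -/
def curvePoint {S : Type u} [CommRing S] [Algebra k S] (a b : S) (h : b ^ 2 = a ^ 3 - a) :
    Spec (.of S) ⟶ curve k :=
  projPoint (curveEval a b h).toRingHom (mk_X_mem 2) one_pos (curveEval_z a b h)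

section

variable {S S' : Type u} [CommRing S] [Algebra k S] [CommRing S'] [Algebra k S'] (a b : S)
  (h : b ^ 2 = a ^ 3 - a)

lemma curvePoint_congr {a b a' b' : S} (ha : a = a') (hb : b = b') (h : b ^ 2 = a ^ 3 - a) :
    curvePoint (k := k) a b h = curvePoint a' b' (ha ▸ hb ▸ h) := by
  subst ha hb; rfl

lemma map_curvePoint (f : S →ₐ[k] S') :
    Spec.map (CommRingCat.ofHom f.toRingHom) ≫ curvePoint (k := k) a b h =
      curvePoint (f a) (f b) (by rw [← map_pow, h, map_sub, map_pow]) := by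
  refine (map_projPoint _ _ _ _ _).trans (projPoint_congr _ _ ?_ _)
  refine congrArg AlgHom.toRingHom (?_ : f.comp (curveEval a b h) = curveEval _ _ _)
  refine Ideal.Quotient.algHom_ext _ (MvPolynomial.algHom_ext fun j => ?_)
  change f (curveEval a b h (Ideal.Quotient.mk _ _)) = aeval ![f a, f b, 1] (X j)
  fin_cases j <;> simp

lemma curvePoint_toSpec : curvePoint a b h ≫ curveToSpec k =
    Spec.map (CommRingCat.ofHom (algebraMap k S)) := by
  refine (projPoint_toSpec _ _ _ _).trans ?_
  congr 2
  exact (curveEval a b h).comp_algebraMap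

lemma curveEval_curveRingMap (i : k) (hi : i ^ 2 = -1)
    (h' : (algebraMap k S i * b) ^ 2 = (-a) ^ 3 - -a) (z : CurveRing k) :
    curveEval a b h (curveRingMap i hi z) = curveEval (-a) (algebraMap k S i * b) h' z := by
  have key : (aeval ![a, b, 1]).comp (subst i) =
      aeval (R := k) ![-a, algebraMap k S i * b, (1 : S)] := by
    ext j
    fin_cases j <;> simp [subst]
  obtain ⟨p, rfl⟩ := Ideal.Quotient.mk_surjective z
  rw [curveRingMap_mk]
  exact DFunLike.congr_fun key p

lemma curveRingMap_z (i : k) (hi : i ^ 2 = -1) :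
    curveRingMap i hi (Ideal.Quotient.mk _ (X 2)) = Ideal.Quotient.mk _ (X 2) := by
  rw [curveRingMap_mk]
  simp [subst]

lemma curvePoint_aut (i : k) (hi : i ^ 2 = -1)
    (h' : (algebraMap k S i * b) ^ 2 = (-a) ^ 3 - -a) :
    curvePoint a b h ≫ curveAut i hi = curvePoint (-a) (algebraMap k S i * b) h' := by
  rw [curvePoint, curveAut]
  refine (projPoint_map _ _ _ _ (curveRingMap i hi) (curveRingMap_irrelevant i hi)
    (curveRingMap_z i hi) (curveEval (-a) (algebraMap k S i * b) h').toRingHom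
    (curveEval_z _ _ _) (curveEval_curveRingMap a b h i hi h')).trans ?_
  rfl

end

variable (k)

variable {k} in
lemma eq_of_eval₂_cubic {S : Type*} [CommRing S] (f : k →+* S) (c : Fin 3 → S) (h : c 2 = 1)
    (h' : eval₂ f c (cubic k) = 0) : c 1 ^ 2 = c 0 ^ 3 - c 0 := by
  replace h' : eval₂ f c (X 1 ^ 2 * X 2 - X 0 * (X 0 ^ 2 - X 2 ^ 2)) = 0 := h'
  simp only [eval₂_sub, eval₂_mul, eval₂_pow, eval₂_X, h] at h'
  linear_combination h'

/-- The inverse exists because the fractions x/z and y/z satisfy the affine equation, which is the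
cubic divided by z³. -/
lemma awayEval_curveEval_bijective :
    Function.Bijective (awayEval (𝒜 := curveGrading k)
      (curveEval (k := k) _ _ (AffineCurveRing.y_sq k)).toRingHom
      (s := Ideal.Quotient.mk _ (X 2)) (curveEval_z _ _ _)) := by
  have hX : ∀ j : Fin 3, Ideal.Quotient.mkₐ k (Ideal.span {cubic k}) (X j) ∈
    curveGrading k (1 • 1) := mk_X_mem
  have h0 : Ideal.Quotient.mk (Ideal.span {cubic k}) (X 2) ∈ curveGrading k 1 := mk_X_mem 2
  let c (j : Fin 3) : Away (curveGrading k) (Ideal.Quotient.mk _ (X 2)) :=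
    Away.mk _ h0 1 (Ideal.Quotient.mkₐ k (Ideal.span {cubic k}) (X j)) (hX j)
  have hc2 : c 2 = 1 := Away.mk_self h0 _
  have heq : c 1 ^ 2 = c 0 ^ 3 - c 0 := eq_of_eval₂_cubic _ c hc2
    (Away.eval₂_eq_zero (Ideal.Quotient.mkₐ k (Ideal.span {cubic k})) hX h0
      (cubic_isHomogeneous k)
      (Ideal.Quotient.eq_zero_iff_mem.mpr (Ideal.mem_span_singleton_self _)))
  let _ : Algebra k (Away (curveGrading k) (Ideal.Quotient.mk (Ideal.span {cubic k}) (X 2))) :=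
    (toAway _ _).toAlgebra
  let ψ := AffineCurveRing.eval (S := k) (c 0) (c 1) heq
  refine awayEval_bijective (Ideal.Quotient.mkₐ k (Ideal.span {cubic k})) hX ?_ h0
    (curveEval (k := k) _ _ (AffineCurveRing.y_sq k)) (curveEval_z _ _ _) ?_ ψ.toRingHom
    ψ.commutes fun j => ?_
  · rintro n _ ⟨p, hp, rfl⟩
    exact ⟨p, hp, rfl⟩
  · exact AffineCurveRing.aeval_surjective k
  · refine (congrArg ψ ((curveEval_mk _ _ _ _).trans (aeval_X _ _))).trans ?_
    fin_cases j
    · exact AffineCurveRing.eval_x _ _ _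
    · exact AffineCurveRing.eval_y _ _ _
    · exact (map_one ψ).trans hc2.symm

/-- The affine chart `z ≠ 0` of the curve. -/
def curveChart : Spec (.of (AffineCurveRing k)) ⟶ curve k :=
  curvePoint _ _ (AffineCurveRing.y_sq k)

instance : IsOpenImmersion (curveChart k) :=
  isOpenImmersion_projPoint _ _ _ _ (awayEval_curveEval_bijective k)

/-- The form z is prime and does not divide the cubic: if the cubic divides pz, then z divides the
cofactor and cancels. -/
lemma mk_X_mem_nonZeroDivisors :
    Ideal.Quotient.mk (Ideal.span {cubic k}) (X 2) ∈ nonZeroDivisors (CurveRing k) := by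
  rw [mem_nonZeroDivisors_iff_right]
  intro a ha
  obtain ⟨p, rfl⟩ := Ideal.Quotient.mk_surjective a
  rw [← map_mul, Ideal.Quotient.eq_zero_iff_mem, Ideal.mem_span_singleton] at ha
  obtain ⟨q, hq⟩ := ha
  have hprime : Prime (X 2 : MvPolynomial (Fin 3) k) := X_prime
  have hdvd : (X 2 : MvPolynomial (Fin 3) k) ∣ cubic k * q := hq ▸ dvd_mul_left _ _
  rcases hprime.dvd_or_dvd hdvd with h | ⟨r, rfl⟩
  · exfalso
    obtain ⟨r, hr⟩ := h
    -- At (1, 0, 0) the cubic takes the value −1 while z vanishes.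
    have := congrArg (MvPolynomial.eval ![1, 0, 0]) hr
    simp [cubic] at this
  · rw [Ideal.Quotient.eq_zero_iff_mem, Ideal.mem_span_singleton]
    exact ⟨r, mul_right_cancel₀ (X_ne_zero (2 : Fin 3)) (by rw [hq]; ring)⟩

instance : IsDominant (curveChart k) :=
  isDominant_projPoint _ _ _ _ (awayEval_curveEval_bijective k) (mk_X_mem_nonZeroDivisors k)

end CurveChart

/-! ### Regular elements in coordinate rings of products with the curve -/

section NonZeroDivisors

open Polynomial TensorProduct nonZeroDivisors

lemma mem_nonZeroDivisors_of_injective_map {R S : Type*} [CommRing R] [CommRing S] (f : R →+* S)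
    (hf : Function.Injective f) {r : R} (hr : f r ∈ S⁰) : r ∈ R⁰ := by
  rw [mem_nonZeroDivisors_iff_right] at hr ⊢
  intro a ha
  exact hf ((hr (f a) (by rw [← map_mul, ha, map_zero])).trans (map_zero f).symm)

lemma algebraMap_mem_nonZeroDivisors_of_flat {R S : Type*} [CommRing R] [CommRing S] [Algebra R S]
    [Module.Flat R S] {r : R} (hr : r ∈ R⁰) : algebraMap R S r ∈ S⁰ := by
  have := Module.Flat.isSMulRegular_of_nonZeroDivisors (M := S) hr
  rw [mem_nonZeroDivisors_iff_right]
  intro a ha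
  refine this ?_
  change r • a = r • (0 : S)
  rw [smul_zero, Algebra.smul_def, mul_comm]
  exact ha

namespace AffineCurveRing

lemma monic_equation (S : Type*) [CommRing S] : (X ^ 2 - C (X ^ 3 - X) : S[X][X]).Monic :=
  monic_X_pow_sub_C _ two_ne_zero

variable {S : Type*} [CommRing S]

lemma aeval_x (p : S[X]) : aeval (x S) p = AdjoinRoot.of _ p := by
  have : aeval (x S) = AlgHom.mk (R := S) (A := S[X]) (B := AffineCurveRing S)
      (AdjoinRoot.of (X ^ 2 - C (X ^ 3 - X) : S[X][X])) (fun _ => rfl) := by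
    ext
    rw [aeval_X]
    rfl
  exact congr($this p)

/-- The coordinate ring is free over S[x], as y satisfies a monic equation, and a monic polynomial
is regular in S[x] for every ring S. Flatness carries regularity upwards. -/
lemma aeval_x_mem_nonZeroDivisors {p : S[X]} (hp : p.Monic) :
    aeval (x S) p ∈ (AffineCurveRing S)⁰ := by
  rw [aeval_x]
  have : Module.Free S[X] (AffineCurveRing S) := (monic_equation S).free_adjoinRoot
  exact algebraMap_mem_nonZeroDivisors_of_flat (S := AffineCurveRing S) hp.mem_nonZeroDivisors

/-- The base change of the curve to S embeds in the curve defined over S, where the previous lemma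
applies; only the injectivity of `f`, witnessed by its left inverse `g`, is needed. -/
lemma aeval_tmul_x_mem_nonZeroDivisors {k S : Type*} [Field k] [CommRing S] [Algebra k S]
    {p : S[X]} (hp : p.Monic) :
    aeval ((1 : S) ⊗ₜ[k] x k) p ∈ (S ⊗[k] AffineCurveRing k)⁰ := by
  let f : S ⊗[k] AffineCurveRing k →ₐ[S] AffineCurveRing S :=
    Algebra.TensorProduct.lift (Algebra.ofId S _) (eval (x S) (y S) (y_sq S))
      (fun _ _ => Commute.all _ _)
  let g : AffineCurveRing S →ₐ[S] S ⊗[k] AffineCurveRing k :=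
    eval (1 ⊗ₜ x k) (1 ⊗ₜ y k) (by
      simp only [Algebra.TensorProduct.tmul_pow, one_pow, y_sq, TensorProduct.tmul_sub])
  have hgf : g.comp f = AlgHom.id S _ := by
    refine Algebra.TensorProduct.ext (AlgHom.ext fun s => ?_) (algHom_ext ?_ ?_)
    · exact (g.comp f).commutes s
    · change g (f (1 ⊗ₜ x k)) = 1 ⊗ₜ x k
      simp only [f, Algebra.TensorProduct.lift_tmul, map_one, one_mul, eval_x, g]
    · change g (f (1 ⊗ₜ y k)) = 1 ⊗ₜ y k
      simp only [f, Algebra.TensorProduct.lift_tmul, map_one, one_mul, eval_y, g]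
  have hf : Function.Injective f :=
    Function.LeftInverse.injective (g := g) fun z => congr($hgf z)
  refine mem_nonZeroDivisors_of_injective_map f.toRingHom hf ?_
  change f (aeval _ p) ∈ _
  rw [← Polynomial.aeval_algHom_apply]
  have : f (1 ⊗ₜ x k) = x S := by
    simp only [f, Algebra.TensorProduct.lift_tmul, map_one, one_mul, eval_x]
  rw [this]
  exact aeval_x_mem_nonZeroDivisors hp

end AffineCurveRing

end NonZeroDivisors

/-! ### The triple product of the affine curve and its discriminant -/

section CubeRing

open Polynomial TensorProduct nonZeroDivisors AffineCurveRing

variable (k : Type u) [Field k]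

/-- The coordinate ring of the triple product of the affine curve. -/
abbrev CubeRing : Type u := (AffineCurveRing k ⊗[k] AffineCurveRing k) ⊗[k] AffineCurveRing k

/-- The embeddings of the coordinate ring of the affine curve into that of its triple product. -/
def cubeIncl : Fin 3 → (AffineCurveRing k →ₐ[k] CubeRing k) :=
  ![Algebra.TensorProduct.includeLeft.comp Algebra.TensorProduct.includeLeft,
    Algebra.TensorProduct.includeLeft.comp Algebra.TensorProduct.includeRight,
    Algebra.TensorProduct.includeRight]

variable {k}

/-- The product of the differences of `0`, `±1` and the numbers `±a`, `±b`, `±c`. -/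
def discr {S : Type*} [CommRing S] (a b c : S) : S :=
  a * b * c * (a ^ 2 - 1) * (b ^ 2 - 1) * (c ^ 2 - 1) * (a ^ 2 - b ^ 2) * (a ^ 2 - c ^ 2) *
    (b ^ 2 - c ^ 2)

lemma map_discr {S S' F : Type*} [CommRing S] [CommRing S'] [FunLike F S S'] [RingHomClass F S S']
    (f : F) (a b c : S) : f (discr a b c) = discr (f a) (f b) (f c) := by
  simp only [discr, map_mul, map_sub, map_pow, map_one]

/-- The triple of coordinates in the triple product. -/
def CubeRing.lift {S : Type*} [CommRing S] [Algebra k S] (a b : Fin 3 → S)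
    (h : ∀ j, b j ^ 2 = a j ^ 3 - a j) : CubeRing k →ₐ[k] S :=
  Algebra.TensorProduct.productMap
    (Algebra.TensorProduct.productMap (eval (a 0) (b 0) (h 0)) (eval (a 1) (b 1) (h 1)))
    (eval (a 2) (b 2) (h 2))

lemma CubeRing.lift_cubeIncl {S : Type*} [CommRing S] [Algebra k S] (a b : Fin 3 → S)
    (h : ∀ j, b j ^ 2 = a j ^ 3 - a j) (j : Fin 3) :
    (CubeRing.lift a b h).comp (cubeIncl k j) = eval (a j) (b j) (h j) := by
  refine AlgHom.ext fun z => ?_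
  fin_cases j <;> simp [CubeRing.lift, cubeIncl]

lemma CubeRing.algHom_ext {S : Type*} [CommRing S] [Algebra k S] {f g : CubeRing k →ₐ[k] S}
    (hx : ∀ j, f (cubeIncl k j (x k)) = g (cubeIncl k j (x k)))
    (hy : ∀ j, f (cubeIncl k j (y k)) = g (cubeIncl k j (y k))) : f = g := by
  refine Algebra.TensorProduct.ext (Algebra.TensorProduct.ext ?_ ?_) ?_
  · exact AffineCurveRing.algHom_ext (hx 0) (hy 0)
  · exact AffineCurveRing.algHom_ext (hx 1) (hy 1)
  · exact AffineCurveRing.algHom_ext (hx 2) (hy 2)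

variable (k)

/-- Up to sign, each factor is a monic polynomial in one xⱼ with coefficients on the earlier factors
of the product. It is regular there, and stays regular after the flat extension by the later
factors. No integrality of the triple product is used. -/
lemma CubeRing.discr_mem_nonZeroDivisors :
    discr (cubeIncl k 0 (x k)) (cubeIncl k 1 (x k)) (cubeIncl k 2 (x k)) ∈ (CubeRing k)⁰ := by
  have h0 : ∀ p : k[X], p.Monic → aeval (cubeIncl k 0 (x k)) p ∈ (CubeRing k)⁰ := by
    intro p hp
    rw [Polynomial.aeval_algHom_apply]
    refine algebraMap_mem_nonZeroDivisors_of_flat (R := AffineCurveRing k ⊗[k] AffineCurveRing k)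
      (S := CubeRing k) ?_
    exact algebraMap_mem_nonZeroDivisors_of_flat (R := AffineCurveRing k)
      (aeval_x_mem_nonZeroDivisors hp)
  have h1 : ∀ p : (AffineCurveRing k)[X], p.Monic →
      algebraMap (AffineCurveRing k ⊗[k] AffineCurveRing k) (CubeRing k)
        (aeval ((1 : AffineCurveRing k) ⊗ₜ[k] x k) p) ∈ (CubeRing k)⁰ := fun p hp =>
    algebraMap_mem_nonZeroDivisors_of_flat (aeval_tmul_x_mem_nonZeroDivisors hp)
  have h2 : ∀ p : (AffineCurveRing k ⊗[k] AffineCurveRing k)[X], p.Monic →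
      aeval (cubeIncl k 2 (x k)) p ∈ (CubeRing k)⁰ := fun p hp =>
    aeval_tmul_x_mem_nonZeroDivisors hp
  have m2 : ∀ {S : Type u} [CommRing S] (c : S), (X ^ 2 - C c : S[X]).Monic := fun c =>
    monic_X_pow_sub_C _ two_ne_zero
  have e12 := h1 _ (m2 (x k ^ 2))
  have e13 := h2 _ (m2 ((x k ^ 2) ⊗ₜ 1))
  have e23 := h2 _ (m2 (1 ⊗ₜ (x k ^ 2)))
  have e1 := h1 _ (m2 1)
  have e1' := h1 X monic_X
  have e0 := h0 _ (m2 1)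
  have e0' := h0 X monic_X
  have e2 := h2 _ (m2 1)
  have e2' := h2 X monic_X
  simp only [map_sub, map_pow, aeval_X, aeval_C, map_one] at e12 e13 e23 e1 e1' e0 e0' e2 e2'
  -- Monic polynomials in the later coordinate give x₂² − x₁² and so on, the opposite sign to
  -- `discr`.
  have hneg : ∀ {a b : CubeRing k}, a - b ∈ (CubeRing k)⁰ → b - a ∈ (CubeRing k)⁰ := by
    intro a b h
    have := mul_mem h (isUnit_one.neg (α := CubeRing k)).mem_nonZeroDivisors
    rwa [mul_neg_one, neg_sub] at this
  have i1 : algebraMap (AffineCurveRing k ⊗[k] AffineCurveRing k) (CubeRing k) (1 ⊗ₜ[k] x k) =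
    cubeIncl k 1 (x k) := rfl
  have i01 : algebraMap (AffineCurveRing k ⊗[k] AffineCurveRing k) (CubeRing k)
    (algebraMap (AffineCurveRing k) _ (x k)) = cubeIncl k 0 (x k) := rfl
  have i02 : algebraMap (AffineCurveRing k ⊗[k] AffineCurveRing k) (CubeRing k)
      ((x k ^ 2) ⊗ₜ 1) = cubeIncl k 0 (x k) ^ 2 := (map_pow (cubeIncl k 0) _ _)
  have i12 : algebraMap (AffineCurveRing k ⊗[k] AffineCurveRing k) (CubeRing k)
      (1 ⊗ₜ (x k ^ 2)) = cubeIncl k 1 (x k) ^ 2 := (map_pow (cubeIncl k 1) _ _)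
  rw [i1, i01] at e12
  rw [i02] at e13
  rw [i12] at e23
  rw [i1] at e1 e1'
  exact mul_mem (mul_mem (mul_mem (mul_mem (mul_mem (mul_mem (mul_mem (mul_mem e0' e1') e2') e0)
    e1) e2) (hneg e12)) (hneg e13)) (hneg e23)

end CubeRing

/-! ### The ring of invariant ratios and its smoothness -/

section InvariantRing

open MvPolynomial

variable (k : Type u) [Field k]

/-- The product of `s`, `s - 1`, `a`, `b`, `a² - 1`, `b² - 1`, `a² - b²`, `a²s - 1` and
`b²s - 1`. -/
def ratioDiscr {S : Type*} [CommRing S] (s a b : S) : S :=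
  s * (s - 1) * a * b * (a ^ 2 - 1) * (b ^ 2 - 1) * (a ^ 2 - b ^ 2) * (a ^ 2 * s - 1) *
    (b ^ 2 * s - 1)

lemma map_ratioDiscr {S S' F : Type*} [CommRing S] [CommRing S'] [FunLike F S S']
    [RingHomClass F S S'] (f : F) (s a b : S) :
    f (ratioDiscr s a b) = ratioDiscr (f s) (f a) (f b) := by
  simp only [ratioDiscr, map_mul, map_sub, map_pow, map_one]

lemma isUnit_ratioDiscr_iff {S : Type*} [CommRing S] {s a b : S} : IsUnit (ratioDiscr s a b) ↔
    (((((((IsUnit s ∧ IsUnit (s - 1)) ∧ IsUnit a) ∧ IsUnit b) ∧ IsUnit (a ^ 2 - 1)) ∧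
      IsUnit (b ^ 2 - 1)) ∧ IsUnit (a ^ 2 - b ^ 2)) ∧ IsUnit (a ^ 2 * s - 1)) ∧
      IsUnit (b ^ 2 * s - 1) := by
  simp only [ratioDiscr, IsUnit.mul_iff]

/-- The equations between the ratios `s = x₁²`, `a = x₂ / x₁`, `b = x₃ / x₁`, `w = y₂ / y₁`,
`v = y₃ / y₁` of the coordinates on the triple product. -/
def ratioRelation : Fin 3 → MvPolynomial (Fin 6) k :=
  ![X 5 * ratioDiscr (X 0) (X 1) (X 2) - 1,
    X 3 ^ 2 * (X 0 - 1) - X 1 * (X 1 ^ 2 * X 0 - 1),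
    X 4 ^ 2 * (X 0 - 1) - X 2 * (X 2 ^ 2 * X 0 - 1)]

section

variable {k} {S : Type*} [CommRing S] (f : MvPolynomial (Fin 6) k →+* S)

lemma map_ratioRelation_zero : f (ratioRelation k 0) =
    f (X 5) * ratioDiscr (f (X 0)) (f (X 1)) (f (X 2)) - 1 := by
  simp [ratioRelation, map_ratioDiscr]

lemma map_ratioRelation_one : f (ratioRelation k 1) =
    f (X 3) ^ 2 * (f (X 0) - 1) - f (X 1) * (f (X 1) ^ 2 * f (X 0) - 1) := by
  simp [ratioRelation]

lemma map_ratioRelation_two : f (ratioRelation k 2) =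
    f (X 4) ^ 2 * (f (X 0) - 1) - f (X 2) * (f (X 2) ^ 2 * f (X 0) - 1) := by
  simp [ratioRelation]

end

/-- The ring of functions `s, a, b, w, v` satisfying the equations between the ratios. -/
abbrev RatioRing : Type u := MvPolynomial (Fin 6) k ⧸ Ideal.span (Set.range (ratioRelation k))

namespace RatioRing

variable {k}

variable (k) in
/-- The generators of the ring. -/
def gen (j : Fin 6) : RatioRing k := Ideal.Quotient.mk _ (X j)

lemma mk_ratioRelation (j : Fin 3) :
    Ideal.Quotient.mk (Ideal.span (Set.range (ratioRelation k))) (ratioRelation k j) = 0 :=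
  Ideal.Quotient.eq_zero_iff_mem.mpr (Ideal.subset_span ⟨j, rfl⟩)

lemma gen_five : gen k 5 * ratioDiscr (gen k 0) (gen k 1) (gen k 2) = 1 :=
  sub_eq_zero.mp ((map_ratioRelation_zero _).symm.trans (mk_ratioRelation 0))

lemma gen_three : gen k 3 ^ 2 * (gen k 0 - 1) = gen k 1 * (gen k 1 ^ 2 * gen k 0 - 1) :=
  sub_eq_zero.mp ((map_ratioRelation_one _).symm.trans (mk_ratioRelation 1))

lemma gen_four : gen k 4 ^ 2 * (gen k 0 - 1) = gen k 2 * (gen k 2 ^ 2 * gen k 0 - 1) :=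
  sub_eq_zero.mp ((map_ratioRelation_two _).symm.trans (mk_ratioRelation 2))

lemma isUnit_ratioDiscr : IsUnit (ratioDiscr (gen k 0) (gen k 1) (gen k 2)) :=
  IsUnit.of_mul_eq_one_right _ gen_five

/-- The invertible elements a and a²s − 1 make the right side of the equation for w² a unit.
Together with the analogous fact for v, this makes the Jacobian determinant invertible. -/
lemma isUnit_gen_three : IsUnit (gen k 3) := by
  obtain ⟨⟨⟨⟨⟨⟨⟨⟨_, _⟩, h⟩, _⟩, _⟩, _⟩, _⟩, h'⟩, _⟩ :=
    isUnit_ratioDiscr_iff.mp (isUnit_ratioDiscr (k := k))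
  have := h.mul h'
  rw [← gen_three, IsUnit.mul_iff] at this
  exact (isUnit_pow_iff two_ne_zero).mp this.1

lemma isUnit_gen_four : IsUnit (gen k 4) := by
  obtain ⟨⟨⟨⟨⟨⟨⟨⟨_, _⟩, _⟩, h⟩, _⟩, _⟩, _⟩, _⟩, h'⟩ :=
    isUnit_ratioDiscr_iff.mp (isUnit_ratioDiscr (k := k))
  have := h.mul h'
  rw [← gen_four, IsUnit.mul_iff] at this
  exact (isUnit_pow_iff two_ne_zero).mp this.1

section

variable {S : Type*} [CommRing S] [Algebra k S] (c : Fin 6 → S)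
  (h0 : c 5 * ratioDiscr (c 0) (c 1) (c 2) = 1)
  (h1 : c 3 ^ 2 * (c 0 - 1) = c 1 * (c 1 ^ 2 * c 0 - 1))
  (h2 : c 4 ^ 2 * (c 0 - 1) = c 2 * (c 2 ^ 2 * c 0 - 1))

/-- A solution of the equations between the ratios in a `k`-algebra. -/
def lift : RatioRing k →ₐ[k] S :=
  Ideal.Quotient.liftₐ _ (aeval c) (by
    intro p hp
    refine (RingHom.mem_ker (f := (aeval c : MvPolynomial (Fin 6) k →ₐ[k] S))).mp
      ((Ideal.span_le (I := RingHom.ker (aeval c : MvPolynomial (Fin 6) k →ₐ[k] S))).mpr ?_ hp)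
    rintro _ ⟨j, rfl⟩
    change aeval c _ = 0
    fin_cases j
    · simp [ratioRelation, map_ratioDiscr, h0]
    · simp [ratioRelation, h1]
    · simp [ratioRelation, h2])

@[simp] lemma lift_gen (j : Fin 6) : lift c h0 h1 h2 (gen k j) = c j := aeval_X c j

lemma algHom_ext {f g : RatioRing k →ₐ[k] S} (h : ∀ j, f (gen k j) = g (gen k j)) : f = g :=
  Ideal.Quotient.algHom_ext _ (MvPolynomial.algHom_ext h)

end

/-- In characteristic different from two, the ring is smooth over the field. -/
lemma smooth (h2 : (2 : k) ≠ 0) : Algebra.Smooth k (RatioRing k) := by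
  -- Differentiate with respect to the inverse of the discriminant, w and v. Each equation involves
  -- exactly one of these three variables, so the Jacobian matrix is diagonal, with entries the
  -- discriminant, 2w(s − 1) and 2v(s − 1).
  have hinj : Function.Injective (![5, 3, 4] : Fin 3 → Fin 6) := by decide
  let P : Algebra.PreSubmersivePresentation k (RatioRing k) (Fin 6) (Fin 3) :=
    Algebra.PreSubmersivePresentation.naive ![5, 3, 4] hinj
  have hdet : P.jacobiMatrix.det =
      ratioDiscr (X 0) (X 1) (X 2) * (2 * X 3 * (X 0 - 1)) * (2 * X 4 * (X 0 - 1)) := by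
    have hP : P.jacobiMatrix = Matrix.of fun i j => pderiv (![5, 3, 4] i) (ratioRelation k j) := by
      ext1 i j
      exact Algebra.PreSubmersivePresentation.jacobiMatrix_naive _ hinj _ _ i j
    have e0 : (ratioRelation k 0) = X 5 * ratioDiscr (X 0) (X 1) (X 2) - 1 := rfl
    have e1 : (ratioRelation k 1) = X 3 ^ 2 * (X 0 - 1) - X 1 * (X 1 ^ 2 * X 0 - 1) := rfl
    have e2 : (ratioRelation k 2) = X 4 ^ 2 * (X 0 - 1) - X 2 * (X 2 ^ 2 * X 0 - 1) := rfl
    have hX : ∀ i j : Fin 6, i ≠ j → pderiv i (X j : MvPolynomial (Fin 6) k) = 0 :=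
      fun i j h => pderiv_X_of_ne h.symm
    rw [hP, Matrix.det_fin_three]
    simp [e0, e1, e2, hX, Derivation.leibniz, ratioDiscr]
    ring
  have hu : IsUnit P.jacobian := by
    rw [P.jacobian_eq_jacobiMatrix_det, hdet]
    have h2' : IsUnit (2 : RatioRing k) := by
      have := (IsUnit.mk0 _ h2).map (algebraMap k (RatioRing k))
      rwa [map_ofNat] at this
    have hs := (isUnit_ratioDiscr_iff.mp (isUnit_ratioDiscr (k := k))).1.1.1.1.1.1.1.2
    have key : ∀ f : MvPolynomial (Fin 6) k →+* RatioRing k, (∀ j, f (X j) = gen k j) →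
        IsUnit (f (ratioDiscr (X 0) (X 1) (X 2) * (2 * X 3 * (X 0 - 1)) *
          (2 * X 4 * (X 0 - 1)))) := by
      intro f hf
      simp only [map_mul, map_ratioDiscr, hf, map_sub, map_one, map_ofNat, IsUnit.mul_iff]
      exact ⟨⟨isUnit_ratioDiscr, ⟨h2', isUnit_gen_three⟩, hs⟩, ⟨h2', isUnit_gen_four⟩, hs⟩
    exact key (algebraMap P.Ring _) fun j => (congr($(P.algebraMap_eq) (X j))).trans (aeval_X P.val j)
  let P' : Algebra.SubmersivePresentation k (RatioRing k) (Fin 6) (Fin 3) := ⟨P, hu⟩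
  have := P'.isStandardSmooth
  infer_instance

end RatioRing

end InvariantRing

/-! ### Invariants of the extension by a fourth root -/

section AdjoinFourthRoot

open Polynomial

variable {R : Type*} [CommRing R] (c i : R) (hi : i ^ 2 = -1)

lemma monic_X_pow_four_sub : (X ^ 4 - C c : R[X]).Monic := monic_X_pow_sub_C _ (by norm_num)

lemma root_pow_four : AdjoinRoot.root (X ^ 4 - C c) ^ 4 = AdjoinRoot.of (X ^ 4 - C c) c := by
  have := AdjoinRoot.eval₂_root (X ^ 4 - C c : R[X])
  rwa [eval₂_sub, eval₂_pow, eval₂_X, eval₂_C, sub_eq_zero] at this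

lemma of_injective_fourthRoot : Function.Injective (AdjoinRoot.of (X ^ 4 - C c)) := by
  intro a b hab
  rw [← sub_eq_zero, ← map_sub, ← AdjoinRoot.mk_C, AdjoinRoot.mk_eq_zero] at hab
  by_contra hne
  have hne' : (C (a - b) : R[X]) ≠ 0 := by rwa [Ne, C_eq_zero, sub_eq_zero]
  have hnt : Nontrivial R := ⟨a, b, hne⟩
  refine (monic_X_pow_four_sub c).not_dvd_of_natDegree_lt hne' ?_ hab
  rw [natDegree_C, natDegree_X_pow_sub_C]
  norm_num

/-- The automorphism of `R[η] / (η⁴ - c)` given by `η ↦ iη`. -/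
def fourthRootAut : AdjoinRoot (X ^ 4 - C c) →ₐ[R] AdjoinRoot (X ^ 4 - C c) :=
  AdjoinRoot.liftAlgHom _ (Algebra.ofId _ _) (AdjoinRoot.of _ i * AdjoinRoot.root _) (by
    rw [eval₂_sub, eval₂_pow, eval₂_X, eval₂_C, mul_pow, root_pow_four, ← map_pow,
      show i ^ 4 = 1 by linear_combination (i ^ 2 - 1) * hi, map_one, one_mul]
    exact sub_self _)

lemma fourthRootAut_root : fourthRootAut c i hi (AdjoinRoot.root _) =
    AdjoinRoot.of _ i * AdjoinRoot.root _ := AdjoinRoot.liftAlgHom_root _ _ _ _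

lemma fourthRootAut_mk (p : R[X]) : fourthRootAut c i hi (AdjoinRoot.mk _ p) =
    AdjoinRoot.mk _ (p.comp (C i * X)) := by
  have : (fourthRootAut c i hi).comp (AdjoinRoot.mkₐ (X ^ 4 - C c)) =
      (AdjoinRoot.mkₐ (X ^ 4 - C c)).comp (aeval (C i * X)) := by
    ext
    simp only [AlgHom.comp_apply, aeval_X, map_mul]
    exact fourthRootAut_root c i hi
  exact congr($this p)

/-- On the basis 1, η, η², η³ the automorphism multiplies the coefficient of ηⁿ by iⁿ. For n = 1, 2,
3 the element iⁿ − 1 divides 2, since (i − 1)(−i − 1) = 2, i² − 1 = −2 and (i³ − 1)(i − 1) = 2. So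
only the constant coefficient of an invariant element survives. -/
lemma mem_range_of_fourthRootAut_eq (h2 : IsUnit (2 : R)) {z : AdjoinRoot (X ^ 4 - C c)}
    (hz : fourthRootAut c i hi z = z) : z ∈ (AdjoinRoot.of (X ^ 4 - C c)).range := by
  rcases subsingleton_or_nontrivial R with hR | hR
  · have := (AdjoinRoot.of (X ^ 4 - C c)).codomain_trivial
    exact ⟨0, Subsingleton.elim _ _⟩
  have hm := monic_X_pow_four_sub c
  obtain ⟨p, hp, rfl⟩ : ∃ p : R[X], p.degree < (4 : ℕ) ∧ AdjoinRoot.mk (X ^ 4 - C c) p = z := by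
    obtain ⟨p, rfl⟩ := AdjoinRoot.mk_surjective z
    refine ⟨p %ₘ (X ^ 4 - C c), ?_, ?_⟩
    · refine (degree_modByMonic_lt p hm).trans_eq ?_
      exact degree_X_pow_sub_C (by norm_num) c
    · rw [AdjoinRoot.mk_eq_mk]
      exact ⟨-(p /ₘ (X ^ 4 - C c)), by linear_combination modByMonic_add_div p (X ^ 4 - C c)⟩
  rw [fourthRootAut_mk, AdjoinRoot.mk_eq_mk] at hz
  have hdeg : (p.comp (C i * X) - p).degree < (4 : ℕ) := by
    rw [degree_lt_iff_coeff_zero] at hp ⊢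
    intro m hm
    rw [coeff_sub, comp_C_mul_X_coeff, hp m hm, zero_mul, sub_zero]
  have heq : p.comp (C i * X) - p = 0 := by
    by_contra hne
    refine hm.not_dvd_of_degree_lt hne ?_ hz
    rwa [degree_X_pow_sub_C (by norm_num)]
  have hcoeff : ∀ n, p.coeff n * (i ^ n - 1) = 0 := by
    intro n
    have := congrArg (coeff · n) heq
    simp only [coeff_sub, comp_C_mul_X_coeff, coeff_zero] at this
    linear_combination this
  have hc : ∀ n, p.coeff n = 0 ∨ n = 0 := by
    intro n
    rw [degree_lt_iff_coeff_zero] at hp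
    rcases lt_or_ge n 4 with hn | hn
    · interval_cases n
      · exact .inr rfl
      · refine .inl (h2.mul_left_eq_zero.mp ?_)
        linear_combination (-i - 1) * hcoeff 1 + p.coeff 1 * hi
      · refine .inl (h2.mul_left_eq_zero.mp ?_)
        linear_combination (-1) * hcoeff 2 + p.coeff 2 * hi
      · refine .inl (h2.mul_left_eq_zero.mp ?_)
        linear_combination (i - 1) * hcoeff 3 + p.coeff 3 * (1 + i - i ^ 2) * hi
    · exact .inl (hp n hn)
  refine ⟨p.coeff 0, ?_⟩
  rw [← AdjoinRoot.mk_C]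
  congr 1
  ext n
  rw [coeff_C]
  split_ifs with h
  · rw [h]
  · exact ((hc n).resolve_right h).symm

end AdjoinFourthRoot

/-- The factors of `discr` contribute x⁹ in all, of which x² is the factor s of `ratioDiscr`. The
remaining x⁷ is harmless, as s being a unit makes x one. -/
lemma isUnit_discr_iff {S : Type*} [CommRing S] {x a b : S} :
    IsUnit (discr x (a * x) (b * x)) ↔ IsUnit (ratioDiscr (x ^ 2) a b) := by
  have h : discr x (a * x) (b * x) = ratioDiscr (x ^ 2) a b * x ^ 7 := by
    simp only [discr, ratioDiscr]
    ring
  rw [h, IsUnit.mul_iff, and_iff_left_iff_imp]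
  intro hu
  exact ((isUnit_pow_iff two_ne_zero).mp (isUnit_ratioDiscr_iff.mp hu).1.1.1.1.1.1.1.1).pow 7

/-! ### The fourth-root extension as an open part of the triple product -/

section RootRing

open Polynomial RatioRing

variable (k : Type u) [Field k]

/-- The ring obtained from the ratios by adjoining `y₁`, with `y₁⁴ = s (s - 1)²`. -/
abbrev RootRing : Type u :=
  AdjoinRoot (X ^ 4 - C (gen k 0 * (gen k 0 - 1) ^ 2) : (RatioRing k)[X])

namespace RootRing

/-- The coordinates `x₁, x₂, x₃`. -/
def coordX (j : Fin 3) : RootRing k :=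
  AdjoinRoot.of _ (![1, gen k 1, gen k 2] j * Ring.inverse (gen k 0 - 1)) * AdjoinRoot.root _ ^ 2

/-- The coordinates `y₁, y₂, y₃`. -/
def coordY (j : Fin 3) : RootRing k :=
  AdjoinRoot.of _ (![1, gen k 3, gen k 4] j) * AdjoinRoot.root _

variable {k}

lemma isUnit_gen_zero_sub_one : IsUnit (gen k 0 - 1) :=
  (isUnit_ratioDiscr_iff.mp (isUnit_ratioDiscr (k := k))).1.1.1.1.1.1.1.2

/-- With y = wη, x = aη²/(s − 1) and η⁴ = s(s − 1)², the curve equation becomes w²(s − 1) = a(a²s −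
1). The first point is the case a = w = 1. -/
lemma coord_eq (j : Fin 3) : coordY k j ^ 2 = coordX k j ^ 3 - coordX k j := by
  have hη := root_pow_four (gen k 0 * (gen k 0 - 1) ^ 2)
  have hr := congrArg (AdjoinRoot.of (X ^ 4 - C (gen k 0 * (gen k 0 - 1) ^ 2)))
    (Ring.mul_inverse_cancel _ (isUnit_gen_zero_sub_one (k := k)))
  have h3 := congrArg (AdjoinRoot.of (X ^ 4 - C (gen k 0 * (gen k 0 - 1) ^ 2))) (gen_three (k := k))
  have h4 := congrArg (AdjoinRoot.of (X ^ 4 - C (gen k 0 * (gen k 0 - 1) ^ 2))) (gen_four (k := k))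
  have key : ∀ {S : Type u} [CommRing S] {s r η a w : S} (_ : η ^ 4 = s * (s - 1) ^ 2)
      (_ : (s - 1) * r = 1) (_ : w ^ 2 * (s - 1) = a * (a ^ 2 * s - 1)),
      (w * η) ^ 2 = (a * r * η ^ 2) ^ 3 - a * r * η ^ 2 := by
    intro S _ s r η a w hη hr h
    have e : (a * r * η ^ 2) ^ 3 - a * r * η ^ 2 =
        η ^ 2 * r * (a * (a ^ 2 * s * ((s - 1) * r) ^ 2 - 1)) := by
      linear_combination a ^ 3 * r ^ 3 * η ^ 2 * hη
    rw [e, hr, one_pow, mul_one, ← h]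
    linear_combination (-w ^ 2 * η ^ 2) * hr
  simp only [map_mul, map_pow, map_sub, map_one] at hη hr h3 h4
  fin_cases j
  · simpa [coordX, coordY] using key hη hr (a := 1) (w := 1) (by ring)
  · simpa [coordX, coordY] using key hη hr h3
  · simpa [coordX, coordY] using key hη hr h4


section

variable {S : Type*} [CommRing S] [Algebra k S]

lemma coordX_eq_mul (j : Fin 3) :
    coordX k j = AdjoinRoot.of _ (![1, gen k 1, gen k 2] j) * coordX k 0 := by
  simp only [coordX, map_mul, Matrix.cons_val_zero, map_one]
  ring

lemma coordY_zero : coordY k 0 = AdjoinRoot.root _ := by simp [coordY]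

lemma coordX_zero_sq : coordX k 0 ^ 2 = AdjoinRoot.of _ (gen k 0) := by
  have hη := root_pow_four (gen k 0 * (gen k 0 - 1) ^ 2)
  have hr := congrArg (AdjoinRoot.of (X ^ 4 - C (gen k 0 * (gen k 0 - 1) ^ 2)))
    (Ring.mul_inverse_cancel _ (isUnit_gen_zero_sub_one (k := k)))
  simp only [map_mul, map_pow, map_sub, map_one] at hη hr
  have key : ∀ {S : Type u} [CommRing S] {s r η : S} (_ : η ^ 4 = s * (s - 1) ^ 2)
      (_ : (s - 1) * r = 1), (1 * r * η ^ 2) ^ 2 = s := by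
    intro S _ s r η hη hr
    linear_combination r ^ 2 * hη + (s * ((s - 1) * r) + s) * hr
  simpa [coordX] using key hη hr

lemma isUnit_coordX_zero : IsUnit (coordX k 0) := by
  rw [← isUnit_pow_iff (two_ne_zero (α := ℕ)), coordX_zero_sq]
  exact (isUnit_ratioDiscr_iff.mp (isUnit_ratioDiscr (k := k))).1.1.1.1.1.1.1.1.map _

lemma isUnit_discr_coordX : IsUnit (discr (coordX k 0) (coordX k 1) (coordX k 2)) := by
  rw [coordX_eq_mul 1, coordX_eq_mul 2, isUnit_discr_iff, coordX_zero_sq]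
  simp only [Matrix.cons_val_one, Matrix.cons_val]
  rw [← map_ratioDiscr]
  exact isUnit_ratioDiscr.map _

lemma isUnit_coordY_zero : IsUnit (coordY k 0) := by
  rw [← isUnit_pow_iff (two_ne_zero (α := ℕ)), coord_eq,
    show coordX k 0 ^ 3 - coordX k 0 = coordX k 0 * (coordX k 0 ^ 2 - 1) by ring, coordX_zero_sq,
    ← map_one (AdjoinRoot.of _), ← map_sub]
  exact isUnit_coordX_zero.mul (isUnit_gen_zero_sub_one.map _)

/-- Existence half of the universal property: the ring represents triples of affine points of the
curve with invertible discriminant. The root goes to `b 0` and the ratios to quotients by `a 0` and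
`b 0`. These are units, because `a 0` and `a 0 ^ 2 - 1` divide the discriminant and their product is
`b 0 ^ 2`. -/
lemma exists_algHom (a b : Fin 3 → S) (h : ∀ j, b j ^ 2 = a j ^ 3 - a j)
    (hd : IsUnit (discr (a 0) (a 1) (a 2))) :
    ∃ f : RootRing k →ₐ[k] S, (∀ j, f (coordX k j) = a j) ∧ ∀ j, f (coordY k j) = b j := by
  have ha0 : IsUnit (a 0) := by
    simp only [discr, IsUnit.mul_iff] at hd
    exact hd.1.1.1.1.1.1.1.1
  have ha0' : IsUnit (a 0 ^ 2 - 1) := by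
    simp only [discr, IsUnit.mul_iff] at hd
    exact hd.1.1.1.1.1.2
  have hb0 : IsUnit (b 0) := by
    rw [← isUnit_pow_iff (two_ne_zero (α := ℕ)), h,
      show a 0 ^ 3 - a 0 = a 0 * (a 0 ^ 2 - 1) by ring]
    exact ha0.mul ha0'
  obtain ⟨A, hA⟩ := ha0.exists_left_inv
  obtain ⟨B, hB⟩ := hb0.exists_left_inv
  have hd' : IsUnit (ratioDiscr (a 0 ^ 2) (a 1 * A) (a 2 * A)) := by
    rw [← isUnit_discr_iff, mul_assoc, mul_assoc, hA, mul_one, mul_one]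
    exact hd
  obtain ⟨D, hD⟩ := hd'.exists_left_inv
  have rel : ∀ j, (b j * B) ^ 2 * (a 0 ^ 2 - 1) = a j * A * ((a j * A) ^ 2 * a 0 ^ 2 - 1) := by
    intro j
    have e1 : a 0 ^ 2 - 1 = b 0 ^ 2 * A := by
      linear_combination A * (-1) * h 0 - (a 0 ^ 2 - 1) * hA
    rw [e1]
    linear_combination A * h j + b j ^ 2 * A * (B * b 0 + 1) * hB - a j ^ 3 * A * (A * a 0 + 1) * hA
  let q : RatioRing k →ₐ[k] S :=
    RatioRing.lift ![a 0 ^ 2, a 1 * A, a 2 * A, b 1 * B, b 2 * B, D] hD (rel 1) (rel 2)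
  have hq : ∀ j, q (gen k j) = ![a 0 ^ 2, a 1 * A, a 2 * A, b 1 * B, b 2 * B, D] j :=
    lift_gen _ _ _ _
  let f : RootRing k →ₐ[k] S := AdjoinRoot.liftAlgHom _ q (b 0) (by
    rw [eval₂_sub, eval₂_pow, eval₂_X, eval₂_C]
    change _ - q _ = 0
    simp only [map_mul, map_pow, map_sub, map_one, hq, Matrix.cons_val_zero]
    linear_combination (b 0 ^ 2 + (a 0 ^ 3 - a 0)) * h 0)
  have hof : ∀ z, f (AdjoinRoot.of _ z) = q z := AdjoinRoot.liftAlgHom_of _ _ _ _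
  have hroot : f (AdjoinRoot.root _) = b 0 := AdjoinRoot.liftAlgHom_root _ _ _ _
  have hX0 : f (coordX k 0) = a 0 := by
    have hr := congrArg q (Ring.mul_inverse_cancel _ (isUnit_gen_zero_sub_one (k := k)))
    simp only [map_mul, map_sub, map_one, hq, Matrix.cons_val_zero] at hr
    simp only [coordX, map_mul, map_pow, hof, hroot, Matrix.cons_val_zero, map_one]
    linear_combination q (Ring.inverse (gen k 0 - 1)) * h 0 + a 0 * hr
  refine ⟨f, fun j => ?_, fun j => ?_⟩
  · rw [coordX_eq_mul, map_mul, hX0, hof]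
    fin_cases j
    · simp
    · simp only [Fin.mk_one, Matrix.cons_val_one, Matrix.cons_val_zero, hq]
      linear_combination a 1 * hA
    · simp only [Fin.reduceFinMk, Matrix.cons_val, hq]
      linear_combination a 2 * hA
  · rw [coordY, map_mul, hroot, hof]
    fin_cases j
    · simp
    · simp only [Fin.mk_one, Matrix.cons_val_one, Matrix.cons_val_zero, hq, Matrix.cons_val]
      linear_combination b 1 * hB
    · simp only [Fin.reduceFinMk, Matrix.cons_val, hq]
      linear_combination b 2 * hB

/-- Uniqueness half of the universal property: η = y₁ and s = x₁², the ratios are recovered by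
cancelling the units x₁ and y₁, and the last generator is an inverse. -/
lemma algHom_ext {f g : RootRing k →ₐ[k] S} (hX : ∀ j, f (coordX k j) = g (coordX k j))
    (hY : ∀ j, f (coordY k j) = g (coordY k j)) : f = g := by
  have hroot : f (AdjoinRoot.root _) = g (AdjoinRoot.root _) := by
    rw [← coordY_zero]
    exact hY 0
  let q : RatioRing k →ₐ[k] RootRing k := IsScalarTower.toAlgHom k _ _
  have hof : ∀ z, q z = AdjoinRoot.of _ z := fun _ => rfl
  have hx : ∀ {r : RatioRing k} {j : Fin 3}, q r * coordX k 0 = coordX k j → f (q r) = g (q r) := by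
    intro r j h
    refine (isUnit_coordX_zero.map f).mul_right_cancel ?_
    rw [← map_mul, h, hX, hX 0, ← map_mul, h]
  have hy : ∀ {r : RatioRing k} {j : Fin 3}, q r * coordY k 0 = coordY k j → f (q r) = g (q r) := by
    intro r j h
    refine (isUnit_coordY_zero.map f).mul_right_cancel ?_
    rw [← map_mul, h, hY, hY 0, ← map_mul, h]
  have h0 : f (q (gen k 0)) = g (q (gen k 0)) := by
    rw [hof, ← coordX_zero_sq, map_pow, map_pow, hX]
  have h1 : f (q (gen k 1)) = g (q (gen k 1)) := hx (coordX_eq_mul 1).symm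
  have h2 : f (q (gen k 2)) = g (q (gen k 2)) := hx (coordX_eq_mul 2).symm
  have h5 : f (q (gen k 5)) = g (q (gen k 5)) := by
    refine ((isUnit_ratioDiscr.map q).map f).mul_right_cancel ?_
    rw [← map_mul, ← map_mul, gen_five, map_one, map_one, map_ratioDiscr, map_ratioDiscr, h0, h1,
      h2, ← map_ratioDiscr, ← map_ratioDiscr, ← map_mul, ← map_mul, gen_five, map_one, map_one]
  have hfg : f.comp q = g.comp q := by
    refine RatioRing.algHom_ext fun j => ?_
    fin_cases j
    · exact h0
    · exact h1
    · exact h2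
    · exact hy (j := 1) (by rw [coordY_zero]; rfl)
    · exact hy (j := 2) (by rw [coordY_zero]; rfl)
    · exact h5
  apply AlgHom.coe_ringHom_injective
  apply AdjoinRoot.ringHom_ext
  · exact RingHom.ext fun z => congr($hfg z)
  · exact hroot

end

variable (k) in
/-- The coordinates as a map from the coordinate ring of the triple product. -/
def ofCube : CubeRing k →ₐ[k] RootRing k := CubeRing.lift (coordX k) (coordY k) coord_eq

lemma ofCube_cubeIncl (j : Fin 3) :
    (ofCube k).comp (cubeIncl k j) = AffineCurveRing.eval (coordX k j) (coordY k j) (coord_eq j) :=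
  CubeRing.lift_cubeIncl _ _ _ j

lemma ofCube_x (j : Fin 3) : ofCube k (cubeIncl k j (AffineCurveRing.x k)) = coordX k j :=
  (congr($(ofCube_cubeIncl j) (AffineCurveRing.x k))).trans (AffineCurveRing.eval_x _ _ _)

lemma ofCube_y (j : Fin 3) : ofCube k (cubeIncl k j (AffineCurveRing.y k)) = coordY k j :=
  (congr($(ofCube_cubeIncl j) (AffineCurveRing.y k))).trans (AffineCurveRing.eval_y _ _ _)

variable (k) in
/-- The product of differences that is inverted in the ring generated by the ratios and `y₁`. -/
def cubeDiscr : CubeRing k := discr (cubeIncl k 0 (AffineCurveRing.x k))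
  (cubeIncl k 1 (AffineCurveRing.x k)) (cubeIncl k 2 (AffineCurveRing.x k))

/-- The localization of the triple product at the discriminant has the same universal property as
`RootRing`; the two induced maps are mutually inverse. -/
lemma isLocalization_ofCube : letI := (ofCube k).toRingHom.toAlgebra
    IsLocalization.Away (cubeDiscr k) (RootRing k) := by
  let _ := (ofCube k).toRingHom.toAlgebra
  let L := Localization.Away (cubeDiscr k)
  let ι : CubeRing k →ₐ[k] L := IsScalarTower.toAlgHom k _ _
  have hu : IsUnit (ofCube k (cubeDiscr k)) := by
    rw [cubeDiscr, map_discr, ofCube_x, ofCube_x, ofCube_x]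
    exact isUnit_discr_coordX
  have hι : IsUnit (ι (cubeDiscr k)) := IsLocalization.Away.algebraMap_isUnit (S := L) _
  obtain ⟨f, hfX, hfY⟩ := exists_algHom (k := k) (S := L)
    (fun j => ι (cubeIncl k j (AffineCurveRing.x k)))
    (fun j => ι (cubeIncl k j (AffineCurveRing.y k)))
    (fun j => by simp only [← map_pow, AffineCurveRing.y_sq, map_sub])
    (by rw [← map_discr]; exact hι)
  have hf : f.comp (ofCube k) = ι := CubeRing.algHom_ext
    (fun j => by rw [AlgHom.comp_apply, ofCube_x, hfX])
    (fun j => by rw [AlgHom.comp_apply, ofCube_y, hfY])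
  let g : L →+* RootRing k := IsLocalization.Away.lift (cubeDiscr k) (g := (ofCube k).toRingHom) hu
  have hg : ∀ z, g (ι z) = ofCube k z := IsLocalization.Away.lift_eq (cubeDiscr k) hu
  let g' : L →ₐ[k] RootRing k := AlgHom.mk g fun r => by
    refine (congrArg g (ι.commutes r).symm).trans ((hg _).trans ((ofCube k).commutes r))
  have hgf : g'.comp f = AlgHom.id k _ := algHom_ext
    (fun j => by
      rw [AlgHom.comp_apply, hfX, ← ofCube_x]
      exact hg _)
    (fun j => by
      rw [AlgHom.comp_apply, hfY, ← ofCube_y]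
      exact hg _)
  have hfg : f.toRingHom.comp g = RingHom.id L :=
    IsLocalization.ringHom_ext (Submonoid.powers (cubeDiscr k)) (RingHom.ext fun z => by
      change f (g (ι z)) = ι z
      rw [hg]
      exact congr($hf z))
  let e : L ≃ₐ[CubeRing k] RootRing k :=
    { g, f with
      invFun := f
      left_inv := fun z => congr($hfg z)
      right_inv := fun z => congr($hgf z)
      commutes' := hg }
  exact IsLocalization.isLocalization_of_algEquiv _ e

end RootRing

section

variable {k} (i : k) (hi : i ^ 2 = -1)

/-- The automorphism `η ↦ iη` of the ring. -/
def rootAut : RootRing k →ₐ[RatioRing k] RootRing k :=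
  fourthRootAut _ (algebraMap k (RatioRing k) i) (by rw [← map_pow, hi, map_neg, map_one])

lemma rootAut_root : rootAut i hi (AdjoinRoot.root _) =
    algebraMap k (RootRing k) i * AdjoinRoot.root _ := fourthRootAut_root _ _ _

lemma rootAut_coordX (j : Fin 3) : rootAut i hi (RootRing.coordX k j) = -RootRing.coordX k j := by
  have h : algebraMap k (RootRing k) i ^ 2 = -1 := by rw [← map_pow, hi, map_neg, map_one]
  rw [RootRing.coordX, map_mul, map_pow, rootAut_root, mul_pow, h]
  exact (congrArg (· * _) ((rootAut i hi).commutes _)).trans (by rw [neg_one_mul, mul_neg]; rfl)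

lemma rootAut_coordY (j : Fin 3) : rootAut i hi (RootRing.coordY k j) =
    algebraMap k (RootRing k) i * RootRing.coordY k j := by
  rw [RootRing.coordY, map_mul, rootAut_root]
  exact (congrArg (· * _) ((rootAut i hi).commutes _)).trans (mul_left_comm _ _ _)

lemma rootAut_eq_iff (h2 : (2 : k) ≠ 0) (z : RootRing k) :
    rootAut i hi z = z ↔ z ∈ (algebraMap (RatioRing k) (RootRing k)).range := by
  refine ⟨fun h => mem_range_of_fourthRootAut_eq _ _ _ ?_ h, ?_⟩
  · have := (IsUnit.mk0 _ h2).map (algebraMap k (RatioRing k))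
    rwa [map_ofNat] at this
  · rintro ⟨z, rfl⟩
    exact (rootAut i hi).commutes z

end

end RootRing

/-! ### The rational parametrization of the space of ratios -/

section Parametrization

open RatioRing

section

variable {S : Type*} [CommRing S] (α β t : S)

/-- The numerator of the parametrization of `(w / α - 1) / 2`. -/
def paramN : S := t * (1 - α ^ 4) - (1 - β ^ 4)

/-- The common denominator of the parametrizations of `w` and `v`. -/
def paramM : S := 1 - β ^ 4 - t ^ 2 * (1 - α ^ 4)

/-- The denominator of the parametrization of `s`. -/
def paramG : S := paramM α β t ^ 2 + 4 * paramN α β t * t * (1 - t)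

/-- The numerator of the parametrization of `w / α`. -/
def paramU : S := paramM α β t + 2 * paramN α β t

/-- The numerator of the parametrization of `v / β`. -/
def paramV : S := paramM α β t + 2 * t * paramN α β t

/-- The product of the functions that have to be invertible on the domain of the
parametrization. -/
def paramDiscr : S :=
  α * β * t * (1 - t) * (1 - α ^ 4) * (1 - β ^ 4) * (α ^ 4 - β ^ 4) * paramN α β t *
    paramM α β t * paramG α β t * paramU α β t * paramV α β t

/-- The values `α, β, t` of the parameters correspond to the point `f` of the space of ratios. -/
structure IsParam {k : Type*} [Field k] [Algebra k S] (f : RatioRing k →ₐ[k] S) : Prop where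
  s : f (gen k 0) * paramG α β t = 4 * paramN α β t * t * (1 - t)
  a : f (gen k 1) = α ^ 2
  b : f (gen k 2) = β ^ 2
  w : f (gen k 3) * paramM α β t = α * paramU α β t
  v : f (gen k 4) * paramM α β t = β * paramV α β t

variable {α β t}

lemma map_paramDiscr {S S' F : Type*} [CommRing S] [CommRing S'] [FunLike F S S']
    [RingHomClass F S S'] (f : F) (α β t : S) :
    f (paramDiscr α β t) = paramDiscr (f α) (f β) (f t) := by
  simp only [paramDiscr, paramU, paramV, paramG, paramM, paramN, map_mul, map_sub, map_pow,
    map_one, map_add, map_ofNat]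

lemma IsParam.map {S S' : Type*} [CommRing S] [CommRing S'] {k : Type*} [Field k] [Algebra k S]
    [Algebra k S'] {α β t : S} {f : RatioRing k →ₐ[k] S} (h : IsParam α β t f) (g : S →ₐ[k] S') :
    IsParam (g α) (g β) (g t) (g.comp f) where
  s := by
    have := congrArg g h.s
    simpa only [paramU, paramV, paramG, paramM, paramN, map_mul, map_sub, map_pow,
      map_one, map_add, map_ofNat, AlgHom.comp_apply] using this
  a := by rw [AlgHom.comp_apply, h.a, map_pow]
  b := by rw [AlgHom.comp_apply, h.b, map_pow]
  w := by
    have := congrArg g h.w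
    simpa only [paramU, paramV, paramG, paramM, paramN, map_mul, map_sub, map_pow,
      map_one, map_add, map_ofNat, AlgHom.comp_apply] using this
  v := by
    have := congrArg g h.v
    simpa only [paramU, paramV, paramG, paramM, paramN, map_mul, map_sub, map_pow,
      map_one, map_add, map_ofNat, AlgHom.comp_apply] using this

/-- The denominators `paramG` and `paramM` are units, so the cross-multiplied equations determine s,
w and v. -/
lemma IsParam.unique {k : Type*} [Field k] [Algebra k S] {f g : RatioRing k →ₐ[k] S}
    (hd : IsUnit (paramDiscr α β t)) (hf : IsParam α β t f) (hg : IsParam α β t g) : f = g := by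
  simp only [paramDiscr, IsUnit.mul_iff] at hd
  obtain ⟨⟨⟨⟨_, hM⟩, hG⟩, _⟩, _⟩ := hd
  have h0 : f (gen k 0) = g (gen k 0) := hG.mul_right_cancel (hf.s.trans hg.s.symm)
  have h1 : f (gen k 1) = g (gen k 1) := hf.a.trans hg.a.symm
  have h2 : f (gen k 2) = g (gen k 2) := hf.b.trans hg.b.symm
  refine RatioRing.algHom_ext fun j => ?_
  fin_cases j
  · exact h0
  · exact h1
  · exact h2
  · exact hM.mul_right_cancel (hf.w.trans hg.w.symm)
  · exact hM.mul_right_cancel (hf.v.trans hg.v.symm)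
  · refine (isUnit_ratioDiscr.map f).mul_right_cancel ?_
    change f (gen k 5) * _ = g (gen k 5) * _
    rw [← map_mul, gen_five, map_one, map_ratioDiscr, h0, h1, h2, ← map_ratioDiscr, ← map_mul,
      gen_five, map_one]

variable (k : Type*) [Field k] [Algebra k S]

/-- Write p = 1 − α⁴, q = 1 − β⁴, N = tp − q, M = q − t²p. Then M + N = pt(1 − t) and M + tN = q(1 −
t). Hence U² = M² + 4pNt(1 − t) and V² = M² + 4qNt(1 − t), while s − 1 = −M²/G; both equations
between the ratios follow. -/
lemma exists_isParam (h2 : (2 : k) ≠ 0) (hd : IsUnit (paramDiscr α β t)) :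
    ∃ f : RatioRing k →ₐ[k] S, IsParam α β t f := by
  simp only [paramDiscr, IsUnit.mul_iff] at hd
  obtain ⟨⟨⟨⟨⟨⟨⟨⟨⟨⟨⟨hα, hβ⟩, ht⟩, ht'⟩, hp⟩, hq⟩, hpq⟩, hN⟩, hM⟩, hG⟩, hU⟩, hV⟩ := hd
  obtain ⟨m, hm⟩ := hM.exists_left_inv
  obtain ⟨g, hg⟩ := hG.exists_left_inv
  have h4 : IsUnit (4 : S) := by
    have h4' : (4 : k) ≠ 0 := by
      rw [show (4 : k) = 2 * 2 by norm_num]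
      exact mul_ne_zero h2 h2
    have := (IsUnit.mk0 _ h4').map (algebraMap k S)
    rwa [map_ofNat] at this
  set s := 4 * paramN α β t * t * (1 - t) * g with hs
  have hmu : IsUnit m := IsUnit.of_mul_eq_one _ hm
  have hgu : IsUnit g := IsUnit.of_mul_eq_one _ hg
  have hs1 : s - 1 = -(paramM α β t ^ 2 * g) := by
    have hg' := hg
    rw [paramG] at hg'
    linear_combination hg'
  have hw : (α * paramU α β t * m) ^ 2 * (s - 1) = α ^ 2 * ((α ^ 2) ^ 2 * s - 1) := by
    have e : paramU α β t ^ 2 = paramM α β t ^ 2 + 4 * (1 - α ^ 4) * paramN α β t * t * (1 - t) := by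
      rw [paramU, paramM, paramN]; ring
    have e' : (α * paramU α β t * m) ^ 2 * (s - 1) = - (α ^ 2 * paramU α β t ^ 2 * g) := by
      rw [hs1]
      linear_combination (-α ^ 2 * paramU α β t ^ 2 * g) * (m * paramM α β t + 1) * hm
    rw [e', e, hs]
    rw [paramG] at hg
    linear_combination -α ^ 2 * hg
  have hv : (β * paramV α β t * m) ^ 2 * (s - 1) = β ^ 2 * ((β ^ 2) ^ 2 * s - 1) := by
    have e : paramV α β t ^ 2 = paramM α β t ^ 2 + 4 * (1 - β ^ 4) * paramN α β t * t * (1 - t) := by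
      rw [paramV, paramM, paramN]; ring
    have e' : (β * paramV α β t * m) ^ 2 * (s - 1) = - (β ^ 2 * paramV α β t ^ 2 * g) := by
      rw [hs1]
      linear_combination (-β ^ 2 * paramV α β t ^ 2 * g) * (m * paramM α β t + 1) * hm
    rw [e', e, hs]
    rw [paramG] at hg
    linear_combination -β ^ 2 * hg
  have hu1 : IsUnit (s - 1) := by
    rw [hs1]
    exact ((hM.pow 2).mul hgu).neg
  have hu : IsUnit (ratioDiscr s (α ^ 2) (β ^ 2)) := by
    refine isUnit_ratioDiscr_iff.mpr ⟨⟨⟨⟨⟨⟨⟨⟨?_, hu1⟩, hα.pow 2⟩, hβ.pow 2⟩, ?_⟩, ?_⟩, ?_⟩, ?_⟩, ?_⟩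
    · exact (((h4.mul hN).mul ht).mul ht').mul hgu
    · convert hp.neg using 1; ring
    · convert hq.neg using 1; ring
    · convert hpq using 1; ring
    -- The relation just proved exhibits α²(α⁴s − 1) as w²(s − 1), and w = αU/M is a unit. This is
    -- why U and V are factors of `paramDiscr`.
    · refine isUnit_of_mul_isUnit_right (x := α ^ 2) ?_
      rw [← hw]
      exact (((hα.mul hU).mul hmu).pow 2).mul hu1
    · refine isUnit_of_mul_isUnit_right (x := β ^ 2) ?_
      rw [← hv]
      exact (((hβ.mul hV).mul hmu).pow 2).mul hu1
  obtain ⟨e, he⟩ := hu.exists_left_inv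
  let f : RatioRing k →ₐ[k] S := RatioRing.lift
    ![s, α ^ 2, β ^ 2, α * paramU α β t * m, β * paramV α β t * m, e] he hw hv
  have hf : ∀ j, f (gen k j) = _ := lift_gen _ _ _ _
  refine ⟨f, ⟨?_, hf 1, hf 2, ?_, ?_⟩⟩
  · rw [hf]
    simp only [Matrix.cons_val_zero, hs]
    linear_combination 4 * paramN α β t * t * (1 - t) * hg
  · rw [hf]
    simp only [Matrix.cons_val]
    linear_combination α * paramU α β t * hm
  · rw [hf]
    simp only [Matrix.cons_val]
    linear_combination β * paramV α β t * hm

/-- Algebraic closedness serves only to extract α and β. After scaling w and v by them, the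
discriminant keeps 1, w' and v' distinct, so the slope t = (v' − 1)/(w' − 1) is defined and differs
from 0 and 1. -/
lemma exists_param {K : Type*} [Field K] [IsAlgClosed K] {k : Type*} [Field k] [Algebra k K]
    (h2 : (2 : k) ≠ 0)
    (f : RatioRing k →ₐ[k] K) : ∃ α β t, paramDiscr α β t ≠ 0 ∧ IsParam α β t f := by
  have h2' : (2 : K) ≠ 0 := by
    have := (map_ne_zero (algebraMap k K)).mpr h2
    rwa [map_ofNat] at this
  have hd := ((isUnit_ratioDiscr (k := k)).map f)
  have hw := congrArg f (gen_three (k := k))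
  have hv := congrArg f (gen_four (k := k))
  rw [map_ratioDiscr] at hd
  simp only [map_mul, map_pow, map_sub, map_one] at hw hv
  obtain ⟨α, hα⟩ := IsAlgClosed.exists_pow_nat_eq (f (gen k 1)) two_pos
  obtain ⟨β, hβ⟩ := IsAlgClosed.exists_pow_nat_eq (f (gen k 2)) two_pos
  generalize hs0 : f (gen k 0) = s at *
  generalize hw0 : f (gen k 3) = w at *
  generalize hv0 : f (gen k 4) = v at *
  rw [← hα, ← hβ] at hd
  rw [← hα] at hw
  rw [← hβ] at hv
  rw [isUnit_ratioDiscr_iff] at hd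
  simp only [isUnit_iff_ne_zero] at hd
  obtain ⟨⟨⟨⟨⟨⟨⟨⟨hs, hs1⟩, ha⟩, hb⟩, ha1⟩, hb1⟩, hab⟩, has⟩, hbs⟩ := hd
  have hα0 : α ≠ 0 := fun h => ha (by rw [h]; ring)
  have hβ0 : β ≠ 0 := fun h => hb (by rw [h]; ring)
  obtain ⟨w', rfl⟩ : ∃ w', w = α * w' := ⟨w / α, by field_simp⟩
  obtain ⟨v', rfl⟩ : ∃ v', v = β * v' := ⟨v / β, by field_simp⟩
  replace hw : w' ^ 2 * (s - 1) = α ^ 4 * s - 1 := by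
    refine mul_left_cancel₀ ha ?_
    linear_combination hw
  replace hv : v' ^ 2 * (s - 1) = β ^ 4 * s - 1 := by
    refine mul_left_cancel₀ hb ?_
    linear_combination hv
  have hw1 : (w' ^ 2 - 1) * (s - 1) = s * ((α ^ 2) ^ 2 - 1) := by linear_combination hw
  have hv1 : (v' ^ 2 - 1) * (s - 1) = s * ((β ^ 2) ^ 2 - 1) := by linear_combination hv
  have hwv : (w' ^ 2 - v' ^ 2) * (s - 1) = s * ((α ^ 2) ^ 2 - (β ^ 2) ^ 2) := by
    linear_combination hw - hv
  have hw2 : w' - 1 ≠ 0 := by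
    intro h
    refine mul_ne_zero hs ha1 ?_
    rw [← hw1]
    linear_combination (w' + 1) * (s - 1) * h
  have hv2 : v' - 1 ≠ 0 := by
    intro h
    refine mul_ne_zero hs hb1 ?_
    rw [← hv1]
    linear_combination (v' + 1) * (s - 1) * h
  have hwv2 : w' - v' ≠ 0 := by
    intro h
    refine mul_ne_zero hs hab ?_
    rw [← hwv]
    linear_combination (w' + v') * (s - 1) * h
  obtain ⟨t, ht⟩ : ∃ t, t * (w' - 1) = v' - 1 := ⟨(v' - 1) / (w' - 1), by field_simp⟩
  have ht0 : t ≠ 0 := fun h => hv2 (by rw [← ht, h, zero_mul])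
  have ht1 : 1 - t ≠ 0 := fun h => hwv2 (by linear_combination (w' - 1) * h + ht)
  have hp : 1 - α ^ 4 ≠ 0 := fun h => ha1 (by linear_combination -h)
  have hq : 1 - β ^ 4 ≠ 0 := fun h => hb1 (by linear_combination -h)
  have hpq : α ^ 4 - β ^ 4 ≠ 0 := fun h => hab (by linear_combination h)
  -- The conic obtained by eliminating s; it passes through (1, 1).
  have hprop : (w' ^ 2 - 1) * (1 - β ^ 4) = (v' ^ 2 - 1) * (1 - α ^ 4) := by
    refine mul_left_cancel₀ hs1 ?_
    linear_combination (1 - β ^ 4) * hw1 - (1 - α ^ 4) * hv1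
  -- Substitute v' − 1 = t(w' − 1) in the conic and cancel w' − 1: this is the second intersection
  -- of the line with the conic.
  have hMN : (w' - 1) * paramM α β t = 2 * paramN α β t := by
    refine mul_left_cancel₀ hw2 ?_
    rw [paramM, paramN]
    linear_combination hprop - (1 - α ^ 4) * (t * (w' - 1) + 2 + (v' - 1)) * ht
  -- If N vanished then so would M, yet M + N = t(1 − t)(1 − α⁴).
  have hN : paramN α β t ≠ 0 := by
    intro h
    have hM : paramM α β t = 0 := by
      rw [h, mul_zero] at hMN
      exact (mul_eq_zero.mp hMN).resolve_left hw2
    refine mul_ne_zero (mul_ne_zero ht0 ht1) hp ?_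
    rw [paramM] at hM
    rw [paramN] at h
    linear_combination h + hM
  have hM : paramM α β t ≠ 0 := by
    intro h
    rw [h, mul_zero] at hMN
    exact (mul_ne_zero h2' hN) hMN.symm
  have hU : w' * paramM α β t = paramU α β t := by
    rw [paramU]
    linear_combination hMN
  have hV : v' * paramM α β t = paramV α β t := by
    rw [paramV]
    linear_combination t * hMN - paramM α β t * ht
  have hw0' : w' ≠ 0 := by
    rintro rfl
    exact has (by linear_combination -hw)
  have hv0' : v' ≠ 0 := by
    rintro rfl
    exact hbs (by linear_combination -hv)
  have hG : s * paramG α β t = 4 * paramN α β t * t * (1 - t) := by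
    refine mul_left_cancel₀ hp ?_
    have e : paramU α β t ^ 2 - paramM α β t ^ 2 =
        4 * (1 - α ^ 4) * paramN α β t * t * (1 - t) := by
      rw [paramU, paramM, paramN]; ring
    have e' : 4 * (1 - α ^ 4) * paramN α β t * t * (1 - t) =
        (w' ^ 2 - 1) * paramM α β t ^ 2 := by
      rw [← e, ← hU]; ring
    rw [paramG]
    linear_combination (s - 1) * e' + paramM α β t ^ 2 * hw1
  have h4 : (4 : K) ≠ 0 := by
    rw [show (4 : K) = 2 * 2 by norm_num]
    exact mul_ne_zero h2' h2'
  have hG0 : paramG α β t ≠ 0 := by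
    intro h
    rw [h, mul_zero] at hG
    exact mul_ne_zero (mul_ne_zero (mul_ne_zero h4 hN) ht0) ht1 hG.symm
  refine ⟨α, β, t, ?_, ⟨by rw [hs0]; exact hG, hα.symm, hβ.symm, ?_, ?_⟩⟩
  · simp only [paramDiscr, mul_ne_zero_iff]
    exact ⟨⟨⟨⟨⟨⟨⟨⟨⟨⟨⟨hα0, hβ0⟩, ht0⟩, ht1⟩, hp⟩, hq⟩, hpq⟩, hN⟩, hM⟩, hG0⟩,
      hU ▸ mul_ne_zero hw0' hM⟩, hV ▸ mul_ne_zero hv0' hM⟩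
  · rw [hw0, ← hU]
    ring
  · rw [hv0, ← hV]
    ring

end

open MvPolynomial

/-- Apart from the coordinates and α⁴ − β⁴, every factor takes the value 1 or −1 at the origin. -/
lemma paramDiscr_ne_zero (k : Type*) [Field k] :
    paramDiscr (X 0 : MvPolynomial (Fin 3) k) (X 1) (X 2) ≠ 0 := by
  have h0 : ∀ p : MvPolynomial (Fin 3) k, eval 0 p ≠ 0 → p ≠ 0 := by
    rintro p hp rfl
    exact hp (map_zero _)
  -- This factor vanishes at the origin, so it is restricted to the line β = t = 0.
  have hab : (X 0 ^ 4 - X 1 ^ 4 : MvPolynomial (Fin 3) k) ≠ 0 := by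
    intro h
    have := congrArg (aeval ![Polynomial.X, 0, (0 : Polynomial k)]) h
    simp at this
  have e2 : constantCoeff (2 : MvPolynomial (Fin 3) k) = 2 := map_ofNat _ _
  simp only [paramDiscr, mul_ne_zero_iff, X_ne_zero, ne_eq, not_false_eq_true, true_and]
  refine ⟨⟨⟨⟨⟨⟨⟨⟨?_, ?_⟩, ?_⟩, hab⟩, ?_⟩, ?_⟩, ?_⟩, ?_⟩, ?_⟩ <;> refine h0 _ ?_ <;>
    simp [paramU, paramV, paramG, paramM, paramN, e2]
  norm_num

/-- The coordinate ring of the domain of the parametrization. -/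
abbrev ParamRing (k : Type u) [Field k] : Type u :=
  Localization.Away (paramDiscr (X 0 : MvPolynomial (Fin 3) k) (X 1) (X 2))

/-- Every point x is the kernel of a map to an algebraically closed field K. Parameters in K extend
to a K-point of the domain, and uniqueness shows that its image is the given K-point, so the kernel
upstairs lies over x. -/
lemma exists_parametrization (k : Type u) [Field k] (h2 : (2 : k) ≠ 0) :
    ∃ f : RatioRing k →ₐ[k] ParamRing k,
      Function.Surjective (PrimeSpectrum.comap f.toRingHom) := by
  let ι : MvPolynomial (Fin 3) k →ₐ[k] ParamRing k := IsScalarTower.toAlgHom k _ _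
  have hu : IsUnit (paramDiscr (ι (X 0)) (ι (X 1)) (ι (X 2))) := by
    rw [← map_paramDiscr]
    exact IsLocalization.Away.algebraMap_isUnit (S := ParamRing k) _
  obtain ⟨f, hf⟩ := exists_isParam k h2 hu
  refine ⟨f, fun x => ?_⟩
  let K := AlgebraicClosure x.asIdeal.ResidueField
  let χ : RatioRing k →ₐ[k] K := IsScalarTower.toAlgHom k _ _
  obtain ⟨α, β, t, hd, hχ⟩ := exists_param h2 χ
  let ev : MvPolynomial (Fin 3) k →ₐ[k] K := aeval ![α, β, t]
  have hev : IsUnit (ev (paramDiscr (X 0) (X 1) (X 2))) := by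
    rw [map_paramDiscr, isUnit_iff_ne_zero]
    simpa [ev] using hd
  let ψ : ParamRing k →+* K := IsLocalization.Away.lift _ (g := ev.toRingHom) hev
  have hψ : ∀ z, ψ (ι z) = ev z := IsLocalization.Away.lift_eq _ hev
  let ψ' : ParamRing k →ₐ[k] K := AlgHom.mk ψ fun r => by
    exact (congrArg ψ (ι.commutes r).symm).trans ((hψ _).trans (ev.commutes r))
  have hψχ : ψ'.comp f = χ := by
    refine IsParam.unique (α := α) (β := β) (t := t) hd.isUnit ?_ hχ
    have := hf.map ψ'
    have e : ∀ j, ψ' (ι (X j)) = ![α, β, t] j := fun j => (hψ _).trans (aeval_X _ _)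
    rw [e, e, e] at this
    exact this
  refine ⟨⟨RingHom.ker ψ, RingHom.ker_isPrime _⟩, PrimeSpectrum.ext ?_⟩
  ext z
  change ψ' (f z) = 0 ↔ z ∈ x.asIdeal
  have : ψ' (f z) = algebraMap x.asIdeal.ResidueField K (algebraMap _ _ z) := congr($hψχ z)
  rw [this, map_eq_zero, Ideal.algebraMap_residueField_eq_zero]

end Parametrization

/-! ### Products of affine charts over a field -/

section ProductChart

open TensorProduct

variable {k S T : Type u} [Field k] [CommRing S] [CommRing T] [Algebra k S] [Algebra k T]
  {X Y : Scheme.{u}} {f : X ⟶ Spec (.of k)} {g : Y ⟶ Spec (.of k)}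
  {p : Spec (.of S) ⟶ X} {q : Spec (.of T) ⟶ Y}
  (hp : p ≫ f = Spec.map (CommRingCat.ofHom (algebraMap k S)))
  (hq : q ≫ g = Spec.map (CommRingCat.ofHom (algebraMap k T)))

/-- The product of two affine charts. -/
def prodChart : Spec (.of (S ⊗[k] T)) ⟶ pullback f g :=
  (pullbackSpecIso k S T).inv ≫
    pullback.map _ _ f g p q (𝟙 _) ((Category.comp_id _).trans hp.symm)
      ((Category.comp_id _).trans hq.symm)

lemma prodChart_fst : prodChart hp hq ≫ pullback.fst f g =
    Spec.map (CommRingCat.ofHom Algebra.TensorProduct.includeLeftRingHom) ≫ p := by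
  rw [prodChart, Category.assoc, pullback.map, pullback.lift_fst, pullbackSpecIso_inv_fst_assoc]

lemma prodChart_snd : prodChart hp hq ≫ pullback.snd f g = Spec.map (CommRingCat.ofHom
    (Algebra.TensorProduct.includeRight : T →ₐ[k] S ⊗[k] T).toRingHom) ≫ q := by
  rw [prodChart, Category.assoc, pullback.map, pullback.lift_snd, pullbackSpecIso_inv_snd_assoc]
  rfl

lemma prodChart_toSpec : prodChart hp hq ≫ pullback.fst f g ≫ f =
    Spec.map (CommRingCat.ofHom (algebraMap k (S ⊗[k] T))) := by
  rw [← Category.assoc, prodChart_fst, Category.assoc, hp, ← Spec.map_comp]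
  rfl

instance isOpenImmersion_prodChart [IsOpenImmersion p] [IsOpenImmersion q] :
    IsOpenImmersion (prodChart hp hq) := by
  rw [prodChart]
  infer_instance

/-- The projections of a fibre product over a field are open, so preimages of dense sets are dense.
The range is the intersection of two such preimages, one of them open. -/
instance isDominant_prodChart [IsOpenImmersion p] [IsOpenImmersion q] [IsDominant p]
    [IsDominant q] : IsDominant (prodChart hp hq) := by
  have : IsDominant (pullback.map (Spec.map (CommRingCat.ofHom (algebraMap k S)))
      (Spec.map (CommRingCat.ofHom (algebraMap k T))) f g p q (𝟙 _)
      ((Category.comp_id _).trans hp.symm) ((Category.comp_id _).trans hq.symm)) := by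
    refine ⟨?_⟩
    rw [DenseRange, Scheme.Pullback.range_map]
    have h1 : Dense (pullback.fst f g ⁻¹' Set.range p) :=
      p.denseRange.preimage (pullback.fst f g).isOpenMap
    have h2 : Dense (pullback.snd f g ⁻¹' Set.range q) :=
      q.denseRange.preimage (pullback.snd f g).isOpenMap
    exact h1.inter_of_isOpen_left h2
      (p.isOpenEmbedding.isOpen_range.preimage (pullback.fst f g).continuous)
  rw [prodChart]
  infer_instance

end ProductChart

/-! ### The equivariant chart of the triple product -/

section CubeChart

open TensorProduct RootRing

lemma isDominant_of_isLocalization_away {R S : Type u} [CommRing R] [CommRing S] [Algebra R S]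
    (r : R) [IsLocalization.Away r S] (hr : r ∈ nonZeroDivisors R) :
    IsDominant (Spec.map (CommRingCat.ofHom (algebraMap R S))) := by
  refine ⟨?_⟩
  change DenseRange (PrimeSpectrum.comap (algebraMap R S))
  rw [PrimeSpectrum.denseRange_comap_iff_ker_le_nilRadical, (RingHom.injective_iff_ker_eq_bot _).mp
    (IsLocalization.injective S (M := .powers r) (Submonoid.powers_le.mpr hr))]
  exact bot_le

variable (k : Type u) [Field k]

/-- The product of the affine charts of the first two factors. -/
def squareChart : Spec (.of (AffineCurveRing k ⊗[k] AffineCurveRing k)) ⟶ square k :=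
  prodChart (curvePoint_toSpec _ _ (AffineCurveRing.y_sq k))
    (curvePoint_toSpec _ _ (AffineCurveRing.y_sq k))

/-- The product of the affine charts of the three factors. -/
def cubeChart : Spec (.of (CubeRing k)) ⟶ cube k :=
  prodChart (p := squareChart k) (prodChart_toSpec _ _)
    (curvePoint_toSpec _ _ (AffineCurveRing.y_sq k))

instance : IsOpenImmersion (squareChart k) :=
  isOpenImmersion_prodChart (p := curveChart k) (q := curveChart k) _ _

instance : IsDominant (squareChart k) :=
  isDominant_prodChart (p := curveChart k) (q := curveChart k) _ _

instance : IsOpenImmersion (cubeChart k) :=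
  isOpenImmersion_prodChart (p := squareChart k) (q := curveChart k) _ _

instance : IsDominant (cubeChart k) :=
  isDominant_prodChart (p := squareChart k) (q := curveChart k) _ _

/-- The open subset of the triple product on which the `xⱼ` are finite and the numbers `0`, `±1`,
`±x₁`, `±x₂`, `±x₃` are distinct. -/
def rootChart : Spec (.of (RootRing k)) ⟶ cube k :=
  Spec.map (CommRingCat.ofHom (ofCube k).toRingHom) ≫ cubeChart k

instance : IsOpenImmersion (rootChart k) := by
  let _ := (ofCube k).toRingHom.toAlgebra
  have := isLocalization_ofCube (k := k)
  have : IsOpenImmersion (Spec.map (CommRingCat.ofHom (ofCube k).toRingHom)) :=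
    IsOpenImmersion.of_isLocalization (S := RootRing k) (cubeDiscr k)
  rw [rootChart]
  infer_instance

instance : IsDominant (rootChart k) := by
  let _ := (ofCube k).toRingHom.toAlgebra
  have := isLocalization_ofCube (k := k)
  have : IsDominant (Spec.map (CommRingCat.ofHom (ofCube k).toRingHom)) :=
    isDominant_of_isLocalization_away (S := RootRing k) (cubeDiscr k)
      (CubeRing.discr_mem_nonZeroDivisors k)
  rw [rootChart]
  infer_instance

variable {k}

lemma map_ofCube_cubeIncl (j : Fin 3) :
    Spec.map (CommRingCat.ofHom (ofCube k).toRingHom) ≫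
      Spec.map (CommRingCat.ofHom (cubeIncl k j).toRingHom) ≫ curveChart k =
      curvePoint (coordX k j) (coordY k j) (coord_eq j) := by
  rw [curveChart, map_curvePoint, map_curvePoint]
  exact curvePoint_congr (ofCube_x j) (ofCube_y j) _

lemma rootChart_fst_fst : rootChart k ≫ pullback.fst _ _ ≫ pullback.fst _ _ =
    curvePoint (coordX k 0) (coordY k 0) (coord_eq 0) := by
  rw [← map_ofCube_cubeIncl, rootChart, Category.assoc]
  congr 1
  have := prodChart_fst (p := squareChart k) (prodChart_toSpec _ _)
    (curvePoint_toSpec _ _ (AffineCurveRing.y_sq k))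
  refine (congr($this ≫ pullback.fst _ _)).trans ?_
  have := prodChart_fst (k := k) (curvePoint_toSpec _ _ (AffineCurveRing.y_sq k))
    (curvePoint_toSpec _ _ (AffineCurveRing.y_sq k))
  rw [Category.assoc]
  refine (congr(_ ≫ $this)).trans ?_
  rw [← Category.assoc, ← Spec.map_comp]
  rfl

lemma rootChart_fst_snd : rootChart k ≫ pullback.fst _ _ ≫ pullback.snd _ _ =
    curvePoint (coordX k 1) (coordY k 1) (coord_eq 1) := by
  rw [← map_ofCube_cubeIncl, rootChart, Category.assoc]
  congr 1
  have := prodChart_fst (p := squareChart k) (prodChart_toSpec _ _)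
    (curvePoint_toSpec _ _ (AffineCurveRing.y_sq k))
  refine (congr($this ≫ pullback.snd _ _)).trans ?_
  have := prodChart_snd (k := k) (curvePoint_toSpec _ _ (AffineCurveRing.y_sq k))
    (curvePoint_toSpec _ _ (AffineCurveRing.y_sq k))
  rw [Category.assoc]
  refine (congr(_ ≫ $this)).trans ?_
  rw [← Category.assoc, ← Spec.map_comp]
  rfl

lemma rootChart_snd : rootChart k ≫ pullback.snd _ _ =
    curvePoint (coordX k 2) (coordY k 2) (coord_eq 2) := by
  rw [← map_ofCube_cubeIncl, rootChart, Category.assoc]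
  congr 1
  exact prodChart_snd (p := squareChart k) (prodChart_toSpec _ _)
    (curvePoint_toSpec _ _ (AffineCurveRing.y_sq k))

lemma rootChart_toSpec : rootChart k ≫ cubeToSpec k =
    Spec.map (CommRingCat.ofHom (algebraMap k (RootRing k))) := by
  rw [← curvePoint_toSpec _ _ (coord_eq 2), ← rootChart_snd, Category.assoc]

variable (i : k) (hi : i ^ 2 = -1)

lemma rootAut_curvePoint (j : Fin 3) :
    Spec.map (CommRingCat.ofHom (rootAut i hi).toRingHom) ≫
      curvePoint (coordX k j) (coordY k j) (coord_eq j) =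
    curvePoint (coordX k j) (coordY k j) (coord_eq j) ≫ curveAut i hi := by
  have h' : (algebraMap k (RootRing k) i * coordY k j) ^ 2 = (-coordX k j) ^ 3 - -coordX k j := by
    rw [← rootAut_coordX i hi, ← rootAut_coordY i hi, ← map_pow, coord_eq, map_sub, map_pow]
  rw [curvePoint_aut _ _ _ i hi h']
  refine (map_curvePoint _ _ _ ((rootAut i hi).restrictScalars k)).trans ?_
  exact curvePoint_congr (rootAut_coordX i hi j) (rootAut_coordY i hi j) _

/-- Equivariance is tested on the three projections to the curve, where both sides are the point
with coordinates (−xⱼ, iyⱼ). -/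
lemma rootAut_rootChart : Spec.map (CommRingCat.ofHom (rootAut i hi).toRingHom) ≫ rootChart k =
    rootChart k ≫ cubeAut i hi := by
  apply pullback.hom_ext
  · apply pullback.hom_ext
    · simp only [Category.assoc, cubeAut, squareAut, pullback.map, pullback.lift_fst]
      rw [rootChart_fst_fst, rootAut_curvePoint, ← rootChart_fst_fst]
      simp only [Category.assoc]
    · simp only [Category.assoc, cubeAut, squareAut, pullback.map, pullback.lift_fst,
        pullback.lift_snd]
      rw [rootChart_fst_snd, rootAut_curvePoint, ← rootChart_fst_snd]
      simp only [Category.assoc]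
  · simp only [Category.assoc, cubeAut, pullback.map, pullback.lift_snd]
    rw [rootChart_snd, rootAut_curvePoint, ← rootChart_snd]
    simp only [Category.assoc]

end CubeChart

/-! ### Non-nilpotent invariants in stable ideals -/

section InvariantElements

open Polynomial

/-- A stable ideal that is not nil contains an invariant element that is not nilpotent. -/
lemma exists_fixed_not_isNilpotent {A : Type*} [CommRing A] (σ : A →+* A)
    (hσ : ∀ a, σ (σ (σ (σ a))) = a) (I : Ideal A) (hI : ∀ a ∈ I, σ a ∈ I) {d : A} (hd : d ∈ I)
    (hd' : ¬ IsNilpotent d) : ∃ c ∈ I, σ c = c ∧ ¬ IsNilpotent c := by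
  -- The orbit polynomial of d has invariant coefficients, and it reduces to X⁴ modulo I, so its
  -- lower coefficients are invariant elements of I.
  let P : A[X] := (X - C d) * (X - C (σ d)) * (X - C (σ (σ d))) * (X - C (σ (σ (σ d))))
  have hPσ : P.map σ = P := by
    simp only [P, Polynomial.map_mul, Polynomial.map_sub, map_X, map_C, hσ]
    ring
  have hPI : P.map (Ideal.Quotient.mk I) = X ^ 4 := by
    have h : ∀ a ∈ I, Ideal.Quotient.mk I a = 0 := fun a ha => Ideal.Quotient.eq_zero_iff_mem.mpr ha
    simp only [P, Polynomial.map_mul, Polynomial.map_sub, map_X, map_C, h _ hd, h _ (hI _ hd),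
      h _ (hI _ (hI _ hd)), h _ (hI _ (hI _ (hI _ hd))), C_0, sub_zero]
    ring
  have hm : P.Monic := (((monic_X_sub_C _).mul (monic_X_sub_C _)).mul (monic_X_sub_C _)).mul
    (monic_X_sub_C _)
  have hdeg : P.natDegree ≤ 4 := by
    simp only [P]
    compute_degree
  have hroot : P.eval d = 0 := by simp [P]
  by_contra! hcon
  have hnil : ∀ n < 4, IsNilpotent (P.coeff n) := by
    intro n hn
    refine hcon _ ?_ ?_
    · rw [← Ideal.Quotient.eq_zero_iff_mem, ← coeff_map, hPI, coeff_X_pow, if_neg hn.ne]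
    · rw [← coeff_map, hPσ]
  have h4 : P.coeff 4 = 1 := by
    rcases subsingleton_or_nontrivial A with h | h
    · exact Subsingleton.elim _ _
    · have : P.natDegree = 4 := by
        simp only [P]
        compute_degree!
      rw [← this]
      exact hm
  -- If all lower coefficients were nilpotent, P(d) = 0 would express d⁴ as a nilpotent element.
  rw [eval_eq_sum_range' (n := 5) (by omega), Finset.sum_range_succ, h4, one_mul] at hroot
  refine hd' ?_
  refine IsNilpotent.of_pow (m := 4) ?_
  rw [eq_neg_of_add_eq_zero_right hroot, isNilpotent_neg_iff, ← mem_nilradical]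
  exact Ideal.sum_mem _ fun n hn => Ideal.mul_mem_right _ _ (hnil n (Finset.mem_range.mp hn))

end InvariantElements

/-! ### Density of charts in the quotient -/

section QuotientChart

namespace StableAffine

variable {Z : Scheme.{u}} {g : Z ⟶ Z}

lemma mem_basicOpen_act (U : StableAffine g) (a : Γ(Z, U.U)) :
    Z.basicOpen (U.act a) = U.U ⊓ g ⁻¹ᵁ Z.basicOpen a :=
  Scheme.basicOpen_appLE ..

lemma basicOpen_ne_bot (U : StableAffine g) {a : Γ(Z, U.U)} (ha : ¬ IsNilpotent a) :
    Z.basicOpen a ≠ ⊥ := fun h => ha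
  ((Scheme.isNilpotent_iff_basicOpen_eq_bot_of_isCompact U.isAffineOpen.isCompact a).mpr h)

lemma act_iterate (hg : g ≫ g ≫ g ≫ g = 𝟙 Z) (U : StableAffine g) (a : Γ(Z, U.U)) :
    U.act (U.act (U.act (U.act a))) = a := by
  have key : ∀ (t : Z ⟶ Z) (_ : t = 𝟙 Z) (e : U.U ≤ t ⁻¹ᵁ U.U), t.appLE U.U U.U e = 𝟙 _ := by
    rintro _ rfl e
    exact (Category.id_comp _).trans (Z.presheaf.map_id _)
  have h : g.appLE U.U U.U U.stable.ge ≫ g.appLE U.U U.U U.stable.ge ≫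
      g.appLE U.U U.U U.stable.ge ≫ g.appLE U.U U.U U.stable.ge = 𝟙 _ := by
    rw [Scheme.Hom.appLE_comp_appLE, Scheme.Hom.appLE_comp_appLE, Scheme.Hom.appLE_comp_appLE]
    exact key _ (by simpa only [Category.assoc] using hg) _
  exact congr($(h).hom a)

/-- A nonempty stable open subset of a stable affine contains a nonempty basic open subset defined
by an invariant section. -/
lemma exists_basicOpen_le (hg : g ≫ g ≫ g ≫ g = 𝟙 Z) (U : StableAffine g) (O : Z.Opens)
    (hO : g ⁻¹ᵁ O = O) (hne : U.U ⊓ O ≠ ⊥) :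
    ∃ c : U.invariants, Z.basicOpen c.1 ≤ O ∧ Z.basicOpen c.1 ≠ ⊥ := by
  -- The sections whose non-vanishing locus lies in O form an ideal, stable because O is.
  -- Non-nilpotent sections are sought, since they have nonempty non-vanishing locus even when Z is
  -- not reduced.
  let I : Ideal Γ(Z, U.U) :=
    { carrier := {a | Z.basicOpen a ≤ O}
      add_mem' := fun ha hb => (Z.basicOpen_add_le _ _).trans (sup_le ha hb)
      zero_mem' := by
        change Z.basicOpen (0 : Γ(Z, U.U)) ≤ O
        rw [Scheme.basicOpen_zero]
        exact bot_le
      smul_mem' := fun c a ha => by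
        change Z.basicOpen (c * a) ≤ O
        rw [Scheme.basicOpen_mul]
        exact inf_le_right.trans ha }
  obtain ⟨x, hx⟩ : ∃ x, x ∈ U.U ⊓ O := by
    by_contra! h
    exact hne (bot_unique fun x hx => h x hx)
  obtain ⟨d, hd, hxd⟩ := U.isAffineOpen.exists_basicOpen_le (V := O) ⟨x, hx.2⟩ hx.1
  have hd' : ¬ IsNilpotent d := by
    intro h
    have := (Scheme.isNilpotent_iff_basicOpen_eq_bot_of_isCompact U.isAffineOpen.isCompact d).mp h
    rw [this] at hxd
    exact hxd
  obtain ⟨c, hc, hcσ, hc'⟩ := exists_fixed_not_isNilpotent U.act (U.act_iterate hg) I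
    (fun a ha => by
      change Z.basicOpen (U.act a) ≤ O
      rw [mem_basicOpen_act]
      exact inf_le_right.trans ((g.preimage_mono ha).trans hO.le)) hd hd'
  exact ⟨⟨c, hcσ⟩, hc, U.basicOpen_ne_bot hc'⟩

lemma basicOpen_le_of_le {U V : StableAffine g} (h : V.U ≤ U.U) (f : U.invariants)
    (hf : Z.basicOpen f.1 ≤ V.U) : U.basicOpen f ≤ V :=
  ⟨res h f, ext ((inf_eq_right.mpr hf).symm.trans (basicOpen_restrict h f.1).symm)⟩

/-- The order demands basic opens of invariant sections on both sides. First D(c) ⊆ W is found with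
c over U, then D(d) ⊆ D(c) with d over W; restricting d to D(c) shows that D(d) is also basic in U.
-/
lemma exists_le_le (hg : g ≫ g ≫ g ≫ g = 𝟙 Z) {U W : StableAffine g} (h : U.U ⊓ W.U ≠ ⊥) :
    ∃ V ≤ U, V ≤ W ∧ V.U ≠ ⊥ := by
  obtain ⟨c, hc, hc'⟩ := U.exists_basicOpen_le hg W.U W.stable h
  obtain ⟨d, hd, hd'⟩ := W.exists_basicOpen_le hg (U.basicOpen c).U (U.basicOpen c).stable
    (by rwa [inf_eq_right.mpr hc])
  exact ⟨W.basicOpen d, (basicOpen_le_of_le (V := U.basicOpen c) hc d hd).trans ⟨c, rfl⟩, ⟨d, rfl⟩,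
    hd'⟩

/-- A nonempty open set of the quotient contains the image of some D(f) with f a non-nilpotent
invariant over a stable affine U. Upstairs D(f) meets the dense set W, and a stable affine V below
both gives a common point of the two charts. -/
lemma isDominant_ι (hg : g ≫ g ≫ g ≫ g = 𝟙 Z) (W : StableAffine g) (hW : Dense (W.U : Set Z)) :
    IsDominant (colimit.ι (quotientDiagram g) W) := by
  refine ⟨dense_iff_inter_open.mpr fun O hO ⟨y, hy⟩ => ?_⟩
  obtain ⟨U, z, rfl⟩ := Scheme.IsLocallyDirected.ι_jointly_surjective (quotientDiagram g) y
  obtain ⟨_, ⟨_, ⟨f, rfl⟩, rfl⟩, hzf, hfO⟩ :=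
    (PrimeSpectrum.isBasis_basic_opens (R := U.invariants)).exists_subset_of_mem_open
      (a := z) (u := (colimit.ι (quotientDiagram g) U) ⁻¹' O) hy
      (hO.preimage (colimit.ι (quotientDiagram g) U).continuous)
  have hf : ¬ IsNilpotent f.1 := by
    intro h
    have h' : IsNilpotent f := by
      obtain ⟨n, hn⟩ := h
      exact ⟨n, Subtype.ext hn⟩
    exact hzf ((PrimeSpectrum.isPrime (R := U.invariants) z).radical_le_iff.mpr bot_le h')
  have hne : (U.basicOpen f).U ⊓ W.U ≠ ⊥ := by
    obtain ⟨x, hx⟩ := (Opens.ne_bot_iff_nonempty _).mp (U.basicOpen_ne_bot hf)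
    obtain ⟨x', hx'⟩ := hW.inter_open_nonempty _ (Z.basicOpen f.1).2 ⟨x, hx⟩
    exact (Opens.ne_bot_iff_nonempty _).mpr ⟨x', hx'⟩
  obtain ⟨V, hVU, hVW, hV⟩ := exists_le_le hg hne
  obtain ⟨x, hx⟩ := (Opens.ne_bot_iff_nonempty _).mp hV
  have hnt : Nontrivial Γ(Z, V.U) := by
    have : Nonempty V.U := ⟨⟨x, hx⟩⟩
    infer_instance
  have hnt' : Nontrivial V.invariants := inferInstance
  let v : PrimeSpectrum V.invariants := Classical.arbitrary _
  have hUf : U.basicOpen f ≤ U := ⟨f, rfl⟩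
  let ιV := colimit.ι (quotientDiagram g) V
  refine ⟨ιV v, ?_, ⟨(quotientDiagram g).map (homOfLE hVW) v, ?_⟩⟩
  · have h1 : ιV v = colimit.ι (quotientDiagram g) U
        ((quotientDiagram g).map (homOfLE hUf) ((quotientDiagram g).map (homOfLE hVU) v)) := by
      have := colimit.w (quotientDiagram g) (homOfLE hVU ≫ homOfLE hUf)
      rw [Functor.map_comp, Category.assoc] at this
      exact congr($this v).symm
    rw [h1]
    refine hfO ?_
    have : (quotientDiagram g).map (homOfLE hUf) ((quotientDiagram g).map (homOfLE hVU) v) ∈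
      Set.range ((quotientDiagram g).map (homOfLE hUf)) := ⟨_, rfl⟩
    rw [range_quotientDiagram_map] at this
    exact this
  · exact congr($(colimit.w (quotientDiagram g) (homOfLE hVW)) v)

end StableAffine

end QuotientChart

/-! ### Charts of the quotient from equivariant open immersions -/

section StableChart

namespace StableAffine

variable {Z : Scheme.{u}} {g : Z ⟶ Z}

/-- The chart of the quotient defined by a stable affine open. -/
def ι (U : StableAffine g) : Spec (.of U.invariants) ⟶ quotient g :=
  colimit.ι (quotientDiagram g) U

instance (U : StableAffine g) : IsOpenImmersion U.ι :=
  inferInstanceAs (IsOpenImmersion (colimit.ι (quotientDiagram g) U))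

lemma ι_toSpec {R : Type u} [CommRing R] (s : Z ⟶ Spec (.of R)) (hs : g ≫ s = s)
    (U : StableAffine g) :
    U.ι ≫ quotientToSpec s hs = Spec.map (CommRingCat.ofHom (U.fromBase s hs)) :=
  colimit.ι_desc _ _

variable (hg : g ≫ g ≫ g ≫ g = 𝟙 Z) {T : Type u} [CommRing T]
  (σ : T →+* T) (j : Spec (.of T) ⟶ Z) [IsOpenImmersion j]
  (hj : Spec.map (CommRingCat.ofHom σ) ≫ j = j ≫ g)

/-- The stable affine open defined by an equivariant open immersion. -/
def ofChart : StableAffine g where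
  U := j.opensRange
  isAffineOpen := isAffineOpen_opensRange j
  stable := by
    have h : ∀ x ∈ j.opensRange, g x ∈ j.opensRange := by
      rintro _ ⟨y, rfl⟩
      exact ⟨Spec.map (CommRingCat.ofHom σ) y, congr($hj y)⟩
    -- Equivariance gives only that g maps the range into itself. If g x lies in the range, three
    -- further applications of g bring it back to x.
    refine le_antisymm (fun x hx => ?_) h
    have := h _ (h _ (h _ hx))
    have e : g (g (g (g x))) = x := congr($hg x)
    rwa [e] at this

section

variable {U : Z.Opens} (hU : U = j.opensRange)

include hU in
lemma top_le_preimage : ⊤ ≤ j ⁻¹ᵁ U := by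
  rw [hU, Scheme.Hom.preimage_opensRange]

/-- The sections over the range of an affine open immersion. -/
def sectionsEquiv : Γ(Z, U) ≃+* T :=
  RingEquiv.ofBijective
    (j.appLE U ⊤ (top_le_preimage j hU) ≫ (Scheme.ΓSpecIso (.of T)).hom).hom (by
    have : IsIso (j.appLE U ⊤ (top_le_preimage j hU)) := by
      have h1 := j.isIso_app U hU.le
      have h2 : IsIso ((Spec (.of T)).presheaf.map
          (homOfLE (top_le_preimage j hU)).op) := by
        have : IsIso (homOfLE (top_le_preimage j hU)) :=
          ⟨homOfLE le_top, Subsingleton.elim _ _, Subsingleton.elim _ _⟩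
        infer_instance
      exact IsIso.comp_isIso
    exact ConcreteCategory.bijective_of_isIso _)

lemma sectionsEquiv_appLE {R : Type u} [CommRing R] (s : Z ⟶ Spec (.of R)) (ρ : R →+* T)
    (hρ : j ≫ s = Spec.map (CommRingCat.ofHom ρ)) (e : U ≤ s ⁻¹ᵁ ⊤) (r : R) :
    sectionsEquiv j hU (((Scheme.ΓSpecIso (.of R)).inv ≫ s.appLE ⊤ U e).hom r) = ρ r := by
  have key : ∀ (t : Spec (.of T) ⟶ Spec (.of R)) (_ : t = Spec.map (CommRingCat.ofHom ρ))
      (e : ⊤ ≤ t ⁻¹ᵁ ⊤), t.appLE ⊤ ⊤ e = (Spec.map (CommRingCat.ofHom ρ)).appTop := by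
    rintro _ rfl _
    exact Scheme.Hom.appLE_eq_app _
  have h : ((Scheme.ΓSpecIso (.of R)).inv ≫ s.appLE ⊤ U e) ≫
      j.appLE U ⊤ (top_le_preimage j hU) ≫ (Scheme.ΓSpecIso (.of T)).hom = CommRingCat.ofHom ρ := by
    rw [Category.assoc, Scheme.Hom.appLE_comp_appLE_assoc, key _ hρ, Scheme.ΓSpecIso_naturality,
      Iso.inv_hom_id_assoc]
  exact congr($(h).hom r)

include hj in
lemma sectionsEquiv_appLE_self (e : U ≤ g ⁻¹ᵁ U) (a : Γ(Z, U)) :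
    sectionsEquiv j hU ((g.appLE U U e).hom a) = σ (sectionsEquiv j hU a) := by
  have key : ∀ (t : Spec (.of T) ⟶ Z) (_ : t = j ≫ g) (e : ⊤ ≤ t ⁻¹ᵁ U)
      (e' : ⊤ ≤ (j ≫ g) ⁻¹ᵁ U), t.appLE U ⊤ e = (j ≫ g).appLE U ⊤ e' := by
    rintro _ rfl _ _; rfl
  have hle := top_le_preimage j hU
  have htop : (⊤ : (Spec (.of T)).Opens) ≤ Spec.map (CommRingCat.ofHom σ) ⁻¹ᵁ ⊤ := le_top
  have h1 : g.appLE U U e ≫ j.appLE U ⊤ hle = j.appLE U ⊤ hle ≫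
        (Spec.map (CommRingCat.ofHom σ)).appLE ⊤ ⊤ htop := by
    rw [Scheme.Hom.appLE_comp_appLE, Scheme.Hom.appLE_comp_appLE]
    exact (key _ hj _ _).symm
  have h2 : (Spec.map (CommRingCat.ofHom σ)).appLE ⊤ ⊤ htop ≫ (Scheme.ΓSpecIso (.of T)).hom =
      (Scheme.ΓSpecIso (.of T)).hom ≫ CommRingCat.ofHom σ := by
    rw [← Scheme.ΓSpecIso_naturality]
    congr 1
  have h3 : g.appLE U U e ≫ j.appLE U ⊤ hle ≫ (Scheme.ΓSpecIso (.of T)).hom =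
      (j.appLE U ⊤ hle ≫ (Scheme.ΓSpecIso (.of T)).hom) ≫ CommRingCat.ofHom σ := by
    rw [Category.assoc, ← h2, ← Category.assoc, h1, Category.assoc]
  exact congr($(h3).hom a)

end

variable {Q : Type u} [CommRing Q] (φ : Q →+* T) (hφ : Function.Injective φ)
  (hφσ : ∀ z, σ z = z ↔ z ∈ φ.range) (W : StableAffine g) (hW : W.U = j.opensRange)

include hj in
lemma sectionsEquiv_act (a : Γ(Z, W.U)) :
    sectionsEquiv j hW (W.act a) = σ (sectionsEquiv j hW a) :=
  sectionsEquiv_appLE_self σ j hj hW W.stable.ge a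

/-- The ring of invariants of the sections over the range of an equivariant affine open
immersion. -/
def invariantsEquiv : Q ≃+* W.invariants :=
  RingEquiv.ofBijective
    (((sectionsEquiv j hW).symm.toRingHom.comp φ).codRestrict W.invariants
      (fun q => by
        change W.act ((sectionsEquiv j hW).symm (φ q)) = (sectionsEquiv j hW).symm (φ q)
        apply (sectionsEquiv j hW).injective
        rw [sectionsEquiv_act σ j hj, RingEquiv.apply_symm_apply]
        exact (hφσ _).mpr ⟨q, rfl⟩))
    ⟨fun a b h => hφ ((sectionsEquiv j hW).symm.injective (congrArg Subtype.val h)), fun a => by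
      obtain ⟨q, hq⟩ := (hφσ (sectionsEquiv j hW a.1)).mp (by
        rw [← sectionsEquiv_act σ j hj]
        exact congrArg _ a.2)
      exact ⟨q, Subtype.ext ((RingEquiv.symm_apply_eq _).mpr hq)⟩⟩

lemma sectionsEquiv_invariantsEquiv (q : Q) :
    sectionsEquiv j hW (invariantsEquiv σ j hj φ hφ hφσ W hW q).1 = φ q :=
  (sectionsEquiv j hW).apply_symm_apply _

lemma isIso_map_ringEquiv {A B : Type u} [CommRing A] [CommRing B] (e : A ≃+* B) :
    IsIso (Spec.map (CommRingCat.ofHom e.toRingHom)) := by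
  have : IsIso (CommRingCat.ofHom e.toRingHom) := e.toCommRingCatIso.isIso_hom
  infer_instance

lemma invariantsEquiv_symm_fromBase {R : Type u} [CommRing R] (s : Z ⟶ Spec (.of R))
    (hs : g ≫ s = s) (ρ : R →+* Q)
    (hρ : j ≫ s = Spec.map (CommRingCat.ofHom (φ.comp ρ))) (r : R) :
    (invariantsEquiv σ j hj φ hφ hφσ W hW).symm (W.fromBase s hs r) = ρ r := by
  refine hφ ?_
  rw [← sectionsEquiv_invariantsEquiv σ j hj φ hφ hφσ W hW, RingEquiv.apply_symm_apply]
  exact sectionsEquiv_appLE j hW s _ hρ _ r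

/-- The chart of the quotient defined by an equivariant affine open immersion. -/
def quotientChart : Spec (.of Q) ⟶ quotient g :=
  Spec.map (CommRingCat.ofHom (invariantsEquiv σ j hj φ hφ hφσ (ofChart hg σ j hj)
    rfl).symm.toRingHom) ≫ (ofChart hg σ j hj).ι

instance isOpenImmersion_quotientChart :
    IsOpenImmersion (quotientChart hg σ j hj φ hφ hφσ) := by
  have := isIso_map_ringEquiv (invariantsEquiv σ j hj φ hφ hφσ (ofChart hg σ j hj) rfl).symm
  rw [quotientChart]
  infer_instance

lemma isDominant_quotientChart [IsDominant j] :
    IsDominant (quotientChart hg σ j hj φ hφ hφσ) := by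
  have := isIso_map_ringEquiv (invariantsEquiv σ j hj φ hφ hφσ (ofChart hg σ j hj) rfl).symm
  have : IsDominant (ofChart hg σ j hj).ι := isDominant_ι hg _ j.denseRange
  rw [quotientChart]
  infer_instance

lemma quotientChart_toSpec {R : Type u} [CommRing R] (s : Z ⟶ Spec (.of R)) (hs : g ≫ s = s)
    (ρ : R →+* Q) (hρ : j ≫ s = Spec.map (CommRingCat.ofHom (φ.comp ρ))) :
    quotientChart hg σ j hj φ hφ hφσ ≫ quotientToSpec s hs = Spec.map (CommRingCat.ofHom ρ) := by
  have h : (invariantsEquiv σ j hj φ hφ hφσ (ofChart hg σ j hj) rfl).symm.toRingHom.comp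
      ((ofChart hg σ j hj).fromBase s hs) = ρ :=
    RingHom.ext fun r => invariantsEquiv_symm_fromBase σ j hj φ hφ hφσ _ rfl s hs ρ hρ r
  rw [quotientChart, Category.assoc, ι_toSpec, ← h]
  exact (Spec.map_comp _ _).symm

end StableAffine

end StableChart

/-! ### The automorphisms have fourth power the identity -/

section OrderFour

open HomogeneousIdeal

lemma projMap_iterate_eq_id {R A : Type u} [CommRing R] [CommRing A] [Algebra R A]
    {𝒜 : ℕ → Submodule R A} [GradedAlgebra 𝒜] (φ : 𝒜 →+*ᵍ 𝒜) (hφ : 𝒜₊ ≤ 𝒜₊.map φ)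
    (h : ∀ a, φ (φ (φ (φ a))) = a) :
    Proj.map φ hφ ≫ Proj.map φ hφ ≫ Proj.map φ hφ ≫ Proj.map φ hφ = 𝟙 _ := by
  have key : ∀ (ψ : 𝒜 →+*ᵍ 𝒜) (_ : ψ = .id 𝒜) (hψ : 𝒜₊ ≤ 𝒜₊.map ψ), Proj.map ψ hψ = 𝟙 _ := by
    rintro _ rfl hψ
    exact Proj.map_id
  rw [← Proj.map_comp, ← Proj.map_comp, ← Proj.map_comp]
  exact key _ (GradedRingHom.ext h) _

variable {k : Type u} [Field k] (i : k) (hi : i ^ 2 = -1)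

lemma curveAut_iterate :
    curveAut i hi ≫ curveAut i hi ≫ curveAut i hi ≫ curveAut i hi = 𝟙 (curve k) := by
  refine projMap_iterate_eq_id (curveRingMap i hi) (curveRingMap_irrelevant i hi) fun a => ?_
  obtain ⟨p, rfl⟩ := Ideal.Quotient.mk_surjective a
  simp only [curveRingMap_mk, subst_pow_four i hi]

lemma squareAut_fst : squareAut i hi ≫ pullback.fst _ _ = pullback.fst _ _ ≫ curveAut i hi :=
  pullback.lift_fst _ _ _

lemma squareAut_snd : squareAut i hi ≫ pullback.snd _ _ = pullback.snd _ _ ≫ curveAut i hi :=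
  pullback.lift_snd _ _ _

lemma cubeAut_fst : cubeAut i hi ≫ pullback.fst _ _ = pullback.fst _ _ ≫ squareAut i hi :=
  pullback.lift_fst _ _ _

lemma cubeAut_snd : cubeAut i hi ≫ pullback.snd _ _ = pullback.snd _ _ ≫ curveAut i hi :=
  pullback.lift_snd _ _ _

lemma iterate_comp_eq {X Y : Scheme.{u}} {f : X ⟶ X} {g : Y ⟶ Y} {p : X ⟶ Y}
    (h : f ≫ p = p ≫ g) (hg : g ≫ g ≫ g ≫ g = 𝟙 Y) : (f ≫ f ≫ f ≫ f) ≫ p = 𝟙 X ≫ p := by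
  have h' : p ≫ g ≫ g ≫ g ≫ g = p := by rw [hg, Category.comp_id]
  have ha : ∀ {W : Scheme.{u}} (q : Y ⟶ W), f ≫ p ≫ q = p ≫ g ≫ q := fun q => by
    rw [← Category.assoc, h, Category.assoc]
  simp only [Category.assoc, Category.id_comp, h, ha, h']

lemma squareAut_iterate :
    squareAut i hi ≫ squareAut i hi ≫ squareAut i hi ≫ squareAut i hi = 𝟙 (square k) :=
  pullback.hom_ext (iterate_comp_eq (squareAut_fst i hi) (curveAut_iterate i hi))
    (iterate_comp_eq (squareAut_snd i hi) (curveAut_iterate i hi))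

lemma cubeAut_iterate :
    cubeAut i hi ≫ cubeAut i hi ≫ cubeAut i hi ≫ cubeAut i hi = 𝟙 (cube k) :=
  pullback.hom_ext (iterate_comp_eq (cubeAut_fst i hi) (squareAut_iterate i hi))
    (iterate_comp_eq (cubeAut_snd i hi) (curveAut_iterate i hi))

end OrderFour

/-! ### The chart of ratios on the quotient of the triple product -/

section RatioChart

variable {k : Type u} [Field k] (h2 : (2 : k) ≠ 0) (i : k) (hi : i ^ 2 = -1)

/-- The chart of the quotient of the triple product on which the ratios are coordinates. -/
def ratioChart : Spec (.of (RatioRing k)) ⟶ cubeQuotient i hi :=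
  StableAffine.quotientChart (cubeAut_iterate i hi) (rootAut i hi).toRingHom (rootChart k)
    (rootAut_rootChart i hi) (algebraMap (RatioRing k) (RootRing k))
    (of_injective_fourthRoot _) (rootAut_eq_iff i hi h2)

instance : IsOpenImmersion (ratioChart h2 i hi) :=
  StableAffine.isOpenImmersion_quotientChart _ _ _ _ _ _ _

instance : IsDominant (ratioChart h2 i hi) :=
  StableAffine.isDominant_quotientChart _ _ _ _ _ _ _

lemma ratioChart_toSpec : ratioChart h2 i hi ≫ cubeQuotientToSpec i hi =
    Spec.map (CommRingCat.ofHom (algebraMap k (RatioRing k))) := by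
  refine StableAffine.quotientChart_toSpec _ _ _ _ _ _ _ (cubeToSpec k) (cubeAut_toSpec i hi) _ ?_
  rw [rootChart_toSpec]
  rfl

end RatioChart

/-! ### Homogeneous basic opens of positive degree -/

section ProjBasis

variable {R A : Type u} [CommRing R] [CommRing A] [Algebra R A] {𝒜 : ℕ → Submodule R A}
  [GradedAlgebra 𝒜]

/-- Positive degree is ensured by multiplying a homogeneous component by the equation of an affine
chart containing x. -/
lemma exists_homogeneous_basicOpen_le {O : (Proj 𝒜).Opens} {x : Proj 𝒜} (hx : x ∈ O) :
    ∃ n, 0 < n ∧ ∃ F ∈ 𝒜 n, x ∈ Proj.basicOpen 𝒜 F ∧ Proj.basicOpen 𝒜 F ≤ O := by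
  obtain ⟨_, ⟨_, ⟨f, rfl⟩, rfl⟩, hxf, hfO⟩ :=
    (Proj.isBasis_basicOpen 𝒜).exists_subset_of_mem_open hx O.2
  replace hxf : x ∈ Proj.basicOpen 𝒜 f := hxf
  rw [Proj.basicOpen_eq_iSup_proj, Opens.mem_iSup] at hxf
  obtain ⟨m, hm⟩ := hxf
  obtain ⟨i, y, rfl⟩ := (Proj.affineOpenCover 𝒜).openCover.exists_eq x
  have hi : (Proj.affineOpenCover 𝒜).openCover.f i y ∈ Proj.basicOpen 𝒜 (i.2 : A) := by
    rw [← Proj.opensRange_awayι 𝒜 _ i.2.2 i.1.2]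
    exact ⟨y, rfl⟩
  refine ⟨m + i.1, Nat.add_pos_right _ i.1.2, GradedRing.proj 𝒜 m f * i.2,
    SetLike.mul_mem_graded (SetLike.coe_mem _) i.2.2, ?_, ?_⟩
  · rw [Proj.basicOpen_mul]
    exact ⟨hm, hi⟩
  · rw [Proj.basicOpen_mul]
    refine inf_le_left.trans (le_trans ?_ hfO)
    rw [Proj.basicOpen_eq_iSup_proj 𝒜 f]
    exact le_iSup (fun i => Proj.basicOpen 𝒜 (GradedRing.proj 𝒜 i f)) m

end ProjBasis

/-! ### Points of the Proj of a Rees algebra -/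

section ReesChart

open Polynomial

variable {R : Type u} [CommRing R] {I : Ideal R}

/-- The evaluation of the Rees algebra at `t = c`. -/
def reesEval {S : Type*} [CommRing S] (ρ : R →+* S) (c : S) : reesAlgebra I →+* S :=
  (eval₂RingHom ρ c).comp (reesAlgebra I).val.toRingHom

lemma reesEval_monomial {S : Type*} [CommRing S] (ρ : R →+* S) (c : S) (n : ℕ) (r : R)
    (hr : r ∈ I ^ n) : reesEval ρ c (reesMonomial n r hr) = ρ r * c ^ n :=
  eval₂_monomial ρ c

lemma reesEval_algebraMap {S : Type*} [CommRing S] (ρ : R →+* S) (c : S) :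
    (reesEval ρ c).comp (algebraMap R (reesAlgebra I)) = ρ :=
  RingHom.ext fun _ => eval₂_C ρ c

/-- A point of the base outside of the centre lifts to any open subset of the Rees chart on which
the equation is invertible. -/
lemma exists_mem_basicOpen_projToSpec_eq {n : ℕ} (hn : 0 < n) {r : R} (hr : r ∈ I ^ n)
    {p : PrimeSpectrum R} (hp : r ∉ p.asIdeal) :
    ∃ q ∈ Proj.basicOpen (reesGrading I) (reesMonomial n r hr),
      projToSpec (R := R) (reesGrading I) q = p := by
  have hrI : r ∈ I ^ 1 := Ideal.pow_le_pow_right hn hr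
  -- Evaluating t at c = 1/r sends rt to 1, which defines a section of Proj over D(r).
  obtain ⟨c, hc⟩ := (IsLocalization.Away.algebraMap_isUnit (S := Localization.Away r) r).exists_right_inv
  have hs : reesEval (I := I) (algebraMap R (Localization.Away r)) c (reesMonomial 1 r hrI) = 1 := by
    rw [reesEval_monomial, pow_one, hc]
  have hp' : p ∈ Set.range (PrimeSpectrum.comap (algebraMap R (Localization.Away r))) := by
    rw [PrimeSpectrum.localization_away_comap_range (Localization.Away r) r]
    exact hp
  obtain ⟨z, rfl⟩ := hp'
  refine ⟨projPoint _ (reesMonomial_mem 1 r hrI) one_pos hs z, ?_, ?_⟩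
  -- Since (rt)ⁿ = rⁿ⁻¹ · rtⁿ, non-vanishing of rt implies that of rtⁿ.
  · have h1 : Proj.basicOpen (reesGrading I) (reesMonomial 1 r hrI) ≤
        Proj.basicOpen (reesGrading I) (reesMonomial n r hr) := by
      rw [← Proj.basicOpen_pow (reesGrading I) (reesMonomial 1 r hrI) n hn]
      refine Proj.basicOpen_mono _ _ _ ⟨algebraMap R _ (r ^ (n - 1)), Subtype.ext ?_⟩
      change (monomial 1 r) ^ n = monomial n r * C (r ^ (n - 1))
      rw [monomial_pow, one_mul, monomial_mul_C, ← pow_succ', Nat.sub_add_cancel hn]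
    refine h1 ?_
    rw [← Proj.opensRange_awayι _ _ (reesMonomial_mem 1 r hrI) one_pos]
    exact ⟨_, rfl⟩
  · have := projPoint_toSpec (R := R) (reesEval (I := I) (algebraMap R (Localization.Away r)) c)
      (reesMonomial_mem 1 r hrI) one_pos hs
    rw [reesEval_algebraMap] at this
    exact congr($this z)

variable (hI : I = ⊤)

/-- The section of the blow-up of the unit ideal. -/
def reesSection : Spec (.of R) ⟶ Proj (reesGrading I) :=
  projPoint (reesEval (RingHom.id R) 1)
    (reesMonomial_mem 1 1 (by rw [hI, pow_one]; trivial)) one_pos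
    (by rw [reesEval_monomial, one_pow, mul_one, map_one])

lemma reesSection_toSpec : reesSection hI ≫ projToSpec (R := R) (reesGrading I) = 𝟙 _ := by
  refine (projPoint_toSpec _ _ _ _).trans ?_
  rw [reesEval_algebraMap]
  exact Spec.map_id _

/-- An element of degree n is rtⁿ, and its value r at t = 1 vanishes only if the element does. -/
lemma awayEval_reesEval_bijective (h : (1 : R) ∈ I ^ 1)
    (hs : reesEval (RingHom.id R) 1 (reesMonomial 1 1 h) = 1) :
    Function.Bijective (awayEval (𝒜 := reesGrading I) (reesEval (RingHom.id R) 1) hs) := by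
  constructor
  · rw [injective_iff_map_eq_zero]
    intro z hz
    obtain ⟨n, a, ha, rfl⟩ := HomogeneousLocalization.Away.mk_surjective (reesGrading I)
      (reesMonomial_mem 1 1 h) z
    rw [awayEval_mk] at hz
    have ha0 : a = 0 := by
      rw [eq_reesMonomial ha, reesEval_monomial, one_pow, mul_one] at hz
      rw [eq_reesMonomial ha]
      refine Subtype.ext ?_
      change monomial _ _ = _
      rw [show (a : R[X]).coeff (n • 1) = 0 from hz, monomial_zero_right]
      rfl
    subst ha0
    apply HomogeneousLocalization.val_injective
    rw [HomogeneousLocalization.Away.val_mk, HomogeneousLocalization.val_zero]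
    exact Localization.mk_zero _
  · intro r
    exact ⟨toAway _ _ r, (awayEval_toAway _ hs r).trans congr($(reesEval_algebraMap (I := I) (RingHom.id R) 1) r)⟩

instance : IsDominant (reesSection hI) := by
  refine isDominant_projPoint _ _ _ _ (awayEval_reesEval_bijective _ _) ?_
  -- The chart t ≠ 0 is dense because t is regular: multiplication by t only shifts coefficients.
  rw [mem_nonZeroDivisors_iff_right]
  intro a ha
  have ha' : (a : R[X]) * monomial 1 1 = 0 := congrArg Subtype.val ha
  rw [monomial_one_one_eq_X] at ha'
  refine Subtype.ext (?_ : (a : R[X]) = 0)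
  refine Polynomial.ext fun n => ?_
  simpa using congrArg (coeff · (n + 1)) ha'

end ReesChart

/-! ### Density and sections of the blow-up away from the centre -/

section BlowUpChart

open Scheme.AffineZariskiSite

variable {Y : Scheme.{u}} (J : Y.IdealSheafData)

/-- The inclusion of a chart of the blow-up. -/
def blowUpι (U : Y.AffineZariskiSite) : Proj (reesGrading (idealOn J U)) ⟶ blowUp J :=
  (blowUpGluingData J).cover.f U

lemma exists_blowUpι_eq (x : blowUp J) : ∃ U y, blowUpι J U y = x :=
  (blowUpGluingData J).cover.exists_eq x

lemma blowUpι_map (U : Y.AffineZariskiSite) :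
    blowUpι J U ≫ blowUpMap J = blowUpChart J U ≫ U.2.fromSpec := by
  refine ((blowUpGluingData J).ι_toBase U).trans ?_
  change (blowUpChart J U ≫ U.2.isoSpec.inv) ≫ U.1.ι = _
  rw [Category.assoc, IsAffineOpen.isoSpec_inv_ι]

lemma range_blowUpι (U : Y.AffineZariskiSite) :
    Set.range (blowUpι J U) = blowUpMap J ⁻¹' U.1 := by
  refine ((blowUpGluingData J).preimage_toBase_eq_range_ι U).symm.trans ?_
  congr 1
  exact Scheme.Opens.range_ι _

/-- The preimage of a dense affine open in the blow-up is dense. -/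
lemma dense_range_blowUpι (V : Y.AffineZariskiSite) (hV : Dense (V.1 : Set Y)) :
    Dense (Set.range (blowUpι J V)) := by
  rw [range_blowUpι]
  refine dense_iff_inter_open.mpr fun O hO ⟨x, hx⟩ => ?_
  obtain ⟨U, y, rfl⟩ := exists_blowUpι_eq J x
  obtain ⟨n, hn, F, hF, hyF, hFO⟩ := exists_homogeneous_basicOpen_le
    (O := blowUpι J U ⁻¹ᵁ ⟨O, hO⟩) (x := y) hx
  obtain ⟨r, hr, rfl⟩ : ∃ r, ∃ hr : r ∈ idealOn J U ^ n, F = reesMonomial n r hr :=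
    ⟨_, _, eq_reesMonomial hF⟩
  -- Otherwise rtⁿ would be nilpotent and would lie in the prime of y.
  have hnil : ¬ IsNilpotent r := by
    rintro ⟨N, hN⟩
    have : reesMonomial n r hr ^ N = 0 := Subtype.ext (by
      change (Polynomial.monomial n r) ^ N = 0
      rw [Polynomial.monomial_pow, hN, Polynomial.monomial_zero_right])
    refine (show reesMonomial n r hr ∉ y.asHomogeneousIdeal from hyF)
      (y.isPrime.mem_of_pow_mem N ?_)
    rw [this]
    exact zero_mem _
  have hne : Y.basicOpen r ≠ ⊥ := fun h => hnil
    ((Scheme.isNilpotent_iff_basicOpen_eq_bot_of_isCompact U.2.isCompact r).mpr h)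
  obtain ⟨p, hp⟩ := (Opens.ne_bot_iff_nonempty _).mp hne
  -- The nonempty open set D(r) meets the dense V, and a point of D(r) lifts into D(rtⁿ), hence into
  -- the given open set.
  obtain ⟨p, hp, hpV⟩ := hV.inter_open_nonempty _ (Y.basicOpen r).2 ⟨p, hp⟩
  obtain ⟨p, rfl⟩ : p ∈ Set.range U.2.fromSpec := by
    rw [IsAffineOpen.range_fromSpec]
    exact Y.basicOpen_le r hp
  have hp' : r ∉ p.asIdeal := by
    have h : p ∈ U.2.fromSpec ⁻¹ᵁ Y.basicOpen r := hp
    rw [U.2.fromSpec_preimage_basicOpen] at h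
    exact h
  obtain ⟨q, hqF, hqp⟩ := exists_mem_basicOpen_projToSpec_eq hn hr hp'
  refine ⟨blowUpι J U q, hFO hqF, ?_⟩
  have h : blowUpMap J (blowUpι J U q) = U.2.fromSpec (blowUpChart J U q) :=
    congr($(blowUpι_map J U) q)
  have h' : blowUpChart J U q = p := hqp
  rw [Set.mem_preimage, h, h']
  exact hpV

variable (V : Y.AffineZariskiSite) (hJ : idealOn J V = ⊤)

/-- The section of the blow-up over an affine open outside of the centre. -/
def blowUpSection : Spec Γ(Y, V.1) ⟶ blowUp J := reesSection hJ ≫ blowUpι J V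

lemma blowUpSection_map : blowUpSection J V hJ ≫ blowUpMap J = V.2.fromSpec := by
  rw [blowUpSection, Category.assoc, blowUpι_map, ← Category.assoc]
  exact congr($(reesSection_toSpec hJ) ≫ V.2.fromSpec).trans (Category.id_comp _)

lemma isDominant_blowUpSection (hV : Dense (V.1 : Set Y)) : IsDominant (blowUpSection J V hJ) := by
  have : IsDominant (blowUpι J V) := ⟨dense_range_blowUpι J V hV⟩
  rw [blowUpSection]
  exact inferInstanceAs (IsDominant (reesSection hJ ≫ blowUpι J V))

lemma idealOn_vanishingIdeal_eq_top (Z : Closeds Y) (h : Disjoint (Z : Set Y) V.1) :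
    idealOn (Scheme.IdealSheafData.vanishingIdeal Z) V = ⊤ := by
  change PrimeSpectrum.vanishingIdeal (V.2.fromSpec ⁻¹' Z) = ⊤
  rw [PrimeSpectrum.vanishingIdeal_eq_top_iff]
  refine Set.eq_empty_of_forall_notMem fun x hx => ?_
  refine h.le_bot ⟨hx, ?_⟩
  have : V.2.fromSpec x ∈ Set.range V.2.fromSpec := ⟨x, rfl⟩
  rwa [IsAffineOpen.range_fromSpec] at this

end BlowUpChart

/-! ### Rational maps from dense open subschemes -/

section RationalMaps

variable {W P X S : Scheme.{u}}

/-- A dominant morphism over `S` from a dense open subscheme defines a dominant rational map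
over `S`. -/
lemma exists_rationalMap (j : W ⟶ P) [IsOpenImmersion j] [IsDominant j] (F : W ⟶ X) [IsDominant F]
    (sP : P ⟶ S) (sX : X ⟶ S) (h : F ≫ sX = j ≫ sP) :
    ∃ f : P ⤏ X, f.IsDominant ∧ f.compHom sX = sP.toRationalMap := by
  let f : P.PartialMap X := ⟨j.opensRange, j.denseRange, j.isoOpensRange.inv ≫ F⟩
  refine ⟨f.toRationalMap, ?_, ?_⟩
  · rw [Scheme.PartialMap.isDominant_toRationalMap_iff]
    exact inferInstanceAs (IsDominant (j.isoOpensRange.inv ≫ F))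
  · rw [← Scheme.RationalMap.compHom_toRationalMap]
    refine Scheme.PartialMap.toRationalMap_eq_iff.mpr
      ⟨j.opensRange, j.denseRange, le_rfl, le_top, ?_⟩
    have h1 : (j.isoOpensRange.inv ≫ F) ≫ sX = j.opensRange.ι ≫ sP := by
      rw [Category.assoc, h, ← Category.assoc, Scheme.Hom.isoOpensRange_inv_comp]
    have h2 : P.homOfLE (le_refl j.opensRange) ≫ (j.isoOpensRange.inv ≫ F) ≫ sX =
        P.homOfLE (le_top : j.opensRange ≤ ⊤) ≫ P.topIso.hom ≫ sP := by
      rw [h1, Scheme.homOfLE_rfl, Category.id_comp, Scheme.topIso_hom, Scheme.homOfLE_ι_assoc]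
    exact h2

end RationalMaps

/-! ### Lifting a smooth chart to the blow-up of the singular locus -/

section Lift

variable {Y S : Scheme.{u}}

lemma disjoint_singularLocus (s : Y ⟶ S) (V : Y.Opens) (h : Smooth (V.ι ≫ s)) :
    Disjoint (singularLocus s : Set Y) V := by
  have hV : V ≤ ⨆ U : {U : Y.Opens // Smooth (U.ι ≫ s)}, U.1 :=
    le_iSup (fun U : {U : Y.Opens // Smooth (U.ι ≫ s)} => U.1) ⟨V, h⟩
  exact Set.disjoint_compl_left_iff_subset.mpr hV

/-- A dense smooth affine chart lifts to the blow-up of the singular locus. -/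
lemma exists_lift_blowUp {R : CommRingCat.{u}} (s : Y ⟶ S) (c : Spec R ⟶ Y) [IsOpenImmersion c]
    [IsDominant c] [Smooth (c ≫ s)] :
    ∃ t : Spec R ⟶ blowUp (Scheme.IdealSheafData.vanishingIdeal (singularLocus s)),
      IsDominant t ∧ t ≫ blowUpMap _ = c := by
  let V : Y.AffineZariskiSite := ⟨c.opensRange, isAffineOpen_opensRange c⟩
  have hs : Smooth (V.1.ι ≫ s) := by
    have h1 : Smooth (c.isoOpensRange.inv ≫ c ≫ s) := inferInstance
    rwa [← Category.assoc, Scheme.Hom.isoOpensRange_inv_comp] at h1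
  -- Smoothness of the chart makes its range miss the centre, so the ideal there is the unit ideal
  -- and the blow-up has a section over it.
  have hJ := idealOn_vanishingIdeal_eq_top V _ (disjoint_singularLocus s V.1 hs)
  have := isDominant_blowUpSection _ V hJ c.denseRange
  have hr : Set.range c = Set.range V.2.fromSpec := V.2.range_fromSpec.symm
  let κ : Spec R ⟶ Spec Γ(Y, V.1) := IsOpenImmersion.lift V.2.fromSpec c hr.le
  have hκ : κ ≫ V.2.fromSpec = c := IsOpenImmersion.lift_fac ..
  have hd : IsDominant κ := ⟨Function.Surjective.denseRange fun x => by
    obtain ⟨y, hy⟩ : V.2.fromSpec x ∈ Set.range c := hr.ge ⟨x, rfl⟩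
    refine ⟨y, V.2.fromSpec.isOpenEmbedding.injective ?_⟩
    rw [← hy]
    exact congr($hκ y)⟩
  refine ⟨κ ≫ blowUpSection _ V hJ, inferInstance, ?_⟩
  rw [Category.assoc, blowUpSection_map, hκ]

end Lift

/-! ### The parametrized chart of the threefold -/

section Unirational

variable {k : Type u} [Field k]

lemma smooth_ratioRing (h2 : (2 : k) ≠ 0) :
    Smooth (Spec.map (CommRingCat.ofHom (algebraMap k (RatioRing k)))) := by
  rw [HasRingHomProperty.Spec_iff (P := @Smooth)]
  have := RatioRing.smooth h2
  exact RingHom.smooth_algebraMap.mpr this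

instance : IsDominant (Spec.map (CommRingCat.ofHom
    (algebraMap (MvPolynomial (Fin 3) k) (ParamRing k)))) :=
  isDominant_of_isLocalization_away _ (mem_nonZeroDivisors_of_ne_zero (paramDiscr_ne_zero k))

instance : IsOpenImmersion (Spec.map (CommRingCat.ofHom
    (algebraMap (MvPolynomial (Fin 3) k) (ParamRing k)))) :=
  IsOpenImmersion.of_isLocalization (S := ParamRing k)
    (paramDiscr (MvPolynomial.X 0 : MvPolynomial (Fin 3) k) (MvPolynomial.X 1) (MvPolynomial.X 2))

/-- The chart of the quotient lifts to the threefold. -/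
lemma exists_chart_uenoCampana (h2 : (2 : k) ≠ 0) (i : k) (hi : i ^ 2 = -1) :
    ∃ t : Spec (.of (RatioRing k)) ⟶ uenoCampana i hi, IsDominant t ∧
      t ≫ uenoCampanaToSpec i hi = Spec.map (CommRingCat.ofHom (algebraMap k (RatioRing k))) := by
  have : Smooth (ratioChart h2 i hi ≫ cubeQuotientToSpec i hi) := by
    rw [ratioChart_toSpec]
    exact smooth_ratioRing h2
  obtain ⟨t, ht, htc⟩ := exists_lift_blowUp (cubeQuotientToSpec i hi) (ratioChart h2 i hi)
  exact ⟨t, ht, (Category.assoc _ _ _).symm.trans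
    (congr($htc ≫ cubeQuotientToSpec i hi).trans (ratioChart_toSpec h2 i hi))⟩

end Unirational

end

end UenoCampana


open AlgebraicGeometry

theorem theorem1 {k : Type*} [Field k] (h2 : (2 : k) ≠ 0) (i : k) (hi : i ^ 2 = -1) :
    ∃ f : UenoCampana.projectiveSpace k 3 ⤏ UenoCampana.uenoCampana i hi,
      f.IsDominant ∧
      f.compHom (UenoCampana.uenoCampanaToSpec i hi) =
        (UenoCampana.projectiveSpaceToSpec k 3).toRationalMap := by
  open CategoryTheory UenoCampana in
  obtain ⟨t, ht, htc⟩ := exists_chart_uenoCampana h2 i hi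
  obtain ⟨f, hf⟩ := exists_parametrization k h2
  have : IsDominant (Spec.map (CommRingCat.ofHom f.toRingHom)) := ⟨hf.denseRange⟩
  -- The domain of definition is the locus of affine 3-space where the discriminant of the
  -- parametrization is nonzero, viewed as a dense open subset of projective space.
  refine exists_rationalMap (Spec.map (CommRingCat.ofHom
    (algebraMap (MvPolynomial (Fin 3) k) (ParamRing k))) ≫ affineChart k 3)
    (Spec.map (CommRingCat.ofHom f.toRingHom) ≫ t) _ _ ?_
  rw [Category.assoc, Category.assoc, affineChart_toSpec, htc, ← Spec.map_comp, ← Spec.map_comp,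
    ← CommRingCat.ofHom_comp, ← CommRingCat.ofHom_comp]
  congr 2
  exact f.comp_algebraMap.trans (IsScalarTower.algebraMap_eq _ _ _)
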